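/- Let $d\ge 2$, $p\in\,]d,\infty[$ and $\eta>0$. Let $\mathbb L^{\infty,p}$ be the space of continuous bounded vector fields $Y:\mathbb R^d\to\mathbb R^d$ whose distributional gradient $\nabla Y$ belongs to $L^p(\mathbb R^d)$. For an integer $m\ge d-1$ and a family $\mathcal X=(X_\lambda)_{1\le\lambda\le m}$ of vector fields in $\mathbb L^{\infty,p}$, set $$I(\mathcal X):=\inf_{x\in\mathbb R^d}\ \sup_{\Lambda}\ \Bigl|\stackrel{d-1}{\wedge}X_\Lambda(x)\Bigr|^{\frac1{d-1}},$$ where $\Lambda=(\lambda_1<\dots<\lambda_{d-1})$ runs over the strictly increasing $(d-1)$-tuples in $\{1,\dots,m\}$ and $\stackrel{d-1}{\wedge}X_\Lambda(x)$ is the unique vector of $\mathbb R^d$ such that $\bigl(\stackrel{d-1}{\wedge}X_\Lambda(x)\bigr)\cdot Y=\det\bigl(X_{\lambda_1}(x),\dots,X_{\lambda_{d-1}}(x),Y\bigr)$ for all $Y\in\mathbb R^d$. The family is called non-degenerate if $I(\mathcal X)>0$. For a normed space $E$ write $|||\mathcal X|||_E:=\sup_{1\le\lambda\le m}\|X_\lambda\|_E$,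 and similarly for $|||\nabla\mathcal X|||_E$. If $g\in L^\infty(\mathbb R^d)$ (real- or complex-valued) is such that $\operatorname{div}(gX_\lambda)\in L^p(\mathbb R^d)$ (divergence in the sense of distributions) for all $\lambda$, put $\partial_{X_\lambda}g:=\operatorname{div}(gX_\lambda)-g\operatorname{div}X_\lambda$ and $|||\partial_{\mathcal X}g|||_{L^p}:=\sup_{1\le\lambda\le m}\|\partial_{X_\lambda}g\|_{L^p}$. Then there is a constant $C>0$, depending only on $d$, $p$ and $\eta$, such that for every integer $m\ge d-1$, every non-degenerate family $\mathcal X=(X_\lambda)_{1\le\lambda\le m}$ of vector fields in $\mathbb L^{\infty,p}$ and every $g\in L^\infty(\mathbb R^d)$ with $\operatorname{div}(gX_\lambda)\in L^p(\mathbb R^d)$ for all $1\le\lambda\le m$, the matrix-valued distribution $\nabla^2(\eta\operatorname{Id}-\Delta)^{-1}g$ (where $(\eta\operatorname{Id}-\Delta)^{-1}$ is the Fourier multiplier on tempered distributions which inverts $\eta\operatorname{Id}-\Delta$) belongs to $L^\infty(\mathbb R^d)$, and $$\bigl\|\nabla^2(\eta\operatorname{Id}-\Delta)^{-1}g\bigr\|_{L^\infty}\le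 C\left(\left(1+\frac{|||\mathcal X|||_{L^\infty}^{4d-5}\,|||\nabla\mathcal X|||_{L^p}}{I(\mathcal X)^{4d-4}}\right)\|g\|_{L^\infty}+\frac{|||\mathcal X|||_{L^\infty}^{4d-5}}{I(\mathcal X)^{4d-4}}\,|||\partial_{\mathcal X}g|||_{L^p}\right).$$ -/

import Mathlib

open MeasureTheory LineDeriv Laplacian
open scoped ENNReal NNReal ContDiff SchwartzMap

/-- The Euclidean space `ℝ^d`. -/
abbrev Eu (d : ℕ) : Type := EuclideanSpace ℝ (Fin d)

/-! ### Weak derivatives, the spaces of vector fields, and derivatives along vector fields -/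

/-- `D` is the (weak, distributional) gradient of the vector field `Y` on `ℝ^d`; here `D x v`
stands for the derivative of `Y` in the direction `v`. -/
def HasWeakGradient {d : ℕ} (Y : Eu d → Eu d) (D : Eu d → (Eu d →L[ℝ] Eu d)) : Prop :=
  LocallyIntegrable Y volume ∧ LocallyIntegrable D volume ∧
    ∀ φ : Eu d → ℝ, ContDiff ℝ ∞ φ → HasCompactSupport φ → ∀ v : Eu d,
      ∫ x, (fderiv ℝ φ x v) • Y x = - ∫ x, φ x • D x v

/-- `w = div (g Y)` in the sense of distributions, that is
`∫ g Y · ∇φ = - ∫ φ w` for all test functions `φ`. -/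
def HasWeakDiv {d : ℕ} (g : Eu d → ℂ) (Y : Eu d → Eu d) (w : Eu d → ℂ) : Prop :=
  (∀ i, LocallyIntegrable (fun x => (Y x i) • g x) volume) ∧ LocallyIntegrable w volume ∧
    ∀ φ : Eu d → ℝ, ContDiff ℝ ∞ φ → HasCompactSupport φ →
      ∫ x, (fderiv ℝ φ x (Y x)) • g x = - ∫ x, φ x • w x

/-- The space `𝕃^{∞,p}` of continuous bounded vector fields with gradient in `L^p`. -/
def MemLInfP {d : ℕ} (p : ℝ≥0∞) (Y : Eu d → Eu d) : Prop :=
  Continuous Y ∧ (∃ K : ℝ, ∀ x, ‖Y x‖ ≤ K) ∧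
    ∃ D : Eu d → (Eu d →L[ℝ] Eu d), HasWeakGradient Y D ∧ MemLp D p volume

/-- `g ∈ 𝕃^p_Y`: the bounded function `g` is of class `L^p` along `Y`, i.e.
`div (g Y) ∈ L^p`. -/
def MemLAlong {d : ℕ} (p : ℝ≥0∞) (Y : Eu d → Eu d) (g : Eu d → ℂ) : Prop :=
  MemLp g ⊤ volume ∧ ∃ w : Eu d → ℂ, HasWeakDiv g Y w ∧ MemLp w p volume

open Classical in
/-- The weak gradient of `Y` (determined up to a null set), and `0` if there is none. -/
noncomputable def weakGradient {d : ℕ} (Y : Eu d → Eu d) : Eu d → (Eu d →L[ℝ] Eu d) :=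
  if h : ∃ D, HasWeakGradient Y D then h.choose else 0

open Classical in
/-- The function `div (g Y)` (determined up to a null set), and `0` if there is none. -/
noncomputable def weakDiv {d : ℕ} (g : Eu d → ℂ) (Y : Eu d → Eu d) : Eu d → ℂ :=
  if h : ∃ w, HasWeakDiv g Y w then h.choose else 0

/-- `∂_Y g := div (g Y) - g div Y`, the divergence of `Y` being the trace of its gradient. -/
noncomputable def derivAlong {d : ℕ} (Y : Eu d → Eu d) (g : Eu d → ℂ) : Eu d → ℂ :=
  fun x => weakDiv g Y x -
    g x * ((LinearMap.trace ℝ (Eu d) (weakGradient Y x : Eu d →ₗ[ℝ] Eu d) : ℝ) : ℂ)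

/-! ### Families of vector fields -/

/-- The `d × d` matrix with columns `v_1, …, v_{d-1}, y`. -/
def colMatrix {d : ℕ} (v : Fin (d - 1) → Eu d) (y : Eu d) : Matrix (Fin d) (Fin d) ℝ :=
  Matrix.of fun i j => if h : (j : ℕ) < d - 1 then v ⟨j, h⟩ i else y i

/-- The wedge product of `v_1, …, v_{d-1}`: the vector `w` with
`w · y = det (v_1, …, v_{d-1}, y)` for all `y`, given by its coordinates. -/
noncomputable def wedge {d : ℕ} (v : Fin (d - 1) → Eu d) : Eu d :=
  WithLp.toLp 2 fun i => (colMatrix v (EuclideanSpace.single i 1)).det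

/-- The defining property of the wedge product. -/
theorem inner_wedge {d : ℕ} (hd : 1 ≤ d) (v : Fin (d - 1) → Eu d) (y : Eu d) :
    inner ℝ (wedge v) y = (colMatrix v y).det := by
  have key : ∀ z : Eu d, colMatrix v z =
      (colMatrix v 0).updateCol ⟨d - 1, by omega⟩ (fun i => z i) := by
    intro z
    ext i j
    by_cases h : (j : ℕ) < d - 1
    · have : j ≠ ⟨d - 1, by omega⟩ := by
        intro h'
        rw [h'] at h
        simp at h
      simp [colMatrix, h, this]
    · have : j = ⟨d - 1, by omega⟩ := by
        ext
        simp only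
        omega
      rw [this]
      simp [colMatrix]
  have hl : ∀ z : Eu d, (colMatrix v z).det =
      Matrix.cramer (colMatrix v 0) (fun i => z i) ⟨d - 1, by omega⟩ := by
    intro z
    rw [Matrix.cramer_apply, key z]
  rw [hl y]
  have hy : (fun i => y i) = ∑ i, y i • (fun k => (EuclideanSpace.single i (1 : ℝ) : Eu d) k) := by
    ext k
    simp [Finset.sum_apply]
  rw [hy, map_sum, Finset.sum_apply]
  simp only [map_smul, Pi.smul_apply, smul_eq_mul, ← hl]
  simp [wedge, PiLp.inner_apply]

/-- `I(𝒳) = inf_x sup_Λ |∧ X_Λ(x)|^{1/(d-1)}`, where `Λ = (λ_1 < ⋯ < λ_{d-1})` runs over the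
strictly increasing `(d-1)`-tuples of indices. The family is non-degenerate if `I(𝒳) > 0`. -/
noncomputable def nonDegeneracy {d m : ℕ} (X : Fin m → Eu d → Eu d) : ℝ :=
  ⨅ x : Eu d, ⨆ Λ : Fin (d - 1) ↪o Fin m,
    ‖wedge (fun k => X (Λ k) x)‖ ^ (1 / ((d : ℝ) - 1))

/-! ### The operators `(η Id - Δ)⁻¹` and `∇²` -/

/-- The symbol of `(η Id - Δ)⁻¹`, for the Fourier transform `∫ e^{-2πi x·ξ} f(x) dx`. -/
noncomputable def resolventSymbol (d : ℕ) (η : ℝ) : Eu d → ℂ :=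
  fun ξ => (((η + (2 * Real.pi) ^ 2 * ‖ξ‖ ^ 2)⁻¹ : ℝ) : ℂ)

/-- `(η Id - Δ)⁻¹` as a Fourier multiplier on tempered distributions. -/
noncomputable def helmholtzInv {d : ℕ} (η : ℝ) (T : 𝓢'(Eu d, ℂ)) : 𝓢'(Eu d, ℂ) :=
  TemperedDistribution.fourierMultiplierCLM ℂ (resolventSymbol d η) T

/-- The bounded matrix field `H` is the Hessian `∇² T` of the tempered distribution `T`. Matrices
carry the Hilbert-Schmidt norm. -/
def IsBoundedHessian {d : ℕ} (T : 𝓢'(Eu d, ℂ))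
    (H : Eu d → EuclideanSpace ℂ (Fin d × Fin d)) : Prop :=
  MemLp H ⊤ volume ∧ ∀ (i j : Fin d) (φ : 𝓢(Eu d, ℂ)),
    (∂_{(EuclideanSpace.single i 1 : Eu d)} (∂_{(EuclideanSpace.single j 1 : Eu d)} T)) φ =
      ∫ x, φ x * H x (i, j)

theorem resolventSymbol_hasTemperateGrowth (d : ℕ) {η : ℝ} (hη : 0 < η) :
    (resolventSymbol d η).HasTemperateGrowth := by
  have h1 : (fun ξ : Eu d => (1 + ‖ξ‖ ^ 2) ^ (-1 : ℝ)).HasTemperateGrowth :=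
    Function.hasTemperateGrowth_one_add_norm_sq_rpow (Eu d) (-1)
  have h2 := h1.comp
    (((2 * Real.pi / Real.sqrt η) • ContinuousLinearMap.id ℝ (Eu d)).hasTemperateGrowth)
  have h3 := Function.Complex.hasTemperateGrowth_ofReal.comp
    ((Function.HasTemperateGrowth.const (E := Eu d) η⁻¹).mul h2)
  have h4 : resolventSymbol d η = Complex.ofReal ∘ ((fun _ : Eu d => η⁻¹) *
      (fun ξ : Eu d => (1 + ‖ξ‖ ^ 2) ^ (-1 : ℝ)) ∘
        ((2 * Real.pi / Real.sqrt η) • ContinuousLinearMap.id ℝ (Eu d))) := by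
    ext ξ
    simp only [resolventSymbol, Function.comp_apply, Pi.mul_apply]
    congr 1
    simp only [FunLike.coe_smul, Pi.smul_apply, ContinuousLinearMap.id_apply, norm_smul,
      Real.rpow_neg_one, ← mul_inv, mul_pow, Real.norm_eq_abs, sq_abs, div_pow,
      Real.sq_sqrt hη.le]
    congr 1
    field_simp
  rw [h4]
  exact h3

/-- The operator `helmholtzInv η` is a right inverse of `η Id - Δ` on tempered distributions. -/
theorem sub_laplacian_helmholtzInv {d : ℕ} {η : ℝ} (hη : 0 < η) (T : 𝓢'(Eu d, ℂ)) :
    (η : ℂ) • helmholtzInv η T - Δ (helmholtzInv η T) = T := by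
  have hs := resolventSymbol_hasTemperateGrowth d hη
  have hn : (fun x : Eu d => Complex.ofReal (‖x‖ ^ 2)).HasTemperateGrowth := by fun_prop
  have hsn := hs.mul hn
  have key : ((η : ℂ) • resolventSymbol d η +
      (((2 * Real.pi) ^ 2 : ℝ) : ℂ) •
        (resolventSymbol d η * fun x : Eu d => Complex.ofReal (‖x‖ ^ 2))) = fun _ => 1 := by
    ext x
    have hx : η + (2 * Real.pi) ^ 2 * ‖x‖ ^ 2 ≠ 0 := by positivity
    simp only [resolventSymbol, Pi.add_apply, Pi.smul_apply, Pi.mul_apply, smul_eq_mul]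
    norm_cast
    field_simp
  have hc1 : ((η : ℂ) • resolventSymbol d η).HasTemperateGrowth :=
    (Function.HasTemperateGrowth.const (E := Eu d) (η : ℂ)).mul hs
  have hc2 : ((((2 * Real.pi) ^ 2 : ℝ) : ℂ) •
      (resolventSymbol d η * fun x : Eu d => Complex.ofReal (‖x‖ ^ 2))).HasTemperateGrowth :=
    (Function.HasTemperateGrowth.const (E := Eu d) (((2 * Real.pi) ^ 2 : ℝ) : ℂ)).mul hsn
  have hadd := TemperedDistribution.smulLeftCLM_add (F := ℂ) hc1 hc2
  rw [key] at hadd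
  rw [TemperedDistribution.laplacian_eq_fourierMultiplierCLM, helmholtzInv,
    TemperedDistribution.fourierMultiplierCLM_fourierMultiplierCLM_apply hs hn,
    neg_smul, sub_neg_eq_add, ← Complex.coe_smul ((2 * Real.pi) ^ 2),
    ← _root_.smul_apply, ← _root_.smul_apply,
    ← TemperedDistribution.fourierMultiplierCLM_smul hs,
    ← TemperedDistribution.fourierMultiplierCLM_smul hsn]
  simp only [TemperedDistribution.fourierMultiplierCLM_apply]
  rw [← FourierTransform.fourierInv_add, ← _root_.add_apply, ← hadd]
  simp

/-! Since `(η - Δ)⁻¹ = ∫₀^∞ e^{-ηt} e^{tΔ} dt`, the Hessian of `(η - Δ)⁻¹ g` is the time integral of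
`e^{-ηt} ∂_a ∂_b e^{tΔ} g`. For a merely bounded `g` the integrand is only `O(1/t)` near `0`, which
diverges logarithmically: second derivatives are not bounded on `L^∞`. Two families of entries
escape this.

The trace is harmless: by the heat equation `e^{-ηt} Δ e^{tΔ} g` is an exact time derivative plus `η
e^{-ηt} e^{tΔ} g`, hence a bound `3 ‖g‖_∞` (`norm_sum_heatHessian_le`).

The entries `(a, Y(x))`, with one direction given by a field `Y` of the family frozen at the point
`x`, gain a power of `t` (`norm_integral_hheat_field_le`). Under the convolution, write `Y(x) =
(Y(x) - Y(y)) + Y(y)`. The part with `Y(y)` is integrated by parts: one derivative leaves the kernel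
and produces `div (g Y)` in `L^p`, at a cost `t^{-1/2 - d/(2p)}`. In the other part, Morrey's
inequality (`norm_sub_le_morrey`) bounds `Y(x) - Y(y)` by `‖∇Y‖_p t^{1/2 - d/(2p)} (1 + |x -
y|/√t)`, and the Gaussian absorbs the last factor; the cost is again `t^{-1/2 - d/(2p)}`. As `p >
d`, this is integrable at `0`.

These entries suffice. A symmetric bilinear form on `ℝ^d` is determined by its trace and its values
on pairs with one vector among `d - 1` independent vectors, because the only missing value, that on
`(W, W)` with `W` the wedge product, is read off from the trace (`exists_coeff_of_wedge_ne_zero`).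
Non-degeneracy supplies such vectors at every `x`, with a quantitative lower bound on `|W|`. Only `d
- 1` fields are used at each point, so the constant does not depend on `m`.

To make this rigorous the time integral is cut to `[ε, R]`. The truncated Hessians are bounded
uniformly in the cut-off and converge almost everywhere, the trace needing Lebesgue points of `g`
(`ae_tendsto_integral_heat_smul`). Duality with Schwartz functions identifies the limit with the
distributional Hessian (`integral_mul_heatHessian`, `exists_boundedHessian`). -/

open Filter Topology

/-! ### The heat kernel -/

/-- The heat kernel `(4πt)^{-d/2} exp(-|z|²/(4t))`. -/
noncomputable def heat {d : ℕ} (t : ℝ) (z : Eu d) : ℝ :=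
  (4 * Real.pi * t) ^ (-((d : ℝ) / 2)) * Real.exp (-(‖z‖ ^ 2) / (4 * t))

/-- The derivative of the heat kernel in the direction `a`. -/
noncomputable def dheat {d : ℕ} (t : ℝ) (a z : Eu d) : ℝ :=
  -(inner ℝ z a / (2 * t)) * heat t z

/-- The second derivative of the heat kernel in the directions `a` and `b`. -/
noncomputable def hheat {d : ℕ} (t : ℝ) (a b z : Eu d) : ℝ :=
  (inner ℝ z a * inner ℝ z b / (4 * t ^ 2) - inner ℝ a b / (2 * t)) * heat t z

section HeatKernel

variable {d : ℕ} {t : ℝ}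

theorem heat_pos (ht : 0 < t) (z : Eu d) : 0 < heat t z := by
  unfold heat; positivity

theorem heat_neg (t : ℝ) (z : Eu d) : heat t (-z) = heat t z := by simp [heat]

theorem hheat_neg (t : ℝ) (a b z : Eu d) : hheat t a b (-z) = hheat t a b z := by
  simp [hheat, heat_neg]

theorem measurable_heat : Measurable fun q : ℝ × Eu d => heat q.1 q.2 := by
  unfold heat; fun_prop

theorem measurable_hheat (a b : Eu d) : Measurable fun q : ℝ × Eu d => hheat q.1 a b q.2 := by
  have := measurable_heat (d := d)
  unfold hheat; fun_prop

theorem contDiff_heat (t : ℝ) : ContDiff ℝ ∞ fun z : Eu d => heat t z := by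
  unfold heat
  exact contDiff_const.mul (Real.contDiff_exp.comp ((contDiff_norm_sq ℝ).neg.div_const _))

theorem contDiff_dheat (t : ℝ) (a : Eu d) : ContDiff ℝ ∞ fun z : Eu d => dheat t a z := by
  unfold dheat
  exact (((contDiff_id.inner ℝ contDiff_const).div_const _).neg).mul (contDiff_heat t)

theorem continuous_heat (t : ℝ) : Continuous fun z : Eu d => heat t z :=
  (contDiff_heat t).continuous

theorem continuous_dheat (t : ℝ) (a : Eu d) : Continuous fun z : Eu d => dheat t a z :=
  (contDiff_dheat t a).continuous

theorem continuous_hheat (t : ℝ) (a b : Eu d) : Continuous fun z : Eu d => hheat t a b z := by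
  have := continuous_heat (d := d) t
  unfold hheat
  fun_prop

theorem integrable_heat (ht : 0 < t) : Integrable fun z : Eu d => heat t z := by
  unfold heat
  apply Integrable.const_mul
  have hb : 0 < 1 / (4 * t) := by positivity
  have := GaussianFourier.integrable_cexp_neg_mul_sq_norm_add (V := Eu d) (b := (1 / (4 * t) : ℝ))
    (by simpa using hb) 0 0
  have := this.re
  refine this.congr (Filter.Eventually.of_forall fun z => ?_)
  simp only [inner_zero_left, Complex.ofReal_zero, mul_zero, add_zero]
  have h : (-((1 / (4 * t) : ℝ) : ℂ) * (‖z‖ : ℂ) ^ 2) = ((-(‖z‖ ^ 2) / (4 * t) : ℝ) : ℂ) := by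
    push_cast; ring
  rw [h, ← Complex.ofReal_exp]
  exact Complex.ofReal_re _

theorem integral_heat (ht : 0 < t) : ∫ z : Eu d, heat t z = 1 := by
  unfold heat
  rw [integral_const_mul]
  have hb : 0 < 1 / (4 * t) := by positivity
  have h := GaussianFourier.integral_rexp_neg_mul_sq_norm (V := Eu d) hb
  have h2 : (fun z : Eu d => Real.exp (-(‖z‖ ^ 2) / (4 * t))) =
      fun z => Real.exp (-(1 / (4 * t)) * ‖z‖ ^ 2) := by
    ext z; congr 1; ring
  rw [h2, h, finrank_euclideanSpace_fin]
  have h3 : Real.pi / (1 / (4 * t)) = 4 * Real.pi * t := by field_simp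
  rw [h3, ← Real.rpow_add (by positivity)]
  simp

theorem heat_le (ht : 0 < t) (z : Eu d) : heat t z ≤ (4 * Real.pi * t) ^ (-((d : ℝ) / 2)) := by
  unfold heat
  apply mul_le_of_le_one_right (by positivity)
  rw [Real.exp_le_one_iff]
  exact div_nonpos_of_nonpos_of_nonneg (by simp) (by positivity)

/-- The constant in the pointwise bounds of the derivatives of the heat kernel. -/
noncomputable def heatConst (d : ℕ) : ℝ := 512 * 2 ^ ((d : ℝ) / 2)

theorem heatConst_pos (d : ℕ) : 0 < heatConst d := by unfold heatConst; positivity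

/-- With `s = ‖z‖/√t`, the quotient of the kernels at times `t` and `2t` is `2^{d/2} e^{-s²/8}`,
which absorbs any polynomial in `s`. Degree three is what a second derivative (degree two) times `1
+ s` requires. -/
theorem poly_mul_heat_le (ht : 0 < t) (z : Eu d) :
    (1 + ‖z‖ / √t + (‖z‖ / √t) ^ 2 + (‖z‖ / √t) ^ 3) * heat t z ≤ heatConst d * heat (2 * t) z := by
  set s := ‖z‖ / √t with hs
  have hs0 : 0 ≤ s := by positivity
  have hz : ‖z‖ ^ 2 = s ^ 2 * t := by
    rw [hs, div_pow, Real.sq_sqrt ht.le]; field_simp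
  -- With `x = s²/8`, the bound `1 + x + x²/2 ≤ e^x` gives `512 e^x ≥ 512 + 64 s² + 4 s⁴`, which
  -- dominates the cubic.
  have h1 : 1 + s + s ^ 2 + s ^ 3 ≤ 512 * Real.exp (s ^ 2 / 8) := by
    have := Real.quadratic_le_exp_of_nonneg (x := s ^ 2 / 8) (by positivity)
    nlinarith [sq_nonneg (s - 1), sq_nonneg (s ^ 2 - s), sq_nonneg (s ^ 2 - 1), sq_nonneg s]
  have h2 : heat (2 * t) z =
      2 ^ (-((d : ℝ) / 2)) * (4 * Real.pi * t) ^ (-((d : ℝ) / 2)) * Real.exp (-(s ^ 2 / 8)) := by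
    unfold heat
    rw [← Real.mul_rpow (by positivity) (by positivity), hz]
    congr 2
    · ring
    · field_simp; ring
  have h3 : heat t z = (4 * Real.pi * t) ^ (-((d : ℝ) / 2)) * Real.exp (-(s ^ 2 / 4)) := by
    unfold heat
    rw [hz]
    congr 2
    field_simp
  have h4 : (2 : ℝ) ^ ((d : ℝ) / 2) * 2 ^ (-((d : ℝ) / 2)) = 1 := by
    rw [← Real.rpow_add (by norm_num)]; simp
  have h5 : Real.exp (-(s ^ 2 / 8)) = Real.exp (s ^ 2 / 8) * Real.exp (-(s ^ 2 / 4)) := by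
    rw [← Real.exp_add]; congr 1; ring
  rw [h2, h3, h5, heatConst]
  calc _ ≤ 512 * Real.exp (s ^ 2 / 8) *
        ((4 * Real.pi * t) ^ (-((d : ℝ) / 2)) * Real.exp (-(s ^ 2 / 4))) := by gcongr
    _ = 512 * ((2 : ℝ) ^ ((d : ℝ) / 2) * 2 ^ (-((d : ℝ) / 2))) * Real.exp (s ^ 2 / 8) *
        ((4 * Real.pi * t) ^ (-((d : ℝ) / 2)) * Real.exp (-(s ^ 2 / 4))) := by rw [h4, mul_one]
    _ = _ := by ring

theorem heat_le_heat_two_mul (ht : 0 < t) (z : Eu d) :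
    heat t z ≤ heatConst d * heat (2 * t) z := by
  refine le_trans ?_ (poly_mul_heat_le ht z)
  have h : (1 : ℝ) ≤ 1 + ‖z‖ / √t + (‖z‖ / √t) ^ 2 + (‖z‖ / √t) ^ 3 := by
    have : 0 ≤ ‖z‖ / √t + (‖z‖ / √t) ^ 2 + (‖z‖ / √t) ^ 3 := by positivity
    linarith
  exact le_mul_of_one_le_left (heat_pos ht z).le h

theorem abs_dheat_le (ht : 0 < t) (a z : Eu d) :
    |dheat t a z| ≤ heatConst d * ‖a‖ * (√t)⁻¹ * heat (2 * t) z := by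
  have hz := poly_mul_heat_le ht z
  have hp := heat_pos ht z
  have h1 : |inner ℝ z a| ≤ ‖z‖ * ‖a‖ := abs_real_inner_le_norm z a
  have hst : √t * √t = t := Real.mul_self_sqrt ht.le
  have hs : 0 < √t := Real.sqrt_pos.2 ht
  unfold dheat
  rw [abs_mul, abs_of_pos hp, abs_neg, abs_div, abs_of_pos (by positivity : 0 < 2 * t)]
  calc |inner ℝ z a| / (2 * t) * heat t z ≤ ‖z‖ * ‖a‖ / (2 * t) * heat t z := by gcongr
    _ = ‖a‖ * (√t)⁻¹ * ((1 / 2) * (‖z‖ / √t) * heat t z) := by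
        have : t = √t * √t := hst.symm
        rw [show ‖z‖ * ‖a‖ / (2 * t) = ‖z‖ * ‖a‖ / (2 * (√t * √t)) by rw [hst]]
        field_simp
    _ ≤ ‖a‖ * (√t)⁻¹ * (heatConst d * heat (2 * t) z) := by
        refine mul_le_mul_of_nonneg_left (le_trans ?_ hz) (by positivity)
        gcongr
        have : 0 ≤ ‖z‖ / √t := by positivity
        nlinarith [pow_nonneg this 2, pow_nonneg this 3]
    _ = _ := by ring

/-- The extra factor `1 + ‖z‖/√t` is decay kept in reserve, to be spent on the growth of `Y x - Y y`
in Morrey's inequality. -/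
theorem abs_hheat_mul_le (ht : 0 < t) (a b z : Eu d) :
    |hheat t a b z| * (1 + ‖z‖ / √t) ≤ heatConst d * ‖a‖ * ‖b‖ * t⁻¹ * heat (2 * t) z := by
  have hz := poly_mul_heat_le ht z
  have hp := heat_pos ht z
  have h1 : |inner ℝ z a| ≤ ‖z‖ * ‖a‖ := abs_real_inner_le_norm z a
  have h2 : |inner ℝ z b| ≤ ‖z‖ * ‖b‖ := abs_real_inner_le_norm z b
  have h3 : |inner ℝ a b| ≤ ‖a‖ * ‖b‖ := abs_real_inner_le_norm a b
  have hs : 0 < √t := Real.sqrt_pos.2 ht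
  unfold hheat
  rw [abs_mul, abs_of_pos hp]
  set s := ‖z‖ / √t with hsd
  have hs0 : 0 ≤ s := by positivity
  have hzs : ‖z‖ ^ 2 = s ^ 2 * t := by
    rw [hsd, div_pow, Real.sq_sqrt ht.le]; field_simp
  have h4 : |inner ℝ z a * inner ℝ z b / (4 * t ^ 2) - inner ℝ a b / (2 * t)| ≤
      ‖a‖ * ‖b‖ * t⁻¹ * (s ^ 2 / 4 + 1 / 2) := by
    calc _ ≤ |inner ℝ z a * inner ℝ z b / (4 * t ^ 2)| + |inner ℝ a b / (2 * t)| := abs_sub _ _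
      _ = |inner ℝ z a| * |inner ℝ z b| / (4 * t ^ 2) + |inner ℝ a b| / (2 * t) := by
        rw [abs_div, abs_mul, abs_div, abs_of_pos (by positivity : 0 < 4 * t ^ 2),
          abs_of_pos (by positivity : 0 < 2 * t)]
      _ ≤ (‖z‖ * ‖a‖) * (‖z‖ * ‖b‖) / (4 * t ^ 2) + (‖a‖ * ‖b‖) / (2 * t) := by gcongr
      _ = ‖z‖ ^ 2 * (‖a‖ * ‖b‖) / (4 * t ^ 2) + (‖a‖ * ‖b‖) / (2 * t) := by ring
      _ = _ := by rw [hzs]; field_simp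
  calc _ ≤ ‖a‖ * ‖b‖ * t⁻¹ * (s ^ 2 / 4 + 1 / 2) * heat t z * (1 + s) := by gcongr
    _ = ‖a‖ * ‖b‖ * t⁻¹ * ((s ^ 2 / 4 + 1 / 2) * (1 + s) * heat t z) := by ring
    _ ≤ ‖a‖ * ‖b‖ * t⁻¹ * (heatConst d * heat (2 * t) z) := by
        refine mul_le_mul_of_nonneg_left (le_trans ?_ hz) (by positivity)
        gcongr
        nlinarith [pow_nonneg hs0 2, pow_nonneg hs0 3]
    _ = _ := by ring

theorem abs_hheat_le (ht : 0 < t) (a b z : Eu d) :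
    |hheat t a b z| ≤ heatConst d * ‖a‖ * ‖b‖ * t⁻¹ * heat (2 * t) z := by
  refine le_trans ?_ (abs_hheat_mul_le ht a b z)
  exact le_mul_of_one_le_right (abs_nonneg _) (by
    have : 0 ≤ ‖z‖ / √t := by positivity
    linarith)

theorem hasFDerivAt_heat (t : ℝ) (z : Eu d) :
    HasFDerivAt (fun z : Eu d => heat t z)
      ((-(heat t z) / (2 * t)) • (innerSL ℝ z : Eu d →L[ℝ] ℝ)) z := by
  unfold heat
  have h := (((hasStrictFDerivAt_norm_sq z).hasFDerivAt.neg.mul_const (4 * t)⁻¹).exp).const_mul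
    ((4 * Real.pi * t) ^ (-((d : ℝ) / 2)))
  refine h.congr_fderiv ?_ |>.congr_of_eventuallyEq ?_
  · ext v
    simp
    rcases eq_or_ne t 0 with rfl | h
    · simp
    · field_simp
      ring_nf
  · exact Filter.Eventually.of_forall fun y => by simp [div_eq_mul_inv]

theorem fderiv_heat (t : ℝ) (z a : Eu d) :
    fderiv ℝ (fun z : Eu d => heat t z) z a = dheat t a z := by
  rw [(hasFDerivAt_heat t z).fderiv]
  simp [dheat]
  ring

theorem hasFDerivAt_dheat (t : ℝ) (a z : Eu d) :
    HasFDerivAt (fun z : Eu d => dheat t a z)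
      (-(inner ℝ z a / (2 * t)) • ((-(heat t z) / (2 * t)) • (innerSL ℝ z : Eu d →L[ℝ] ℝ)) +
        heat t z • (-((2 * t)⁻¹ • (innerSL ℝ a : Eu d →L[ℝ] ℝ)))) z := by
  unfold dheat
  have h1 : HasFDerivAt (fun z : Eu d => -(inner ℝ z a / (2 * t)))
      (-((2 * t)⁻¹ • (innerSL ℝ a : Eu d →L[ℝ] ℝ))) z := by
    have := (((innerSL ℝ a).hasFDerivAt (x := z)).const_mul (2 * t)⁻¹).neg
    refine this.congr_of_eventuallyEq (Filter.Eventually.of_forall fun y => ?_)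
    simp only [innerSL_apply_apply, Pi.neg_apply]
    rw [real_inner_comm]
    ring
  exact h1.mul (hasFDerivAt_heat t z)

theorem fderiv_dheat (t : ℝ) (a z b : Eu d) :
    fderiv ℝ (fun z : Eu d => dheat t a z) z b = hheat t a b z := by
  rw [(hasFDerivAt_dheat t a z).fderiv]
  simp [hheat]
  rcases eq_or_ne t 0 with rfl | h
  · simp
  · field_simp
    ring

theorem sum_hheat (t : ℝ) (z : Eu d) :
    ∑ i, hheat t (EuclideanSpace.single i 1) (EuclideanSpace.single i 1) z =
      (‖z‖ ^ 2 / (4 * t ^ 2) - d / (2 * t)) * heat t z := by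
  unfold hheat
  rw [← Finset.sum_mul, Finset.sum_sub_distrib]
  congr 2
  · rw [← Finset.sum_div, EuclideanSpace.norm_sq_eq]
    congr 1
    apply Finset.sum_congr rfl
    intro i _
    simp [EuclideanSpace.inner_single_right]
    ring
  · simp
    ring

/-- The heat equation; it turns time integrals of Laplacians into boundary terms. -/
theorem hasDerivAt_heat (ht : 0 < t) (z : Eu d) :
    HasDerivAt (fun t => heat t z)
      (∑ i, hheat t (EuclideanSpace.single i 1) (EuclideanSpace.single i 1) z) t := by
  rw [sum_hheat t]
  unfold heat
  have h1 : HasDerivAt (fun t => (4 * Real.pi * t) ^ (-((d : ℝ) / 2)))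
      (-((d : ℝ) / 2) / t * (4 * Real.pi * t) ^ (-((d : ℝ) / 2))) t := by
    have h := ((hasDerivAt_id t).const_mul (4 * Real.pi)).rpow_const (p := -((d : ℝ) / 2))
      (Or.inl (by simp; exact ht.ne'))
    refine h.congr_deriv ?_
    simp only [id, mul_one]
    rw [Real.rpow_sub_one (by positivity)]
    field_simp
  have h2 : HasDerivAt (fun t => Real.exp (-(‖z‖ ^ 2) / (4 * t)))
      (‖z‖ ^ 2 / (4 * t ^ 2) * Real.exp (-(‖z‖ ^ 2) / (4 * t))) t := by
    have h := (((hasDerivAt_inv ht.ne').const_mul (-(‖z‖ ^ 2) / 4))).exp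
    have he : ∀ s : ℝ, -(‖z‖ ^ 2) / 4 * s⁻¹ = -(‖z‖ ^ 2) / (4 * s) := by
      intro s; rw [div_mul_eq_div_div]; rw [div_eq_mul_inv _ s]
    simp only [he] at h
    refine h.congr_deriv ?_
    field_simp
  refine (h1.mul h2).congr_deriv ?_
  field_simp
  ring

end HeatKernel

/-! ### Weak derivatives tested against functions without compact support -/

/-- Dilations by `n + 1` of one bump function: the chain rule provides the decay of the gradient. -/
theorem exists_cutoff_seq (d : ℕ) : ∃ (χ : ℕ → Eu d → ℝ) (C : ℝ), 0 ≤ C ∧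
    (∀ n, ContDiff ℝ ∞ (χ n)) ∧ (∀ n, HasCompactSupport (χ n)) ∧ (∀ n x, |χ n x| ≤ 1) ∧
    (∀ n x, ‖fderiv ℝ (χ n) x‖ ≤ C / (n + 1)) ∧ ∀ x, Tendsto (fun n => χ n x) atTop (𝓝 1) := by
  let f : ContDiffBump (0 : Eu d) := ⟨1, 2, by norm_num, by norm_num⟩
  have hf : ContDiff ℝ ∞ (f : Eu d → ℝ) := f.contDiff
  have hfs : HasCompactSupport (f : Eu d → ℝ) := f.hasCompactSupport
  obtain ⟨C, hC⟩ := (hf.continuous_fderiv (by simp)).bounded_above_of_compact_support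
    (hfs.fderiv (𝕜 := ℝ))
  have hs : ∀ n : ℕ, ((n : ℝ) + 1)⁻¹ ≠ 0 := fun n => by positivity
  refine ⟨fun n x => f (((n : ℝ) + 1)⁻¹ • x), C, (norm_nonneg _).trans (hC 0), fun n => ?_,
    fun n => ?_, fun n x => ?_, fun n x => ?_, fun x => ?_⟩
  · exact hf.comp (contDiff_const_smul _)
  · exact hfs.comp_smul (hs n)
  · rw [abs_of_nonneg f.nonneg]; exact f.le_one
  · have h : HasFDerivAt (fun x => f (((n : ℝ) + 1)⁻¹ • x))
        ((fderiv ℝ f (((n : ℝ) + 1)⁻¹ • x)).comp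
          (((n : ℝ) + 1)⁻¹ • ContinuousLinearMap.id ℝ (Eu d))) x :=
      ((hf.differentiable (by simp)) _).hasFDerivAt.comp x
        (((n : ℝ) + 1)⁻¹ • ContinuousLinearMap.id ℝ (Eu d)).hasFDerivAt
    rw [h.fderiv]
    simp only [ContinuousLinearMap.comp_smul, ContinuousLinearMap.comp_id, norm_smul, norm_inv]
    rw [Real.norm_of_nonneg (by positivity), inv_mul_eq_div]
    gcongr
    exact hC _
  · have h : Tendsto (fun n : ℕ => ((n : ℝ) + 1)⁻¹ • x) atTop (𝓝 0) := by
      have := (tendsto_one_div_add_atTop_nhds_zero_nat (𝕜 := ℝ)).smul_const x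
      simpa using this
    have h2 := (hf.continuous.tendsto 0).comp h
    rwa [f.one_of_mem_closedBall (by simpa using f.rIn_pos.le)] at h2

/-- Gaussian kernels have no compact support, so the weak identity is applied to `χ_n φ` and `n →
∞`. The error `φ · Dχ_n(V)` is `O(1/n)` because `V` is bounded. A constant `V` covers weak
gradients, and `V = Y` covers `div (g Y)`. -/
theorem integral_fderiv_smul_eq_neg_of_integrable {d : ℕ} {E : Type*} [NormedAddCommGroup E]
    [NormedSpace ℝ E] {V : Eu d → Eu d} (hV : Continuous V) {K : ℝ} (hK : ∀ x, ‖V x‖ ≤ K)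
    {g w : Eu d → E} (hg : AEStronglyMeasurable g)
    (h : ∀ φ : Eu d → ℝ, ContDiff ℝ ∞ φ → HasCompactSupport φ →
      ∫ x, (fderiv ℝ φ x (V x)) • g x = - ∫ x, φ x • w x)
    {φ : Eu d → ℝ} (hφ : ContDiff ℝ ∞ φ) (h1 : Integrable fun x => ‖fderiv ℝ φ x‖ * ‖g x‖)
    (h2 : Integrable fun x => φ x • g x) (h3 : Integrable fun x => φ x • w x) :
    ∫ x, (fderiv ℝ φ x (V x)) • g x = - ∫ x, φ x • w x := by
  obtain ⟨χ, C, hC0, hχ, hχs, hχ1, hχd, hχt⟩ := exists_cutoff_seq d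
  have hd : ∀ n x, fderiv ℝ (fun x => χ n x * φ x) x (V x) =
      χ n x * fderiv ℝ φ x (V x) + φ x * fderiv ℝ (χ n) x (V x) := by
    intro n x
    rw [fderiv_fun_mul ((hχ n).differentiable (by simp) x) (hφ.differentiable (by simp) x)]
    simp
  have heq : ∀ n, ∫ x, (χ n x * fderiv ℝ φ x (V x) + φ x * fderiv ℝ (χ n) x (V x)) • g x =
      - ∫ x, (χ n x * φ x) • w x := by
    intro n
    rw [← h _ ((hχ n).mul hφ) ((hχs n).mul_right)]
    simp only [hd]
  have hcφ : Continuous fun x => fderiv ℝ φ x (V x) :=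
    (hφ.continuous_fderiv (by simp)).clm_apply hV
  have hcχ : ∀ n, Continuous fun x => fderiv ℝ (χ n) x (V x) := fun n =>
    ((hχ n).continuous_fderiv (by simp)).clm_apply hV
  have hK0 : 0 ≤ K := (norm_nonneg _).trans (hK 0)
  have hχC : ∀ n x, ‖fderiv ℝ (χ n) x‖ ≤ C := fun n x =>
    (hχd n x).trans (div_le_self hC0 (by linarith [(Nat.cast_nonneg n : (0 : ℝ) ≤ n)]))
  have l1 : Tendsto (fun n => ∫ x, (χ n x * fderiv ℝ φ x (V x) +
      φ x * fderiv ℝ (χ n) x (V x)) • g x) atTop (𝓝 (∫ x, (fderiv ℝ φ x (V x)) • g x)) := by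
    apply tendsto_integral_of_dominated_convergence
      (fun x => K * (‖fderiv ℝ φ x‖ * ‖g x‖) + C * K * ‖φ x • g x‖)
    · intro n
      exact ((((hχ n).continuous.mul hcφ).add
        (hφ.continuous.mul (hcχ n))).aestronglyMeasurable).smul hg
    · exact (h1.const_mul K).add (h2.norm.const_mul (C * K))
    · intro n
      refine Eventually.of_forall fun x => ?_
      have e1 : |fderiv ℝ φ x (V x)| ≤ ‖fderiv ℝ φ x‖ * K :=
        ((fderiv ℝ φ x).le_opNorm _).trans (by gcongr; exact hK x)
      have e2 : |fderiv ℝ (χ n) x (V x)| ≤ C * K :=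
        ((fderiv ℝ (χ n) x).le_opNorm _).trans
          (mul_le_mul (hχC n x) (hK x) (norm_nonneg _) hC0)
      rw [norm_smul, norm_smul]
      calc _ ≤ (|χ n x| * |fderiv ℝ φ x (V x)| + |φ x| * |fderiv ℝ (χ n) x (V x)|) * ‖g x‖ := by
            gcongr
            refine (norm_add_le _ _).trans ?_
            simp [norm_mul]
        _ ≤ (1 * (‖fderiv ℝ φ x‖ * K) + |φ x| * (C * K)) * ‖g x‖ := by
            gcongr
            exact hχ1 n x
        _ = _ := by rw [Real.norm_eq_abs (φ x)]; ring
    · refine Eventually.of_forall fun x => ?_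
      have e1 : Tendsto (fun n => fderiv ℝ (χ n) x (V x)) atTop (𝓝 0) := by
        apply squeeze_zero_norm (a := fun n : ℕ => C * K * (1 / ((n : ℝ) + 1)))
        · intro n
          refine ((fderiv ℝ (χ n) x).le_opNorm _).trans ?_
          refine (mul_le_mul (hχd n x) (hK x) (norm_nonneg _) (by positivity)).trans_eq ?_
          ring
        · simpa using (tendsto_one_div_add_atTop_nhds_zero_nat (𝕜 := ℝ)).const_mul (C * K)
      have := (((hχt x).mul_const (fderiv ℝ φ x (V x))).add (e1.const_mul (φ x))).smul_const (g x)
      simpa using this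
  have l2 : Tendsto (fun n => ∫ x, (χ n x * φ x) • w x) atTop (𝓝 (∫ x, φ x • w x)) := by
    apply tendsto_integral_of_dominated_convergence (fun x => ‖φ x • w x‖)
    · intro n
      have := ((hχ n).continuous.aestronglyMeasurable (μ := volume)).smul h3.aestronglyMeasurable
      refine this.congr (Eventually.of_forall fun x => ?_)
      simp [mul_smul]
    · exact h3.norm
    · intro n
      refine Eventually.of_forall fun x => ?_
      rw [mul_smul, norm_smul]
      exact mul_le_of_le_one_left (norm_nonneg _) (hχ1 n x)
    · refine Eventually.of_forall fun x => ?_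
      have := ((hχt x).mul_const (φ x)).smul_const (w x)
      simpa using this
  exact tendsto_nhds_unique l1 (l2.neg.congr fun n => (heq n).symm)

/-! ### Smoothing estimates for the heat semigroup -/

section Smoothing

variable {d : ℕ} {t : ℝ} {E : Type*} [NormedAddCommGroup E]

theorem integrable_heat_sub (ht : 0 < t) (x : Eu d) : Integrable fun y : Eu d => heat t (x - y) :=
  (integrable_heat ht).comp_sub_left x

theorem integral_heat_sub (ht : 0 < t) (x : Eu d) : ∫ y : Eu d, heat t (x - y) = 1 := by
  rw [integral_sub_left_eq_self (fun z : Eu d => heat t z) volume x, integral_heat ht]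

/-- The bound of the heat semigroup from `L^p` to `L^∞`. -/
theorem lintegral_heat_mul_le (ht : 0 < t) {p : ℝ≥0∞} (hp1 : 1 ≤ p) (hpt : p < ⊤) {h : Eu d → E}
    (hh : AEStronglyMeasurable h) (x : Eu d) :
    ∫⁻ y, ENNReal.ofReal (heat t (x - y)) * ‖h y‖ₑ ≤
      ENNReal.ofReal ((4 * Real.pi * t) ^ (-((d : ℝ) / (2 * p.toReal)))) * eLpNorm h p volume := by
  set ρ : Eu d → ℝ≥0∞ := fun y => ENNReal.ofReal (heat t (x - y)) with hρ
  have hρm : Measurable ρ :=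
    ((continuous_heat t).comp (continuous_const.sub continuous_id)).measurable.ennreal_ofReal
  -- The kernel `heat t (x - ·)` is a probability density, so passing from `L¹` to `L^p` for this
  -- measure costs nothing. Its density is at most `c = (4πt)^{-d/2}`, and returning to Lebesgue
  -- measure costs `c^{1/p}`.
  have hprob : IsProbabilityMeasure ((volume : Measure (Eu d)).withDensity ρ) := by
    constructor
    rw [withDensity_apply _ MeasurableSet.univ, Measure.restrict_univ, hρ,
      ← ofReal_integral_eq_lintegral_ofReal (integrable_heat_sub ht x)
        (Eventually.of_forall fun y => (heat_pos ht _).le), integral_heat_sub ht x]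
    simp
  set c : ℝ≥0∞ := ENNReal.ofReal ((4 * Real.pi * t) ^ (-((d : ℝ) / 2))) with hc
  have hle : (volume : Measure (Eu d)).withDensity ρ ≤ c • volume := by
    rw [← withDensity_const]
    exact withDensity_mono (Eventually.of_forall fun y =>
      ENNReal.ofReal_le_ofReal (heat_le ht _))
  have hac := withDensity_absolutelyContinuous (volume : Measure (Eu d)) ρ
  have h1 : ∫⁻ y, ρ y * ‖h y‖ₑ = eLpNorm h 1 ((volume : Measure (Eu d)).withDensity ρ) := by
    rw [eLpNorm_one_eq_lintegral_enorm,
      lintegral_withDensity_eq_lintegral_mul₀ hρm.aemeasurable hh.enorm]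
    rfl
  have hp0 : 0 < p.toReal := ENNReal.toReal_pos (by positivity) hpt.ne
  calc ∫⁻ y, ρ y * ‖h y‖ₑ = eLpNorm h 1 ((volume : Measure (Eu d)).withDensity ρ) := h1
    _ ≤ eLpNorm h p ((volume : Measure (Eu d)).withDensity ρ) :=
        eLpNorm_le_eLpNorm_of_exponent_le hp1 (hh.mono_ac hac)
    _ ≤ eLpNorm h p (c • volume) := eLpNorm_mono_measure _ hle
    _ = c ^ (1 / p).toReal • eLpNorm h p volume :=
        eLpNorm_smul_measure_of_ne_top hpt.ne _ _
    _ = _ := by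
        rw [smul_eq_mul, hc, ENNReal.ofReal_rpow_of_pos (by positivity),
          ← Real.rpow_mul (by positivity)]
        congr 3
        rw [one_div, ENNReal.toReal_inv]
        field_simp

theorem integrable_heat_mul_norm (ht : 0 < t) {p : ℝ≥0∞} (hp1 : 1 ≤ p) (hpt : p < ⊤)
    {h : Eu d → E} (hh : MemLp h p) (x : Eu d) :
    Integrable fun y => heat t (x - y) * ‖h y‖ := by
  refine ⟨((continuous_heat t).comp (continuous_const.sub
    continuous_id)).aestronglyMeasurable.mul hh.1.norm, ?_⟩
  have h1 : ∀ y, ‖heat t (x - y) * ‖h y‖‖ₑ = ENNReal.ofReal (heat t (x - y)) * ‖h y‖ₑ := by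
    intro y
    rw [enorm_mul, enorm_norm, Real.enorm_eq_ofReal (heat_pos ht _).le]
  rw [hasFiniteIntegral_iff_enorm]
  simp only [h1]
  exact (lintegral_heat_mul_le ht hp1 hpt hh.1 x).trans_lt
    (ENNReal.mul_lt_top ENNReal.ofReal_lt_top hh.2)

theorem integral_heat_mul_norm_le (ht : 0 < t) {p : ℝ≥0∞} (hp1 : 1 ≤ p) (hpt : p < ⊤)
    {h : Eu d → E} (hh : MemLp h p) (x : Eu d) :
    ∫ y, heat t (x - y) * ‖h y‖ ≤
      (4 * Real.pi * t) ^ (-((d : ℝ) / (2 * p.toReal))) * (eLpNorm h p volume).toReal := by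
  rw [integral_eq_lintegral_of_nonneg_ae
    (Eventually.of_forall fun y => mul_nonneg (heat_pos ht _).le (norm_nonneg _))
    (integrable_heat_mul_norm ht hp1 hpt hh x).1]
  have h1 : ∀ y, ENNReal.ofReal (heat t (x - y) * ‖h y‖) =
      ENNReal.ofReal (heat t (x - y)) * ‖h y‖ₑ := by
    intro y
    rw [ENNReal.ofReal_mul (heat_pos ht _).le, ofReal_norm]
  simp only [h1]
  refine (ENNReal.toReal_mono (ENNReal.mul_lt_top ENNReal.ofReal_lt_top hh.2).ne
    (lintegral_heat_mul_le ht hp1 hpt hh.1 x)).trans_eq ?_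
  rw [ENNReal.toReal_mul, ENNReal.toReal_ofReal (by positivity)]

theorem norm_integral_smul_le_of_abs_le [NormedSpace ℝ E] (ht : 0 < t) {p : ℝ≥0∞} (hp1 : 1 ≤ p)
    (hpt : p < ⊤) {h : Eu d → E} (hh : MemLp h p) (x : Eu d) {k : Eu d → ℝ} {c : ℝ} (hc : 0 ≤ c)
    (hk : ∀ z, |k z| ≤ c * heat t z) :
    ‖∫ y, k (x - y) • h y‖ ≤
      c * ((4 * Real.pi * t) ^ (-((d : ℝ) / (2 * p.toReal))) * (eLpNorm h p volume).toReal) := by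
  refine (norm_integral_le_of_norm_le ((integrable_heat_mul_norm ht hp1 hpt hh x).const_mul c)
    (Eventually.of_forall fun y => ?_)).trans ?_
  · rw [norm_smul, ← mul_assoc]
    gcongr
    exact hk _
  · rw [integral_const_mul]
    gcongr
    exact integral_heat_mul_norm_le ht hp1 hpt hh x

theorem integrable_smul_of_abs_le [NormedSpace ℝ E] (ht : 0 < t) {p : ℝ≥0∞} (hp1 : 1 ≤ p)
    (hpt : p < ⊤) {h : Eu d → E} (hh : MemLp h p) (x : Eu d) {k : Eu d → ℝ} (hkc : Continuous k)
    {c : ℝ} (hk : ∀ z, |k z| ≤ c * heat t z) :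
    Integrable fun y => k (x - y) • h y := by
  refine ((integrable_heat_mul_norm ht hp1 hpt hh x).const_mul c).mono'
    ((hkc.comp (continuous_const.sub continuous_id)).aestronglyMeasurable.smul hh.1)
    (Eventually.of_forall fun y => ?_)
  rw [norm_smul, ← mul_assoc]
  gcongr
  exact hk _

theorem integrable_smul_of_abs_le_of_bounded [NormedSpace ℝ E] (ht : 0 < t) {h : Eu d → E}
    (hh : AEStronglyMeasurable h) {G : ℝ} (hG : ∀ᵐ y, ‖h y‖ ≤ G) (x : Eu d) {k : Eu d → ℝ}
    (hkc : Continuous k) {c : ℝ} (hk : ∀ z, |k z| ≤ c * heat t z) :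
    Integrable fun y => k (x - y) • h y := by
  refine ((integrable_heat_sub ht x).const_mul (c * G)).mono'
    ((hkc.comp (continuous_const.sub continuous_id)).aestronglyMeasurable.smul hh) ?_
  filter_upwards [hG] with y hy
  rw [norm_smul]
  calc ‖k (x - y)‖ * ‖h y‖ ≤ (c * heat t (x - y)) * G :=
        mul_le_mul (hk _) hy (norm_nonneg _) ((abs_nonneg _).trans (hk _))
    _ = _ := by ring

theorem norm_integral_smul_le_of_bounded [NormedSpace ℝ E] (ht : 0 < t) {h : Eu d → E}
    {G : ℝ} (hG : ∀ᵐ y, ‖h y‖ ≤ G) (x : Eu d) {k : Eu d → ℝ} {c : ℝ}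
    (hk : ∀ z, |k z| ≤ c * heat t z) :
    ‖∫ y, k (x - y) • h y‖ ≤ c * G := by
  refine (norm_integral_le_of_norm_le ((integrable_heat_sub ht x).const_mul (c * G)) ?_).trans ?_
  · filter_upwards [hG] with y hy
    rw [norm_smul]
    calc ‖k (x - y)‖ * ‖h y‖ ≤ (c * heat t (x - y)) * G :=
          mul_le_mul (hk _) hy (norm_nonneg _) ((abs_nonneg _).trans (hk _))
      _ = _ := by ring
  · rw [integral_const_mul, integral_heat_sub ht, mul_one]

end Smoothing

/-! ### The heat semigroup: evolution formula, behaviour at time zero, integration by parts. -/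

section Semigroup

variable {d : ℕ} {t : ℝ} {E : Type*} [NormedAddCommGroup E] [NormedSpace ℝ E]

/-- The Laplacian of the heat kernel. -/
noncomputable def lapHeat {d : ℕ} (t : ℝ) (z : Eu d) : ℝ :=
  ∑ i, hheat t (EuclideanSpace.single i 1) (EuclideanSpace.single i 1) z

theorem measurable_lapHeat : Measurable fun q : ℝ × Eu d => lapHeat q.1 q.2 :=
  Finset.measurable_sum _ fun _ _ => measurable_hheat _ _

theorem continuous_lapHeat (t : ℝ) : Continuous fun z : Eu d => lapHeat t z :=
  continuous_finsetSum _ fun _ _ => continuous_hheat t _ _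

theorem abs_lapHeat_le (ht : 0 < t) (z : Eu d) :
    |lapHeat t z| ≤ d * heatConst d * t⁻¹ * heat (2 * t) z := by
  refine (Finset.abs_sum_le_sum_abs _ _).trans ?_
  refine (Finset.sum_le_sum fun i _ => abs_hheat_le ht _ _ z).trans_eq ?_
  simp
  ring

theorem integrable_prod_of_integral_norm_le {E : Type*} [NormedAddCommGroup E] {a b M : ℝ}
    {F : ℝ × Eu d → E}
    (hF : AEStronglyMeasurable F ((volume.restrict (Set.Ioc a b)).prod volume))
    (h1 : ∀ s ∈ Set.Ioc a b, Integrable fun y => F (s, y))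
    (h2 : ∀ s ∈ Set.Ioc a b, ∫ y, ‖F (s, y)‖ ≤ M) :
    Integrable F ((volume.restrict (Set.Ioc a b)).prod volume) := by
  rw [integrable_prod_iff hF]
  refine ⟨ae_restrict_of_forall_mem measurableSet_Ioc h1, ?_⟩
  refine (integrable_const M).mono' hF.norm.integral_prod_right' ?_
  refine ae_restrict_of_forall_mem measurableSet_Ioc fun s hs => ?_
  rw [Real.norm_of_nonneg (integral_nonneg fun y => norm_nonneg _)]
  exact h2 s hs

theorem aestronglyMeasurable_kernel_smul {K : ℝ → Eu d → ℝ}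
    (hK : Measurable fun q : ℝ × Eu d => K q.1 q.2) {X : ℝ → Eu d} (hX : Measurable X)
    {h : Eu d → E} (hh : AEStronglyMeasurable h) (μ : Measure ℝ) [SFinite μ] :
    AEStronglyMeasurable (fun q : ℝ × Eu d => K q.1 (X q.1 - q.2) • h q.2) (μ.prod volume) := by
  have h1 : Measurable fun q : ℝ × Eu d => K q.1 (X q.1 - q.2) :=
    hK.comp (measurable_fst.prodMk ((hX.comp measurable_fst).sub measurable_snd))
  exact h1.aestronglyMeasurable.smul hh.comp_snd

theorem integral_norm_smul_le_of_bounded (ht : 0 < t) {h : Eu d → E}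
    {G : ℝ} (hG : ∀ᵐ y, ‖h y‖ ≤ G) (x : Eu d) {k : Eu d → ℝ} {c : ℝ}
    (hk : ∀ z, |k z| ≤ c * heat t z) :
    ∫ y, ‖k (x - y) • h y‖ ≤ c * G := by
  refine (integral_mono_of_nonneg (Eventually.of_forall fun y => norm_nonneg _)
    ((integrable_heat_sub ht x).const_mul (c * G)) ?_).trans_eq ?_
  · filter_upwards [hG] with y hy
    rw [norm_smul]
    calc ‖k (x - y)‖ * ‖h y‖ ≤ (c * heat t (x - y)) * G :=
          mul_le_mul (hk _) hy (norm_nonneg _) ((abs_nonneg _).trans (hk _))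
      _ = _ := by ring
  · rw [integral_const_mul, integral_heat_sub ht, mul_one]

/-- Swapping a time integral and a convolution with a kernel of Gaussian type. -/
theorem intervalIntegral_integral_swap [CompleteSpace E] {a b : ℝ} (hab : a ≤ b) {K : ℝ → Eu d → ℝ}
    (hK : Measurable fun q : ℝ × Eu d => K q.1 q.2) (hKc : ∀ s, Continuous (K s))
    {τ : ℝ → ℝ} (hτ : ∀ s ∈ Set.Ioc a b, 0 < τ s)
    {c : ℝ} (hc : ∀ s ∈ Set.Ioc a b, ∀ z, |K s z| ≤ c * heat (τ s) z)
    {X : ℝ → Eu d} (hX : Measurable X) {h : Eu d → E} (hh : AEStronglyMeasurable h) {G : ℝ}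
    (hG : ∀ᵐ y, ‖h y‖ ≤ G) :
    ∫ s in a..b, ∫ y, K s (X s - y) • h y = ∫ y, (∫ s in a..b, K s (X s - y)) • h y := by
  simp only [intervalIntegral.integral_of_le hab]
  rw [integral_integral_swap]
  · congr 1
    ext y
    exact integral_smul_const _ _
  · exact integrable_prod_of_integral_norm_le (M := c * G)
      (F := fun q : ℝ × Eu d => K q.1 (X q.1 - q.2) • h q.2)
      (aestronglyMeasurable_kernel_smul hK hX hh _)
      (fun s hs => integrable_smul_of_abs_le_of_bounded (hτ s hs) hh hG (X s) (hKc s) (hc s hs))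
      (fun s hs => integral_norm_smul_le_of_bounded (hτ s hs) hG (X s) (hc s hs))

theorem intervalIntegral_lapHeat (η : ℝ) {ε R : ℝ} (hε : 0 < ε) (hR : ε ≤ R) (z : Eu d) :
    ∫ s in ε..R, Real.exp (-(η * s)) * (lapHeat s z - η * heat s z) =
      Real.exp (-(η * R)) * heat R z - Real.exp (-(η * ε)) * heat ε z := by
  have hpos : ∀ s ∈ Set.uIcc ε R, 0 < s := fun s hs => by
    rw [Set.uIcc_of_le hR] at hs
    exact hε.trans_le hs.1
  apply intervalIntegral.integral_eq_sub_of_hasDerivAt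
    (f := fun s => Real.exp (-(η * s)) * heat s z)
  · intro s hs
    have h1 : HasDerivAt (fun s => Real.exp (-(η * s))) (Real.exp (-(η * s)) * -(η * 1)) s :=
      (((hasDerivAt_id s).const_mul η).neg).exp
    refine (h1.mul (hasDerivAt_heat (hpos s hs) z)).congr_deriv ?_
    simp only [lapHeat]
    ring
  · apply ContinuousOn.intervalIntegrable
    intro s hs
    have hs' := hpos s hs
    have h1 : ContinuousAt (fun s => heat s z) s := (hasDerivAt_heat hs' z).continuousAt
    apply ContinuousAt.continuousWithinAt
    simp only [lapHeat, sum_hheat]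
    have h2 : 4 * s ^ 2 ≠ 0 := by positivity
    have h3 : 2 * s ≠ 0 := by positivity
    fun_prop (disch := assumption)

/-- The integrand is the time derivative of `e^{-ηs} e^{sΔ} h`. The case `η = 0` serves Morrey's
inequality; `η > 0` serves the trace of the Hessian and the resolvent. -/
theorem intervalIntegral_lapHeat_smul [CompleteSpace E] {η : ℝ} (hη : 0 ≤ η) {ε R : ℝ} (hε : 0 < ε)
    (hR : ε ≤ R) {h : Eu d → E} (hh : AEStronglyMeasurable h) {G : ℝ} (hG : ∀ᵐ y, ‖h y‖ ≤ G)
    (x : Eu d) :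
    ∫ s in ε..R, Real.exp (-(η * s)) •
        ((∫ y, lapHeat s (x - y) • h y) - η • ∫ y, heat s (x - y) • h y) =
      Real.exp (-(η * R)) • (∫ y, heat R (x - y) • h y) -
        Real.exp (-(η * ε)) • ∫ y, heat ε (x - y) • h y := by
  have hint : ∀ s, 0 < s → Integrable fun y => heat s (x - y) • h y := fun s hs =>
    integrable_smul_of_abs_le_of_bounded (c := 1) hs hh hG x (continuous_heat s) fun z => by
      rw [one_mul, abs_of_pos (heat_pos hs z)]
  have hint2 : ∀ s, 0 < s → Integrable fun y => lapHeat s (x - y) • h y := fun s hs =>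
    integrable_smul_of_abs_le_of_bounded (by positivity : 0 < 2 * s) hh hG x
      (continuous_lapHeat s) (abs_lapHeat_le hs)
  set K : ℝ → Eu d → ℝ := fun s z => Real.exp (-(η * s)) * (lapHeat s z - η * heat s z) with hK
  have h1 : ∀ s ∈ Set.uIcc ε R, Real.exp (-(η * s)) •
        ((∫ y, lapHeat s (x - y) • h y) - η • ∫ y, heat s (x - y) • h y) =
        ∫ y, K s (x - y) • h y := by
    intro s hs
    rw [Set.uIcc_of_le hR] at hs
    have hs0 := hε.trans_le hs.1
    have h3 : Integrable fun y => η • heat s (x - y) • h y := (hint s hs0).smul η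
    rw [← integral_smul, ← integral_sub (hint2 s hs0) h3, ← integral_smul]
    congr 1
    ext y
    simp only [hK]
    module
  rw [intervalIntegral.integral_congr h1]
  rw [intervalIntegral_integral_swap hR (K := K) (X := fun _ => x) (τ := fun s => 2 * s)
    (c := d * heatConst d * ε⁻¹ + η * heatConst d) ?_ ?_ ?_ ?_ measurable_const hh hG]
  · simp only [hK, intervalIntegral_lapHeat η hε hR, sub_smul, mul_smul]
    have h3 : ∀ s, 0 < s → Integrable fun y => Real.exp (-(η * s)) • heat s (x - y) • h y :=
      fun s hs => (hint s hs).smul _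
    rw [integral_sub (h3 R (hε.trans_le hR)) (h3 ε hε), integral_smul, integral_smul]
  · have := measurable_heat (d := d)
    have := measurable_lapHeat (d := d)
    fun_prop
  · intro s
    have := continuous_heat (d := d) s
    have := continuous_lapHeat (d := d) s
    fun_prop
  · intro s hs
    have := hε.trans hs.1
    positivity
  · intro s hs z
    have hs0 := hε.trans hs.1
    have hC := heatConst_pos d
    have hp := heat_pos (by positivity : 0 < 2 * s) z
    rw [abs_mul, abs_of_pos (Real.exp_pos _)]
    have he : Real.exp (-(η * s)) ≤ 1 := Real.exp_le_one_iff.2 (by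
      have := mul_nonneg hη hs0.le
      linarith)
    calc _ ≤ 1 * |lapHeat s z - η * heat s z| := by gcongr
      _ ≤ |lapHeat s z| + |η * heat s z| := by rw [one_mul]; exact abs_sub _ _
      _ ≤ d * heatConst d * s⁻¹ * heat (2 * s) z + η * (heatConst d * heat (2 * s) z) := by
        gcongr
        · exact abs_lapHeat_le hs0 z
        · rw [abs_mul, abs_of_nonneg hη, abs_of_pos (heat_pos hs0 z)]
          gcongr
          exact heat_le_heat_two_mul hs0 z
      _ ≤ d * heatConst d * ε⁻¹ * heat (2 * s) z + η * (heatConst d * heat (2 * s) z) := by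
        gcongr
        exact hs.1.le
      _ = _ := by ring

theorem heat_sqrt_smul (ht : 0 < t) (u : Eu d) :
    heat t (√t • u) = (√t ^ d)⁻¹ * heat 1 u := by
  unfold heat
  rw [norm_smul, Real.norm_of_nonneg (Real.sqrt_nonneg t), mul_pow, Real.sq_sqrt ht.le, mul_one,
    Real.mul_rpow (by positivity) ht.le, ← mul_assoc, mul_comm (_⁻¹)]
  congr 2
  · rw [Real.rpow_neg ht.le, Real.sqrt_eq_rpow, ← Real.rpow_natCast, ← Real.rpow_mul ht.le]
    congr 2
    ring
  · field_simp

/-- The substitution `y = x - √t u` moves the dependence on `t` from the kernel to the argument of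
`h`, so that a single Gaussian can dominate as `t → 0`. -/
theorem integral_heat_smul_eq_rescaled (ht : 0 < t) (h : Eu d → E) (x : Eu d) :
    ∫ y, heat t (x - y) • h y = ∫ u, heat 1 u • h (x - √t • u) := by
  have h1 : ∫ y, heat t (x - y) • h y = ∫ z, heat t z • h (x - z) := by
    rw [← integral_sub_left_eq_self (fun z => heat t z • h (x - z)) volume x]
    simp
  have hs : 0 < √t := Real.sqrt_pos.2 ht
  have h2 := Measure.integral_comp_smul (volume : Measure (Eu d))
    (fun z => heat t z • h (x - z)) (√t)
  rw [finrank_euclideanSpace_fin, abs_of_pos (by positivity)] at h2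
  simp only [heat_sqrt_smul ht, mul_smul] at h2
  rw [integral_smul] at h2
  rw [h1]
  exact (smul_right_injective E (by positivity : (√t ^ d)⁻¹ ≠ 0) h2).symm

theorem tendsto_integral_heat_smul [CompleteSpace E] {h : Eu d → E} (hh : Continuous h) {G : ℝ}
    (hG : ∀ y, ‖h y‖ ≤ G) (x : Eu d) :
    Tendsto (fun t => ∫ y, heat t (x - y) • h y) (𝓝[>] 0) (𝓝 (h x)) := by
  have h1 : ∫ u : Eu d, heat 1 u • h x = h x := by
    rw [integral_smul_const, integral_heat one_pos, one_smul]
  rw [← h1]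
  have h2 : ∀ᶠ t : ℝ in 𝓝[>] 0, ∫ u, heat 1 u • h (x - √t • u) = ∫ y, heat t (x - y) • h y := by
    filter_upwards [self_mem_nhdsWithin] with t ht
    exact (integral_heat_smul_eq_rescaled ht h x).symm
  refine Tendsto.congr' h2 ?_
  apply tendsto_integral_filter_of_dominated_convergence (fun u => heat 1 u * G)
  · refine Eventually.of_forall fun t => ?_
    have := continuous_heat (d := d) 1
    exact (by fun_prop : Continuous fun u => heat 1 u • h (x - √t • u)).aestronglyMeasurable
  · refine Eventually.of_forall fun t => Eventually.of_forall fun u => ?_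
    rw [norm_smul, Real.norm_of_nonneg (heat_pos one_pos u).le]
    gcongr
    · exact (heat_pos one_pos u).le
    · exact hG _
  · exact (integrable_heat one_pos).mul_const G
  · refine Eventually.of_forall fun u => ?_
    have hc : Continuous fun t : ℝ => heat 1 u • h (x - √t • u) := by fun_prop
    have := (hc.tendsto 0).mono_left (nhdsWithin_le_nhds (s := Set.Ioi 0))
    simpa using this

/-- Weak integration by parts against a kernel of Gaussian type. -/
theorem integral_fderiv_kernel_smul (ht : 0 < t) {V : Eu d → Eu d} (hV : Continuous V) {K : ℝ}
    (hK : ∀ x, ‖V x‖ ≤ K) {g w : Eu d → E} (hg : AEStronglyMeasurable g) {G : ℝ}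
    (hG : ∀ᵐ y, ‖g y‖ ≤ G) {p : ℝ≥0∞} (hp1 : 1 ≤ p) (hpt : p < ⊤) (hw : MemLp w p)
    (h : ∀ φ : Eu d → ℝ, ContDiff ℝ ∞ φ → HasCompactSupport φ →
      ∫ x, (fderiv ℝ φ x (V x)) • g x = - ∫ x, φ x • w x)
    {k : Eu d → ℝ} (hk : ContDiff ℝ ∞ k) {c : ℝ} (hkc : ∀ z, |k z| ≤ c * heat t z)
    (hkd : ∀ z, ‖fderiv ℝ k z‖ ≤ c * heat t z) (x : Eu d) :
    ∫ y, (fderiv ℝ k (x - y) (V y)) • g y = ∫ y, k (x - y) • w y := by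
  have hφ : ContDiff ℝ ∞ fun y => k (x - y) := hk.comp (contDiff_const.sub contDiff_id)
  -- The reflection `y ↦ x - y` changes the sign of the gradient, which cancels the minus sign of
  -- the weak formula.
  have hd : ∀ y, fderiv ℝ (fun y => k (x - y)) y = - fderiv ℝ k (x - y) := by
    intro y
    have h1 : HasFDerivAt (fun y => k (x - y)) ((fderiv ℝ k (x - y)).comp
        (-ContinuousLinearMap.id ℝ (Eu d))) y :=
      (hk.differentiable (by simp) _).hasFDerivAt.comp y ((hasFDerivAt_id y).const_sub x)
    rw [h1.fderiv]
    simp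
  have := integral_fderiv_smul_eq_neg_of_integrable hV hK hg h hφ ?_
    (integrable_smul_of_abs_le_of_bounded ht hg hG x hk.continuous hkc)
    (integrable_smul_of_abs_le ht hp1 hpt hw x hk.continuous hkc)
  · simp only [hd] at this
    simpa [neg_smul, integral_neg] using this
  · have hc : Continuous fun z => ‖fderiv ℝ k z‖ := (hk.continuous_fderiv (by simp)).norm
    have := (integrable_smul_of_abs_le_of_bounded ht hg hG x hc (k := fun z => ‖fderiv ℝ k z‖)
      (c := c) (fun z => by simpa using hkd z)).norm
    simpa [hd, norm_smul] using this

theorem norm_fderiv_heat_le (ht : 0 < t) (z : Eu d) :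
    ‖fderiv ℝ (fun z : Eu d => heat t z) z‖ ≤ heatConst d * (√t)⁻¹ * heat (2 * t) z := by
  have hC := heatConst_pos d
  have hp := heat_pos (by positivity : 0 < 2 * t) z
  refine ContinuousLinearMap.opNorm_le_bound _ (by positivity) fun a => ?_
  rw [fderiv_heat]
  refine (abs_dheat_le ht a z).trans_eq ?_
  ring

theorem norm_fderiv_dheat_le (ht : 0 < t) (a z : Eu d) :
    ‖fderiv ℝ (fun z : Eu d => dheat t a z) z‖ ≤
      heatConst d * ‖a‖ * t⁻¹ * heat (2 * t) z := by
  have hC := heatConst_pos d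
  have hp := heat_pos (by positivity : 0 < 2 * t) z
  refine ContinuousLinearMap.opNorm_le_bound _ (by positivity) fun b => ?_
  rw [fderiv_dheat]
  refine (abs_hheat_le ht a b z).trans_eq ?_
  ring

section WeakField

variable {V : Eu d → Eu d} {K : ℝ} {g w : Eu d → E} {G : ℝ} {p : ℝ≥0∞}

theorem integral_dheat_smul_of_weak (ht : 0 < t) (hV : Continuous V) (hK : ∀ x, ‖V x‖ ≤ K)
    (hg : AEStronglyMeasurable g) (hG : ∀ᵐ y, ‖g y‖ ≤ G) (hp1 : 1 ≤ p) (hpt : p < ⊤)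
    (hw : MemLp w p)
    (h : ∀ φ : Eu d → ℝ, ContDiff ℝ ∞ φ → HasCompactSupport φ →
      ∫ x, (fderiv ℝ φ x (V x)) • g x = - ∫ x, φ x • w x) (x : Eu d) :
    ∫ y, dheat t (V y) (x - y) • g y = ∫ y, heat t (x - y) • w y := by
  have hC := heatConst_pos d
  have hp := fun z : Eu d => heat_pos (by positivity : 0 < 2 * t) z
  have := integral_fderiv_kernel_smul (t := 2 * t) (by positivity) hV hK hg hG hp1 hpt hw h
    (contDiff_heat t) (c := heatConst d + heatConst d * (√t)⁻¹) (fun z => ?_) (fun z => ?_) x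
  · simpa only [fderiv_heat] using this
  · rw [abs_of_pos (heat_pos ht z), add_mul]
    have h1 := heat_le_heat_two_mul ht z
    have h2 : 0 ≤ heatConst d * (√t)⁻¹ * heat (2 * t) z := by have := hp z; positivity
    linarith
  · refine (norm_fderiv_heat_le ht z).trans ?_
    have h2 : 0 ≤ heatConst d * heat (2 * t) z := by have := hp z; positivity
    rw [add_mul]
    linarith

/-- The direction `V y` is taken at the integration point, not at `x`; the difference between the
two is the commutator estimated by Morrey's inequality. -/
theorem integral_hheat_smul_of_weak (ht : 0 < t) (hV : Continuous V) (hK : ∀ x, ‖V x‖ ≤ K)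
    (hg : AEStronglyMeasurable g) (hG : ∀ᵐ y, ‖g y‖ ≤ G) (hp1 : 1 ≤ p) (hpt : p < ⊤)
    (hw : MemLp w p)
    (h : ∀ φ : Eu d → ℝ, ContDiff ℝ ∞ φ → HasCompactSupport φ →
      ∫ x, (fderiv ℝ φ x (V x)) • g x = - ∫ x, φ x • w x) (a x : Eu d) :
    ∫ y, hheat t a (V y) (x - y) • g y = ∫ y, dheat t a (x - y) • w y := by
  have hC := heatConst_pos d
  have hp := fun z : Eu d => heat_pos (by positivity : 0 < 2 * t) z
  -- One constant must bound both the kernel and its gradient, hence the sum.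
  have := integral_fderiv_kernel_smul (t := 2 * t) (by positivity) hV hK hg hG hp1 hpt hw h
    (contDiff_dheat t a) (c := heatConst d * ‖a‖ * (√t)⁻¹ + heatConst d * ‖a‖ * t⁻¹)
    (fun z => ?_) (fun z => ?_) x
  · simpa only [fderiv_dheat] using this
  · refine (abs_dheat_le ht a z).trans ?_
    have h2 : 0 ≤ heatConst d * ‖a‖ * t⁻¹ * heat (2 * t) z := by have := hp z; positivity
    rw [add_mul]
    linarith
  · refine (norm_fderiv_dheat_le ht a z).trans ?_
    have h2 : 0 ≤ heatConst d * ‖a‖ * (√t)⁻¹ * heat (2 * t) z := by have := hp z; positivity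
    rw [add_mul]
    linarith

end WeakField

end Semigroup

/-! ### Morrey's inequality by heat smoothing, and the commutator estimate. -/

section Morrey

variable {d : ℕ} {t : ℝ} {p : ℝ≥0∞}

theorem rpow_four_pi_mul_le {c a : ℝ} (hc : 1 ≤ c) (ha : 0 ≤ a) (ht : 0 < t) :
    (4 * Real.pi * (c * t)) ^ (-a) ≤ t ^ (-a) := by
  apply Real.rpow_le_rpow_of_nonpos ht _ (by linarith)
  have h1 : 1 ≤ 4 * Real.pi := by linarith [Real.pi_gt_three]
  have h2 : 1 ≤ 4 * Real.pi * c := one_le_mul_of_one_le_of_one_le h1 hc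
  calc t = 1 * t := (one_mul t).symm
    _ ≤ 4 * Real.pi * c * t := by gcongr
    _ = _ := by ring

/-- The constant in the Morrey inequality. -/
noncomputable def morreyConst (d : ℕ) (p : ℝ≥0∞) : ℝ :=
  2 * (d * heatConst d / (1 / 2 - d / (2 * p.toReal))) + 1

variable {Y : Eu d → Eu d} {D : Eu d → (Eu d →L[ℝ] Eu d)} {K : ℝ}

theorem MemLp.apply_const (hD : MemLp D p) (v : Eu d) : MemLp (fun x => D x v) p :=
  (ContinuousLinearMap.apply ℝ (Eu d) v).comp_memLp' hD

theorem eLpNorm_apply_const_le (hD : MemLp D p) (v : Eu d) :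
    (eLpNorm (fun x => D x v) p volume).toReal ≤ ‖v‖ * (eLpNorm D p volume).toReal := by
  have h : eLpNorm (fun x => D x v) p volume ≤ ENNReal.ofReal ‖v‖ * eLpNorm D p volume :=
    eLpNorm_le_mul_eLpNorm_of_ae_le_mul
      (Eventually.of_forall fun x => by rw [mul_comm]; exact (D x).le_opNorm v) p
  refine (ENNReal.toReal_mono (ENNReal.mul_lt_top ENNReal.ofReal_lt_top hD.2).ne h).trans_eq ?_
  rw [ENNReal.toReal_mul, ENNReal.toReal_ofReal (norm_nonneg v)]

/-- In each `∂_i²` one derivative is moved onto `Y`. The other costs `t^{-1/2}`, and the passage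
from `L^p` to `L^∞` costs `t^{-d/(2p)}`. -/
theorem norm_integral_lapHeat_smul_le (ht : 0 < t) (hY : Continuous Y) (hK : ∀ x, ‖Y x‖ ≤ K)
    (hp1 : 1 ≤ p) (hpt : p < ⊤) (hYD : HasWeakGradient Y D) (hD : MemLp D p) (x : Eu d) :
    ‖∫ y, lapHeat t (x - y) • Y y‖ ≤
      d * heatConst d * (eLpNorm D p volume).toReal * t ^ (-(1 / 2 + d / (2 * p.toReal))) := by
  have hC := heatConst_pos d
  have hi : ∀ i, Integrable fun y =>
      hheat t (EuclideanSpace.single i 1) (EuclideanSpace.single i 1) (x - y) • Y y := fun i =>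
    integrable_smul_of_abs_le_of_bounded (by positivity : 0 < 2 * t) hY.aestronglyMeasurable
      (Eventually.of_forall hK) x (continuous_hheat t _ _) (abs_hheat_le ht _ _)
  have h1 : ∫ y, lapHeat t (x - y) • Y y = ∑ i, ∫ y,
      hheat t (EuclideanSpace.single i 1) (EuclideanSpace.single i 1) (x - y) • Y y := by
    rw [← integral_finsetSum _ fun i _ => hi i]
    simp only [lapHeat, Finset.sum_smul]
  rw [h1]
  refine (norm_sum_le _ _).trans ?_
  have h2 : ∀ i : Fin d, ‖∫ y,
      hheat t (EuclideanSpace.single i 1) (EuclideanSpace.single i 1) (x - y) • Y y‖ ≤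
      heatConst d * (eLpNorm D p volume).toReal * t ^ (-(1 / 2 + d / (2 * p.toReal))) := by
    intro i
    set e : Eu d := EuclideanSpace.single i 1 with he
    have hne : ‖e‖ = 1 := by simp [he]
    have h3 := integral_hheat_smul_of_weak ht (V := fun _ => e) continuous_const
      (fun _ => le_rfl) hY.aestronglyMeasurable (Eventually.of_forall hK) hp1 hpt
      (MemLp.apply_const hD e) (fun φ h1 h2 => hYD.2.2 φ h1 h2 e) e x
    rw [h3]
    refine (norm_integral_smul_le_of_abs_le (by positivity : 0 < 2 * t) hp1 hpt
      (MemLp.apply_const hD e) x (by positivity) (abs_dheat_le ht e)).trans ?_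
    have h4 := eLpNorm_apply_const_le hD e
    rw [hne, one_mul] at h4
    have h5 : (√t)⁻¹ * t ^ (-((d : ℝ) / (2 * p.toReal))) =
        t ^ (-(1 / 2 + (d : ℝ) / (2 * p.toReal))) := by
      rw [Real.sqrt_eq_rpow, ← Real.rpow_neg ht.le, ← Real.rpow_add ht]
      congr 1
      ring
    have h6 := rpow_four_pi_mul_le one_le_two
      (by positivity : 0 ≤ (d : ℝ) / (2 * p.toReal)) ht
    calc _ ≤ heatConst d * ‖e‖ * (√t)⁻¹ * (t ^ (-((d : ℝ) / (2 * p.toReal))) *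
          (eLpNorm D p volume).toReal) := by
          gcongr
      _ = _ := by rw [hne, ← h5]; ring
  refine (Finset.sum_le_sum fun i _ => h2 i).trans_eq ?_
  simp
  ring

/-- `Y - e^{tΔ} Y = -∫₀^t Δ e^{sΔ} Y ds`, whose integrand has an exponent above `-1` because `p >
d`. The integral is taken from `ε`, and `ε → 0` is allowed by the continuity of `Y`. -/
theorem norm_sub_integral_heat_le (ht : 0 < t) (hY : Continuous Y) (hK : ∀ x, ‖Y x‖ ≤ K)
    (hp1 : 1 ≤ p) (hpt : p < ⊤) (hdp : (d : ℝ) < p.toReal)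
    (hYD : HasWeakGradient Y D) (hD : MemLp D p) (x : Eu d) :
    ‖Y x - ∫ y, heat t (x - y) • Y y‖ ≤ d * heatConst d / (1 / 2 - d / (2 * p.toReal)) *
      (eLpNorm D p volume).toReal * t ^ (1 / 2 - d / (2 * p.toReal)) := by
  set N := (eLpNorm D p volume).toReal with hN
  have hC := heatConst_pos d
  have hp0 : 0 < p.toReal := lt_of_le_of_lt (Nat.cast_nonneg d) hdp
  have ha : 0 < 1 / 2 - d / (2 * p.toReal) := by
    rw [sub_pos, div_lt_div_iff₀ (by positivity) (by norm_num)]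
    linarith
  have hlim := ((tendsto_integral_heat_smul hY hK x).sub_const
    (∫ y, heat t (x - y) • Y y)).norm
  refine le_of_tendsto hlim ?_
  filter_upwards [Ioo_mem_nhdsGT ht] with ε hε
  have hf := intervalIntegral_lapHeat_smul (le_refl (0 : ℝ)) hε.1 hε.2.le hY.aestronglyMeasurable
    (Eventually.of_forall hK) x
  simp only [zero_mul, neg_zero, Real.exp_zero, one_smul, zero_smul, sub_zero] at hf
  rw [norm_sub_rev, ← hf]
  refine (intervalIntegral.norm_integral_le_of_norm_le hε.2.le
    (g := fun s => d * heatConst d * N * s ^ (-(1 / 2 + d / (2 * p.toReal)))) ?_ ?_).trans ?_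
  · refine Eventually.of_forall fun s hs => ?_
    exact norm_integral_lapHeat_smul_le (hε.1.trans hs.1) hY hK hp1 hpt hYD hD x
  · exact (intervalIntegral.intervalIntegrable_rpow' (by linarith)).const_mul _
  · rw [intervalIntegral.integral_const_mul, integral_rpow (Or.inl (by linarith))]
    have he : -(1 / 2 + (d : ℝ) / (2 * p.toReal)) + 1 = 1 / 2 - d / (2 * p.toReal) := by ring
    rw [he]
    have h0 : 0 ≤ ε ^ (1 / 2 - (d : ℝ) / (2 * p.toReal)) := by have := hε.1; positivity
    calc _ ≤ d * heatConst d * N *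
          (t ^ (1 / 2 - (d : ℝ) / (2 * p.toReal)) / (1 / 2 - d / (2 * p.toReal))) := by
          gcongr
          linarith
      _ = _ := by ring

theorem intervalIntegral_dheat (t : ℝ) (z v : Eu d) :
    ∫ s in (0 : ℝ)..1, dheat t v (z + s • v) = heat t (z + v) - heat t z := by
  have h := intervalIntegral.integral_eq_sub_of_hasDerivAt (a := 0) (b := 1)
    (f := fun s : ℝ => heat t (z + s • v)) (f' := fun s => dheat t v (z + s • v)) ?_ ?_
  · simpa using h
  · intro s _
    have h1 : HasDerivAt (fun s : ℝ => z + s • v) v s := by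
      simpa using ((hasDerivAt_id s).smul_const v).const_add z
    have h2 := (hasFDerivAt_heat t (z + s • v)).comp_hasDerivAt s h1
    refine h2.congr_deriv ?_
    rw [← fderiv_heat, (hasFDerivAt_heat t (z + s • v)).fderiv]
  · have := continuous_dheat t v
    exact (by fun_prop : Continuous fun s : ℝ => dheat t v (z + s • v)).intervalIntegrable _ _

/-- The increment is the integral along the segment from `x` to `x + v` of the derivative in the
direction `v`, which is transferred from the kernel to `Y`. -/
theorem norm_integral_heat_sub_le (ht : 0 < t) (hY : Continuous Y) (hK : ∀ x, ‖Y x‖ ≤ K)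
    (hp1 : 1 ≤ p) (hpt : p < ⊤) (hYD : HasWeakGradient Y D) (hD : MemLp D p) (x v : Eu d) :
    ‖(∫ y, heat t (x + v - y) • Y y) - ∫ y, heat t (x - y) • Y y‖ ≤
      ‖v‖ * (eLpNorm D p volume).toReal * t ^ (-(d / (2 * p.toReal))) := by
  have hm := hY.aestronglyMeasurable (μ := volume)
  have hint : ∀ x, Integrable fun y => heat t (x - y) • Y y := fun x =>
    integrable_smul_of_abs_le_of_bounded (c := 1) ht hm (Eventually.of_forall hK) x
      (continuous_heat t) fun z => by rw [one_mul, abs_of_pos (heat_pos ht z)]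
  have h1 : (∫ y, heat t (x + v - y) • Y y) - ∫ y, heat t (x - y) • Y y =
      ∫ s in (0 : ℝ)..1, ∫ y, dheat t v ((x + s • v) - y) • Y y := by
    rw [intervalIntegral_integral_swap zero_le_one (K := fun _ z => dheat t v z)
      (X := fun s => x + s • v) (τ := fun _ => 2 * t) (c := heatConst d * ‖v‖ * (√t)⁻¹)
      ((continuous_dheat t v).measurable.comp measurable_snd) (fun _ => continuous_dheat t v)
      (fun _ _ => by positivity) (fun _ _ => abs_dheat_le ht v) (by fun_prop) hm
      (Eventually.of_forall hK), ← integral_sub (hint _) (hint _)]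
    congr 1
    ext1 y
    have h2 : ∀ s : ℝ, x + s • v - y = x - y + s • v := fun s => by abel
    simp only [h2, intervalIntegral_dheat]
    rw [← sub_smul]
    congr 3
    abel
  rw [h1]
  refine (intervalIntegral.norm_integral_le_of_norm_le_const
    (C := ‖v‖ * (eLpNorm D p volume).toReal * t ^ (-(d / (2 * p.toReal)))) ?_).trans_eq (by simp)
  intro s _
  have h3 := integral_dheat_smul_of_weak ht (V := fun _ => v) continuous_const
      (fun _ => le_rfl) hm (Eventually.of_forall hK) hp1 hpt
      (MemLp.apply_const hD v) (fun φ h1 h2 => hYD.2.2 φ h1 h2 v) (x + s • v)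
  rw [h3]
  refine (norm_integral_smul_le_of_abs_le ht hp1 hpt (MemLp.apply_const hD v) (x + s • v)
    zero_le_one fun z => by rw [one_mul, abs_of_pos (heat_pos ht z)]).trans ?_
  have h5 := rpow_four_pi_mul_le (le_refl (1 : ℝ))
    (by positivity : 0 ≤ (d : ℝ) / (2 * p.toReal)) ht
  rw [one_mul] at h5
  calc _ ≤ 1 * (t ^ (-((d : ℝ) / (2 * p.toReal))) * (‖v‖ * (eLpNorm D p volume).toReal)) := by
        gcongr
        exact eLpNorm_apply_const_le hD v
    _ = _ := by ring

/-- The **Morrey inequality**, at the parabolic scale `√t`. -/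
theorem norm_sub_le_morrey (ht : 0 < t) (hY : Continuous Y) (hK : ∀ x, ‖Y x‖ ≤ K)
    (hp1 : 1 ≤ p) (hpt : p < ⊤) (hdp : (d : ℝ) < p.toReal)
    (hYD : HasWeakGradient Y D) (hD : MemLp D p) (x y : Eu d) :
    ‖Y x - Y y‖ ≤ morreyConst d p * (eLpNorm D p volume).toReal *
      t ^ (1 / 2 - d / (2 * p.toReal)) * (1 + ‖x - y‖ / √t) := by
  have h1 := norm_sub_integral_heat_le ht hY hK hp1 hpt hdp hYD hD x
  have h2 := norm_sub_integral_heat_le ht hY hK hp1 hpt hdp hYD hD y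
  have h3 := norm_integral_heat_sub_le ht hY hK hp1 hpt hYD hD y (x - y)
  rw [add_sub_cancel] at h3
  set N := (eLpNorm D p volume).toReal with hN
  set A := d * heatConst d / (1 / 2 - d / (2 * p.toReal)) with hA
  set T := t ^ (1 / 2 - (d : ℝ) / (2 * p.toReal)) with hT
  have hC := heatConst_pos d
  have hp0 : 0 < p.toReal := lt_of_le_of_lt (Nat.cast_nonneg d) hdp
  have ha : 0 < 1 / 2 - d / (2 * p.toReal) := by
    rw [sub_pos, div_lt_div_iff₀ (by positivity) (by norm_num)]
    linarith
  have hA0 : 0 ≤ A := by positivity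
  have hN0 : 0 ≤ N := ENNReal.toReal_nonneg
  have hT0 : 0 < T := by positivity
  have h4 : t ^ (-((d : ℝ) / (2 * p.toReal))) = T * (√t)⁻¹ := by
    rw [hT, Real.sqrt_eq_rpow, ← Real.rpow_neg ht.le, ← Real.rpow_add ht]
    congr 1
    ring
  rw [h4] at h3
  have h5 : ‖Y x - Y y‖ ≤ A * N * T + A * N * T + ‖x - y‖ * N * (T * (√t)⁻¹) := by
    -- The comparison goes through the smoothed field at time `t`, which is not tied to `|x - y|`:
    -- two smoothing errors, and one increment of a Lipschitz function.
    have e : Y x - Y y = (Y x - ∫ z, heat t (x - z) • Y z) - (Y y - ∫ z, heat t (y - z) • Y z) +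
      ((∫ z, heat t (x - z) • Y z) - ∫ z, heat t (y - z) • Y z) := by abel
    rw [e]
    exact (norm_add_le _ _).trans (add_le_add ((norm_sub_le _ _).trans (add_le_add h1 h2)) h3)
  refine h5.trans ?_
  have hq : 0 ≤ ‖x - y‖ / √t := by positivity
  have e2 : morreyConst d p = 2 * A + 1 := rfl
  rw [e2]
  have e3 : ‖x - y‖ * N * (T * (√t)⁻¹) = N * T * (‖x - y‖ / √t) := by ring
  rw [e3]
  have hNT : 0 ≤ N * T := by positivity
  nlinarith [mul_nonneg (mul_nonneg hA0 hNT) hq, mul_nonneg hNT hq]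

/-- The commutator estimate: the second derivative of `e^{tΔ} g`, one of them being taken along
`Y`, has an integrable singularity at `t = 0`. -/
theorem norm_integral_hheat_field_le (ht : 0 < t) (hY : Continuous Y) (hK : ∀ x, ‖Y x‖ ≤ K)
    (hp1 : 1 ≤ p) (hpt : p < ⊤) (hdp : (d : ℝ) < p.toReal)
    (hYD : HasWeakGradient Y D) (hD : MemLp D p) {g w : Eu d → ℂ} (hg : AEStronglyMeasurable g)
    {G : ℝ} (hG : ∀ᵐ y, ‖g y‖ ≤ G) (hw : HasWeakDiv g Y w) (hwp : MemLp w p) (a x : Eu d) :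
    ‖∫ y, hheat t a (Y x) (x - y) • g y‖ ≤ heatConst d * ‖a‖ *
      (morreyConst d p * (eLpNorm D p volume).toReal * G + (eLpNorm w p volume).toReal) *
        t ^ (-(1 / 2 + d / (2 * p.toReal))) := by
  have hC := heatConst_pos d
  set N := (eLpNorm D p volume).toReal with hN
  set T := t ^ (1 / 2 - (d : ℝ) / (2 * p.toReal)) with hT
  have hT0 : 0 < T := by positivity
  have hKx : Integrable fun y => hheat t a (Y x) (x - y) • g y :=
    integrable_smul_of_abs_le_of_bounded (by positivity : 0 < 2 * t) hg hG x
      (continuous_hheat t _ _) (abs_hheat_le ht _ _)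
  have hKy : Integrable fun y => hheat t a (Y y) (x - y) • g y := by
    refine ((integrable_heat_sub (by positivity : 0 < 2 * t) x).const_mul
      (heatConst d * ‖a‖ * K * t⁻¹ * G)).mono' ?_ ?_
    · have := continuous_heat (d := d) t
      have hc : Continuous fun y => hheat t a (Y y) (x - y) := by
        unfold hheat
        fun_prop
      exact hc.aestronglyMeasurable.smul hg
    · filter_upwards [hG] with y hy
      rw [norm_smul]
      have h1 := abs_hheat_le ht a (Y y) (x - y)
      have h2 := heat_pos (by positivity : 0 < 2 * t) (x - y)
      have hG0 := (norm_nonneg _).trans hy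
      calc _ ≤ (heatConst d * ‖a‖ * ‖Y y‖ * t⁻¹ * heat (2 * t) (x - y)) * G :=
            mul_le_mul h1 hy (norm_nonneg _) (by positivity)
        _ ≤ (heatConst d * ‖a‖ * K * t⁻¹ * heat (2 * t) (x - y)) * G := by
            gcongr
            exact hK y
        _ = _ := by ring
  -- The splitting `Y x = (Y x - Y y) + Y y`; the second part is integrated by parts against `div (g
  -- Y)`.
  have h1 : ∫ y, hheat t a (Y x) (x - y) • g y =
      (∫ y, hheat t a (Y x - Y y) (x - y) • g y) + ∫ y, dheat t a (x - y) • w y := by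
    rw [← integral_hheat_smul_of_weak ht hY hK hg hG hp1 hpt hwp hw.2.2 a x]
    have h2 : ∫ y, hheat t a (Y x - Y y) (x - y) • g y =
        (∫ y, hheat t a (Y x) (x - y) • g y) - ∫ y, hheat t a (Y y) (x - y) • g y := by
      rw [← integral_sub hKx hKy]
      congr 1
      ext1 y
      rw [← sub_smul]
      congr 1
      simp only [hheat, inner_sub_right]
      ring
    rw [h2, sub_add_cancel]
  have hM0 : 0 ≤ morreyConst d p := by
    have := (norm_nonneg _).trans (norm_sub_le_morrey ht hY hK hp1 hpt hdp hYD hD x x)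
    have hp0 : 0 < p.toReal := lt_of_le_of_lt (Nat.cast_nonneg d) hdp
    have ha : 0 < 1 / 2 - d / (2 * p.toReal) := by
      rw [sub_pos, div_lt_div_iff₀ (by positivity) (by norm_num)]
      linarith
    unfold morreyConst
    positivity
  have hA : ‖∫ y, hheat t a (Y x - Y y) (x - y) • g y‖ ≤
      heatConst d * ‖a‖ * t⁻¹ * (morreyConst d p * N * T) * G := by
    refine (norm_integral_le_of_norm_le ((integrable_heat_sub (by positivity : 0 < 2 * t)
      x).const_mul (heatConst d * ‖a‖ * t⁻¹ * (morreyConst d p * N * T) * G)) ?_).trans_eq ?_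
    · filter_upwards [hG] with y hy
      have hG0 := (norm_nonneg _).trans hy
      have h2 := heat_pos (by positivity : 0 < 2 * t) (x - y)
      set u := Y x - Y y with hu
      have h3 := abs_hheat_mul_le ht a u (x - y)
      have h4 := norm_sub_le_morrey ht hY hK hp1 hpt hdp hYD hD x y
      rw [norm_smul]
      -- The factor `1 + ‖x - y‖/√t` of Morrey's inequality cancels against the one in
      -- `abs_hheat_mul_le`.
      have h5 : |hheat t a u (x - y)| ≤
          heatConst d * ‖a‖ * t⁻¹ * (morreyConst d p * N * T) * heat (2 * t) (x - y) := by
        have hs : 0 < 1 + ‖x - y‖ / √t := by positivity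
        refine le_of_mul_le_mul_right (h3.trans ?_) hs
        calc _ ≤ heatConst d * ‖a‖ * (morreyConst d p * N * T * (1 + ‖x - y‖ / √t)) * t⁻¹ *
              heat (2 * t) (x - y) := by gcongr
          _ = _ := by ring
      calc _ ≤ (heatConst d * ‖a‖ * t⁻¹ * (morreyConst d p * N * T) * heat (2 * t) (x - y)) * G :=
            mul_le_mul h5 hy (norm_nonneg _) (by positivity)
        _ = _ := by ring
    · rw [integral_const_mul, integral_heat_sub (by positivity), mul_one]
  have hB : ‖∫ y, dheat t a (x - y) • w y‖ ≤ heatConst d * ‖a‖ * (√t)⁻¹ *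
      (t ^ (-((d : ℝ) / (2 * p.toReal))) * (eLpNorm w p volume).toReal) := by
    refine (norm_integral_smul_le_of_abs_le (by positivity : 0 < 2 * t) hp1 hpt
      hwp x (by positivity) (abs_dheat_le ht a)).trans ?_
    have h6 := rpow_four_pi_mul_le one_le_two
      (by positivity : 0 ≤ (d : ℝ) / (2 * p.toReal)) ht
    gcongr
  rw [h1]
  refine (norm_add_le _ _).trans ((add_le_add hA hB).trans_eq ?_)
  have e1 : t⁻¹ * T = t ^ (-(1 / 2 + (d : ℝ) / (2 * p.toReal))) := by
    rw [hT, ← Real.rpow_neg_one, ← Real.rpow_add ht]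
    congr 1
    ring
  have e2 : (√t)⁻¹ * t ^ (-((d : ℝ) / (2 * p.toReal))) =
      t ^ (-(1 / 2 + (d : ℝ) / (2 * p.toReal))) := by
    rw [Real.sqrt_eq_rpow, ← Real.rpow_neg ht.le, ← Real.rpow_add ht]
    congr 1
    ring
  calc _ = heatConst d * ‖a‖ * (morreyConst d p * N * G) * (t⁻¹ * T) +
        heatConst d * ‖a‖ * (eLpNorm w p volume).toReal *
          ((√t)⁻¹ * t ^ (-((d : ℝ) / (2 * p.toReal)))) := by ring
    _ = _ := by rw [e1, e2]; ring

end Morrey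

/-! ### Almost everywhere convergence of the heat semigroup -/

section LebesguePoints

variable {d : ℕ} {t : ℝ}

/-- The density which writes the heat kernel as a superposition of indicators of balls. -/
noncomputable def heatLayer (d : ℕ) (t r : ℝ) : ℝ :=
  (4 * Real.pi * t) ^ (-((d : ℝ) / 2)) * (r / (2 * t) * Real.exp (-(r ^ 2) / (4 * t)))

theorem heatLayer_nonneg (d : ℕ) (ht : 0 < t) {r : ℝ} (hr : 0 ≤ r) : 0 ≤ heatLayer d t r := by
  unfold heatLayer; positivity

theorem measurable_heatLayer (d : ℕ) (t : ℝ) : Measurable (heatLayer d t) := by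
  unfold heatLayer; fun_prop

/-- `heatLayer` is minus the derivative of the radial profile of the kernel, which vanishes at
infinity. -/
theorem integral_heatLayer (ht : 0 < t) (z : Eu d) :
    ∫ r in Set.Ioi ‖z‖, heatLayer d t r = heat t z := by
  have h := integral_Ioi_of_hasDerivAt_of_nonneg' (a := ‖z‖) (l := 0)
    (g := fun r => -((4 * Real.pi * t) ^ (-((d : ℝ) / 2)) * Real.exp (-(r ^ 2) / (4 * t))))
    (g' := heatLayer d t) ?_ ?_ ?_
  · rw [h]; simp [heat]
  · intro r _
    have h1 : HasDerivAt (fun r : ℝ => -(r ^ 2) / (4 * t)) (-(2 * r) / (4 * t)) r := by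
      simpa using ((hasDerivAt_pow 2 r).neg).div_const (4 * t)
    refine ((h1.exp.const_mul ((4 * Real.pi * t) ^ (-((d : ℝ) / 2)))).neg).congr_deriv ?_
    unfold heatLayer
    field_simp
    ring
  · intro r hr
    exact heatLayer_nonneg d ht ((norm_nonneg z).trans hr.le)
  · have h1 : Tendsto (fun r : ℝ => -(r ^ 2) / (4 * t)) atTop atBot :=
      (tendsto_neg_atTop_atBot.comp (tendsto_pow_atTop two_ne_zero)).atBot_div_const (by positivity)
    have := ((Real.tendsto_exp_atBot.comp h1).const_mul
      ((4 * Real.pi * t) ^ (-((d : ℝ) / 2)))).neg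
    simpa using this

theorem integrableOn_heatLayer_mul_pow (d : ℕ) (ht : 0 < t) :
    IntegrableOn (fun r => heatLayer d t r * r ^ d) (Set.Ioi 0) := by
  have h := (integrableOn_rpow_mul_exp_neg_mul_sq (b := 1 / (4 * t)) (by positivity)
    (s := ((d + 1 : ℕ) : ℝ)) (by
      have : (0 : ℝ) ≤ ((d + 1 : ℕ) : ℝ) := Nat.cast_nonneg _
      linarith)).const_mul ((4 * Real.pi * t) ^ (-((d : ℝ) / 2)) / (2 * t))
  refine h.congr (Eventually.of_forall fun r => ?_)
  simp only [heatLayer, Real.rpow_natCast]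
  rw [show -(1 / (4 * t)) * r ^ 2 = -(r ^ 2) / (4 * t) by ring]
  ring

variable {g : Eu d → ℂ} {G : ℝ}

theorem norm_setIntegral_closedBall_le (hG : ∀ᵐ y, ‖g y‖ ≤ G) (x : Eu d) (r : ℝ) :
    ‖∫ y in Metric.closedBall x r, g y‖ ≤ G * volume.real (Metric.closedBall x r) :=
  norm_setIntegral_le_of_norm_le_const_ae measure_closedBall_lt_top (ae_restrict_of_ae hG)

/-- Layer-cake formula: insert `integral_heatLayer` and exchange the integrals over the set `|x - y|
≤ r`. -/
theorem integral_heat_smul_eq_layers (ht : 0 < t) (hg : AEStronglyMeasurable g)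
    (hG : ∀ᵐ y, ‖g y‖ ≤ G) (x : Eu d) :
    ∫ y, heat t (x - y) • g y =
      ∫ r in Set.Ioi 0, heatLayer d t r • ∫ y in Metric.closedBall x r, g y := by
  have hG0 : 0 ≤ G := by
    obtain ⟨y, hy⟩ := hG.exists
    exact (norm_nonneg _).trans hy
  set B : Set (ℝ × Eu d) := {q | dist q.2 x ≤ q.1} with hB
  have hBm : MeasurableSet B :=
    (isClosed_le (continuous_snd.dist continuous_const) continuous_fst).measurableSet
  set F : ℝ × Eu d → ℂ := B.indicator fun q => heatLayer d t q.1 • g q.2 with hF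
  have hFr : ∀ r, (fun y => F (r, y)) =
      (Metric.closedBall x r).indicator fun y => heatLayer d t r • g y := by
    intro r
    ext y
    by_cases h : dist y x ≤ r <;> simp [hF, hB, h]
  have hFy : ∀ y, (fun r => F (r, y)) =
      (Set.Ici ‖x - y‖).indicator fun r => heatLayer d t r • g y := by
    intro y
    ext r
    by_cases h : ‖x - y‖ ≤ r <;> simp [hF, hB, h, dist_eq_norm, norm_sub_rev y x]
  have hFm : AEStronglyMeasurable F ((volume.restrict (Set.Ioi 0)).prod volume) :=
    ((((measurable_heatLayer d t).comp measurable_fst).aestronglyMeasurable).smul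
      hg.comp_snd).indicator hBm
  have hgl : ∀ r, IntegrableOn g (Metric.closedBall x r) := fun r =>
    Measure.integrableOn_of_bounded measure_closedBall_lt_top.ne hg (ae_restrict_of_ae hG)
  have hFi : Integrable F ((volume.restrict (Set.Ioi 0)).prod volume) := by
    rw [integrable_prod_iff hFm]
    constructor
    · refine Eventually.of_forall fun r => ?_
      rw [hFr, integrable_indicator_iff measurableSet_closedBall]
      exact (hgl r).smul (heatLayer d t r)
    · refine (((integrableOn_heatLayer_mul_pow d ht).const_mul
        (G * volume.real (Metric.ball (0 : Eu d) 1)))).mono' hFm.norm.integral_prod_right' ?_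
      refine ae_restrict_of_forall_mem measurableSet_Ioi fun r hr => ?_
      have hr0 : 0 < r := hr
      have hl := heatLayer_nonneg d ht hr0.le
      rw [Real.norm_of_nonneg (integral_nonneg fun y => norm_nonneg _)]
      have h1 : ∀ y, ‖F (r, y)‖ =
          (Metric.closedBall x r).indicator (fun y => heatLayer d t r * ‖g y‖) y := by
        intro y
        rw [show F (r, y) = _ from congrFun (hFr r) y, norm_indicator_eq_indicator_norm]
        simp only [norm_smul, Real.norm_of_nonneg hl]
      simp only [h1]
      rw [integral_indicator measurableSet_closedBall, integral_const_mul]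
      have h2 : ∫ y in Metric.closedBall x r, ‖g y‖ ≤
          G * volume.real (Metric.closedBall x r) := by
        refine (le_abs_self _).trans (norm_setIntegral_le_of_norm_le_const_ae
          (f := fun y => ‖g y‖) measure_closedBall_lt_top (ae_restrict_of_ae ?_))
        exact hG.mono fun y hy => by simpa using hy
      have h3 := Measure.addHaar_real_closedBall (volume : Measure (Eu d)) x hr0.le
      rw [finrank_euclideanSpace_fin] at h3
      rw [h3] at h2
      calc _ ≤ heatLayer d t r * (G * (r ^ d * volume.real (Metric.ball (0 : Eu d) 1))) := by
            gcongr
        _ = _ := by ring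
  have hsw := integral_integral_swap (f := fun r y => F (r, y))
    (μ := volume.restrict (Set.Ioi (0 : ℝ))) (ν := (volume : Measure (Eu d))) hFi
  have hl : ∀ r, ∫ y, F (r, y) = heatLayer d t r • ∫ y in Metric.closedBall x r, g y := by
    intro r
    rw [hFr, integral_indicator measurableSet_closedBall, integral_smul]
  have hr : ∀ y, x ≠ y → ∫ r in Set.Ioi 0, F (r, y) = heat t (x - y) • g y := by
    intro y hxy
    have hp : 0 < ‖x - y‖ := norm_pos_iff.2 (sub_ne_zero.2 hxy)
    rw [hFy, setIntegral_indicator measurableSet_Ici, Set.inter_eq_right.2, integral_smul_const,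
      integral_Ici_eq_integral_Ioi, integral_heatLayer ht]
    intro r hr
    exact hp.trans_le hr
  simp only [hl] at hsw
  rw [hsw]
  -- The identity `hr` assumes `y ≠ x`, and a point is negligible only for `d ≥ 1`; in dimension `0`
  -- the single point carries all the mass and is treated directly.
  rcases Nat.eq_zero_or_pos d with rfl | hd
  · have hF0 : ∀ y, ∫ r in Set.Ioi 0, F (r, y) = heat t (x - y) • g y := by
      intro y
      have hxy : ‖x - y‖ = 0 := by rw [Subsingleton.elim x y]; simp
      rw [hFy, hxy, setIntegral_indicator measurableSet_Ici, Set.inter_eq_left.2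
        Set.Ioi_subset_Ici_self, integral_smul_const, ← hxy, integral_heatLayer ht]
    simp only [hF0]
  · have : Nonempty (Fin d) := ⟨⟨0, hd⟩⟩
    refine integral_congr_ae ?_
    have : ∀ᵐ y : Eu d, y ≠ x := Measure.ae_ne volume x
    filter_upwards [this] with y hy
    exact (hr y hy.symm).symm

theorem stronglyMeasurable_setIntegral_closedBall (hg : AEStronglyMeasurable g) (x : Eu d) :
    StronglyMeasurable fun r => ∫ y in Metric.closedBall x r, g y := by
  set B : Set (ℝ × Eu d) := {q | dist q.2 x ≤ q.1} with hB
  have hBm : MeasurableSet B :=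
    (isClosed_le (continuous_snd.dist continuous_const) continuous_fst).measurableSet
  have h1 : StronglyMeasurable (B.indicator fun q => hg.mk g q.2) :=
    (hg.stronglyMeasurable_mk.comp_measurable measurable_snd).indicator hBm
  have h2 := h1.integral_prod_right' (ν := volume)
  convert! h2 using 2 with r
  have h3 : (fun y => B.indicator (fun q => hg.mk g q.2) (r, y)) =
      (Metric.closedBall x r).indicator (hg.mk g) := by
    ext y
    by_cases h : dist y x ≤ r <;> simp [hB, h]
  rw [h3, integral_indicator measurableSet_closedBall]
  exact integral_congr_ae (ae_restrict_of_ae hg.ae_eq_mk)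

/-- The heat semigroup as a superposition of averages over balls. -/
theorem integral_heat_smul_eq_averages (ht : 0 < t) (hg : AEStronglyMeasurable g)
    (hG : ∀ᵐ y, ‖g y‖ ≤ G) (x : Eu d) :
    ∫ y, heat t (x - y) • g y = ∫ r in Set.Ioi 0,
      (heatLayer d 1 r * r ^ d * volume.real (Metric.ball (0 : Eu d) 1)) •
        ⨍ y in Metric.closedBall x (√t * r), g y := by
  have hs : 0 < √t := Real.sqrt_pos.2 ht
  rw [integral_heat_smul_eq_layers ht hg hG]
  have h := integral_comp_mul_left_Ioi
    (fun r => heatLayer d t r • ∫ y in Metric.closedBall x r, g y) 0 hs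
  rw [mul_zero] at h
  have h2 := (smul_right_injective ℂ hs.ne') |>.eq_iff.2 h
  simp only [smul_smul] at h2
  rw [mul_inv_cancel₀ hs.ne', one_smul] at h2
  rw [← h2, ← integral_smul]
  refine setIntegral_congr_fun measurableSet_Ioi fun r hr => ?_
  have hr0 : 0 < r := hr
  have h3 := Measure.addHaar_real_closedBall (volume : Measure (Eu d)) x (mul_pos hs hr0).le
  rw [finrank_euclideanSpace_fin] at h3
  have hω : 0 < volume.real (Metric.ball (0 : Eu d) 1) :=
    ENNReal.toReal_pos (Metric.measure_ball_pos _ _ one_pos).ne' measure_ball_lt_top.ne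
  -- Parabolic scaling. One factor `√t` is the Jacobian; the other `d` of them normalise the volume
  -- of the ball, so that integrals become averages.
  have h4 : heatLayer d t (√t * r) = (√t ^ d)⁻¹ * (√t)⁻¹ * heatLayer d 1 r := by
    unfold heatLayer
    have e1 : t ^ (-((d : ℝ) / 2)) = (√t ^ d)⁻¹ := by
      rw [Real.rpow_neg ht.le, Real.sqrt_eq_rpow, ← Real.rpow_natCast, ← Real.rpow_mul ht.le]
      congr 2
      ring
    have e2 : -((√t * r) ^ 2) / (4 * t) = -(r ^ 2) / (4 * 1) := by
      rw [mul_pow, Real.sq_sqrt ht.le]; field_simp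
    have e3 : √t * r / (2 * t) = (√t)⁻¹ * (r / (2 * 1)) := by
      conv_lhs => rw [← Real.mul_self_sqrt ht.le]
      rw [Real.sqrt_mul_self hs.le]
      field_simp
    rw [Real.mul_rpow (by positivity) ht.le, e1, e2, e3, mul_one (4 * Real.pi)]
    ring
  rw [setAverage_eq, h3, h4]
  simp only [smul_smul]
  congr 1
  rw [mul_pow]
  field_simp

/-- As `g` is only bounded and measurable, convergence holds at Lebesgue points. In
`integral_heat_smul_eq_averages` the weight in `r` does not depend on `t`, while the balls shrink;
dominated convergence concludes. -/
theorem ae_tendsto_integral_heat_smul (hg : AEStronglyMeasurable g)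
    (hG : ∀ᵐ y, ‖g y‖ ≤ G) :
    ∀ᵐ x, Tendsto (fun t => ∫ y, heat t (x - y) • g y) (𝓝[>] 0) (𝓝 (g x)) := by
  have hG0 : 0 ≤ G := by
    obtain ⟨y, hy⟩ := hG.exists
    exact (norm_nonneg _).trans hy
  have hloc : LocallyIntegrable g := by
    have h : MemLp g ⊤ volume := memLp_top_of_bound hg G hG
    exact h.locallyIntegrable le_top
  filter_upwards [IsUnifLocDoublingMeasure.ae_tendsto_average volume hloc 1] with x hx
  set Q : ℝ → ℝ := fun r => heatLayer d 1 r * r ^ d * volume.real (Metric.ball (0 : Eu d) 1)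
    with hQ
  have hQi : IntegrableOn Q (Set.Ioi 0) :=
    (integrableOn_heatLayer_mul_pow d one_pos).mul_const _
  -- That `Q` has total mass one comes from the averages formula applied to a constant function.
  have hlim : ∫ r in Set.Ioi 0, Q r • g x = g x := by
    have h := integral_heat_smul_eq_averages (d := d) one_pos
      (g := fun _ => g x) aestronglyMeasurable_const
      (Eventually.of_forall fun _ => le_refl ‖g x‖) x
    rw [integral_smul_const, integral_heat_sub one_pos, one_smul] at h
    refine Eq.trans ?_ h.symm
    refine setIntegral_congr_fun measurableSet_Ioi fun r hr => ?_
    have hr0 : 0 < r := hr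
    simp only [Real.sqrt_one, one_mul]
    rw [setAverage_const (Metric.measure_closedBall_pos volume x hr0).ne'
      measure_closedBall_lt_top.ne]
  rw [← hlim]
  have h2 : ∀ᶠ t : ℝ in 𝓝[>] 0, ∫ r in Set.Ioi 0, Q r • ⨍ y in Metric.closedBall x (√t * r), g y =
      ∫ y, heat t (x - y) • g y := by
    filter_upwards [self_mem_nhdsWithin] with t ht
    exact (integral_heat_smul_eq_averages ht hg hG x).symm
  refine Tendsto.congr' h2 ?_
  have hav : ∀ r, ‖⨍ y in Metric.closedBall x r, g y‖ ≤ G := by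
    intro r
    rw [setAverage_eq, norm_smul, norm_inv, Real.norm_of_nonneg measureReal_nonneg]
    rcases (measureReal_nonneg (μ := (volume : Measure (Eu d)))
      (s := Metric.closedBall x r)).eq_or_lt with h0 | h0
    · rw [← h0]; simpa using hG0
    · rw [inv_mul_le_iff₀ h0, mul_comm]
      exact norm_setIntegral_closedBall_le hG x r
  apply tendsto_integral_filter_of_dominated_convergence (fun r => Q r * G)
  · refine Eventually.of_forall fun t => ?_
    have h3 : StronglyMeasurable fun r => ⨍ y in Metric.closedBall x r, g y := by
      simp only [setAverage_eq]
      have h4 : Measurable fun r => volume.real (Metric.closedBall x r) :=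
        (Monotone.measurable fun r s hrs => measure_mono (Metric.closedBall_subset_closedBall
          hrs)).ennreal_toReal
      exact h4.inv.stronglyMeasurable.smul (stronglyMeasurable_setIntegral_closedBall hg x)
    exact hQi.aestronglyMeasurable.smul
      (h3.comp_measurable (measurable_const_mul (√t))).aestronglyMeasurable
  · refine Eventually.of_forall fun t =>
      ae_restrict_of_forall_mem measurableSet_Ioi fun r hr => ?_
    have hr0 : 0 < r := hr
    have hQ0 : 0 ≤ Q r := by
      have := heatLayer_nonneg d one_pos hr0.le
      positivity
    rw [norm_smul, Real.norm_of_nonneg hQ0]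
    gcongr
    exact hav _
  · exact hQi.mul_const G
  · refine ae_restrict_of_forall_mem measurableSet_Ioi fun r hr => ?_
    have hr0 : 0 < r := hr
    refine Tendsto.const_smul ?_ (Q r)
    have hδ : Tendsto (fun t : ℝ => √t * r) (𝓝[>] 0) (𝓝[>] 0) := by
      refine tendsto_nhdsWithin_iff.2 ⟨?_, ?_⟩
      · have hc : Continuous fun t : ℝ => √t * r := by fun_prop
        have := (hc.tendsto 0).mono_left (nhdsWithin_le_nhds (s := Set.Ioi 0))
        simpa using this
      · filter_upwards [self_mem_nhdsWithin] with t ht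
        exact mul_pos (Real.sqrt_pos.2 ht) hr0
    refine hx (fun _ => x) _ hδ ?_
    filter_upwards with t
    exact Metric.mem_closedBall_self (by positivity)

end LebesguePoints

/-! ### The regularised Hessian of `(η - Δ)⁻¹ g` -/

section Hessian

variable {d : ℕ} {t : ℝ}

/-- `∫_ε^R e^{-ηt} ∂_a ∂_b e^{tΔ} g (x) dt`. -/
noncomputable def heatHessian (η ε R : ℝ) (g : Eu d → ℂ) (a b x : Eu d) : ℂ :=
  ∫ t in ε..R, Real.exp (-(η * t)) • ∫ y, hheat t a b (x - y) • g y

/-- The convolution kernel of `heatHessian`. -/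
noncomputable def hessKernel (η ε R : ℝ) (a b z : Eu d) : ℝ :=
  ∫ t in ε..R, Real.exp (-(η * t)) * hheat t a b z

theorem hessKernel_neg (η ε R : ℝ) (a b z : Eu d) :
    hessKernel η ε R a b (-z) = hessKernel η ε R a b z := by
  simp only [hessKernel, hheat_neg]

theorem measurable_exp_mul_hheat (η : ℝ) (a b : Eu d) :
    Measurable fun q : ℝ × Eu d => Real.exp (-(η * q.1)) * hheat q.1 a b q.2 := by
  have := measurable_hheat a b
  fun_prop

theorem abs_exp_mul_hheat_le {η ε R : ℝ} (hη : 0 ≤ η) (hε : 0 < ε) (a b : Eu d) {s : ℝ}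
    (hs : s ∈ Set.Ioc ε R) (z : Eu d) :
    |Real.exp (-(η * s)) * hheat s a b z| ≤ heatConst d * ‖a‖ * ‖b‖ * ε⁻¹ * heat (2 * s) z := by
  have hs0 := hε.trans hs.1
  have hC := heatConst_pos d
  have hp := heat_pos (by positivity : 0 < 2 * s) z
  have he : Real.exp (-(η * s)) ≤ 1 := Real.exp_le_one_iff.2 (by
    have := mul_nonneg hη hs0.le
    linarith)
  rw [abs_mul, abs_of_pos (Real.exp_pos _)]
  calc _ ≤ 1 * (heatConst d * ‖a‖ * ‖b‖ * s⁻¹ * heat (2 * s) z) := by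
        gcongr
        exact abs_hheat_le hs0 a b z
    _ ≤ 1 * (heatConst d * ‖a‖ * ‖b‖ * ε⁻¹ * heat (2 * s) z) := by
        gcongr
        exact hs.1.le
    _ = _ := one_mul _

theorem measurable_hessKernel {η ε R : ℝ} (hR : ε ≤ R) (a b : Eu d) :
    Measurable fun z : Eu d => hessKernel η ε R a b z := by
  simp only [hessKernel, intervalIntegral.integral_of_le hR]
  exact ((measurable_exp_mul_hheat η a b).stronglyMeasurable.integral_prod_left
    (μ := volume.restrict (Set.Ioc ε R))).measurable

theorem integrable_hessKernel {η ε R : ℝ} (hη : 0 ≤ η) (hε : 0 < ε) (hR : ε ≤ R) (a b : Eu d) :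
    Integrable fun z : Eu d => hessKernel η ε R a b z := by
  simp only [hessKernel, intervalIntegral.integral_of_le hR]
  have hpos : ∀ s ∈ Set.Ioc ε R, 0 < 2 * s := fun s hs => by
    have := hε.trans hs.1
    positivity
  have hdom : ∀ s ∈ Set.Ioc ε R, Integrable fun z : Eu d =>
      heatConst d * ‖a‖ * ‖b‖ * ε⁻¹ * heat (2 * s) z := fun s hs =>
    (integrable_heat (hpos s hs)).const_mul (heatConst d * ‖a‖ * ‖b‖ * ε⁻¹)
  refine (integrable_prod_of_integral_norm_le (M := heatConst d * ‖a‖ * ‖b‖ * ε⁻¹)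
    (measurable_exp_mul_hheat η a b).aestronglyMeasurable (fun s hs => ?_)
    (fun s hs => ?_)).integral_prod_right
  · have h1 : Continuous fun z : Eu d => Real.exp (-(η * s)) * hheat s a b z :=
      continuous_const.mul (continuous_hheat s a b)
    exact (hdom s hs).mono' h1.aestronglyMeasurable
      (Eventually.of_forall (abs_exp_mul_hheat_le hη hε a b hs))
  · refine (integral_mono_of_nonneg (Eventually.of_forall fun y => norm_nonneg _)
      (hdom s hs) (Eventually.of_forall (abs_exp_mul_hheat_le hη hε a b hs))).trans_eq ?_
    rw [integral_const_mul, integral_heat (hpos s hs), mul_one]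

variable {g : Eu d → ℂ} {G : ℝ}

theorem heatHessian_eq_integral_hessKernel {η ε R : ℝ} (hη : 0 ≤ η) (hε : 0 < ε) (hR : ε ≤ R)
    (hg : AEStronglyMeasurable g) (hG : ∀ᵐ y, ‖g y‖ ≤ G) (a b x : Eu d) :
    heatHessian η ε R g a b x = ∫ y, hessKernel η ε R a b (x - y) • g y := by
  unfold heatHessian hessKernel
  rw [← intervalIntegral_integral_swap hR (K := fun s z => Real.exp (-(η * s)) * hheat s a b z)
    (X := fun _ => x) (measurable_exp_mul_hheat η a b)
    (fun s => continuous_const.mul (continuous_hheat s a b)) (τ := fun s => 2 * s)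
    (fun s hs => by have := hε.trans hs.1; positivity)
    (fun s hs => abs_exp_mul_hheat_le hη hε a b hs) measurable_const hg hG]
  congr 1
  ext s
  rw [← integral_smul]
  simp only [smul_smul]

theorem integrable_mul_convolution {k : Eu d → ℝ} (hk : Integrable k) (hkm : Measurable k)
    (hg : AEStronglyMeasurable g) (hG : ∀ᵐ y, ‖g y‖ ≤ G) {φ : Eu d → ℂ} (hφ : Integrable φ) :
    Integrable (fun q : Eu d × Eu d => φ q.1 * (k (q.1 - q.2) • g q.2))
      ((volume : Measure (Eu d)).prod volume) := by
  have hG0 : 0 ≤ G := by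
    obtain ⟨y, hy⟩ := hG.exists
    exact (norm_nonneg _).trans hy
  have hm : AEStronglyMeasurable (fun q : Eu d × Eu d => φ q.1 * (k (q.1 - q.2) • g q.2))
      ((volume : Measure (Eu d)).prod volume) :=
    hφ.aestronglyMeasurable.comp_fst.mul
      ((hkm.comp (measurable_fst.sub measurable_snd)).aestronglyMeasurable.smul hg.comp_snd)
  have hbound : ∀ x, ∀ᵐ y, ‖φ x * (k (x - y) • g y)‖ ≤ ‖φ x‖ * G * ‖k (x - y)‖ := fun x => by
    filter_upwards [hG] with y hy
    rw [norm_mul, norm_smul]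
    calc ‖φ x‖ * (‖k (x - y)‖ * ‖g y‖) ≤ ‖φ x‖ * (‖k (x - y)‖ * G) := by gcongr
      _ = _ := by ring
  have hdom : ∀ x, Integrable fun y => ‖φ x‖ * G * ‖k (x - y)‖ := fun x =>
    (hk.norm.comp_sub_left x).const_mul _
  rw [integrable_prod_iff hm]
  constructor
  · refine Eventually.of_forall fun x => (hdom x).mono' ?_ (hbound x)
    have h1 : Measurable fun y => k (x - y) := hkm.comp (measurable_const.sub measurable_id)
    exact (h1.aestronglyMeasurable.smul hg).const_mul (φ x)
  · refine (hφ.norm.mul_const (G * ∫ z, ‖k z‖)).mono' hm.norm.integral_prod_right'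
      (Eventually.of_forall fun x => ?_)
    rw [Real.norm_of_nonneg (integral_nonneg fun y => norm_nonneg _)]
    refine (integral_mono_of_nonneg (Eventually.of_forall fun y => norm_nonneg _)
      (hdom x) (hbound x)).trans_eq ?_
    rw [integral_const_mul, integral_sub_left_eq_self (fun z => ‖k z‖) volume x]
    ring

theorem integral_mul_kernel_comm {k : Eu d → ℝ} (hke : ∀ z, k (-z) = k z) (g φ : Eu d → ℂ)
    (y : Eu d) : ∫ x, φ x * (k (x - y) • g y) = g y * ∫ x, k (y - x) • φ x := by
  rw [← integral_const_mul]
  congr 1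
  ext x
  rw [show x - y = -(y - x) by abel, hke]
  simp only [Complex.real_smul]
  ring

/-- Symmetry of the convolution with an even kernel. -/
theorem integral_mul_convolution_comm {k : Eu d → ℝ} (hk : Integrable k) (hkm : Measurable k)
    (hke : ∀ z, k (-z) = k z) (hg : AEStronglyMeasurable g) (hG : ∀ᵐ y, ‖g y‖ ≤ G)
    {φ : Eu d → ℂ} (hφ : Integrable φ) :
    ∫ x, φ x * ∫ y, k (x - y) • g y = ∫ y, g y * ∫ x, k (y - x) • φ x := by
  have hsw := integral_integral_swap (f := fun x y => φ x * (k (x - y) • g y))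
    (integrable_mul_convolution hk hkm hg hG hφ)
  simp only [integral_const_mul, integral_mul_kernel_comm hke] at hsw
  exact hsw

theorem SchwartzMap.integral_fderiv_smul_eq_neg (f : 𝓢(Eu d, ℂ)) (v : Eu d) (φ : Eu d → ℝ)
    (hφ : ContDiff ℝ ∞ φ) (hs : HasCompactSupport φ) :
    ∫ x, (fderiv ℝ φ x v) • f x = - ∫ x, φ x • (∂_{v} f) x := by
  have hfc : ∀ f : 𝓢(Eu d, ℂ), Continuous f := fun f => f.continuous
  have hφ' : Continuous fun x => fderiv ℝ φ x v :=
    (hφ.continuous_fderiv (by simp)).clm_apply continuous_const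
  have hs' : HasCompactSupport fun x => fderiv ℝ φ x v := hs.fderiv_apply (𝕜 := ℝ) v
  have := integral_smul_fderiv_eq_neg_fderiv_smul_of_integrable (f := φ) (g := (f : Eu d → ℂ))
    (v := v) (μ := volume)
    ((hφ'.smul (hfc f)).integrable_of_hasCompactSupport hs'.smul_right)
    ((hφ.continuous.smul (hfc (∂_{v} f))).integrable_of_hasCompactSupport hs.smul_right)
    ((hφ.continuous.smul (hfc f)).integrable_of_hasCompactSupport hs.smul_right)
    (fun x _ => hφ.differentiable (by simp) x) (fun x _ => f.differentiable x)
  simp only [SchwartzMap.lineDerivOp_apply_eq_fderiv]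
  rw [this, neg_neg]

theorem SchwartzMap.integral_hheat_smul (ht : 0 < t) (f : 𝓢(Eu d, ℂ)) (a b x : Eu d) :
    ∫ y, hheat t a b (x - y) • f y = ∫ y, heat t (x - y) • (∂_{a} (∂_{b} f)) y := by
  rw [integral_hheat_smul_of_weak ht (V := fun _ => b) continuous_const (fun _ => le_rfl)
    f.continuous.aestronglyMeasurable (Eventually.of_forall (SchwartzMap.norm_le_seminorm ℝ f))
    (le_refl 1) ENNReal.one_lt_top ((∂_{b} f).memLp 1)
    (fun φ h1 h2 => SchwartzMap.integral_fderiv_smul_eq_neg f b φ h1 h2) a x,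
    integral_dheat_smul_of_weak ht (V := fun _ => a) continuous_const (fun _ => le_rfl)
    (∂_{b} f).continuous.aestronglyMeasurable
    (Eventually.of_forall (SchwartzMap.norm_le_seminorm ℝ (∂_{b} f)))
    (le_refl 1) ENNReal.one_lt_top ((∂_{a} (∂_{b} f)).memLp 1)
    (fun φ h1 h2 => SchwartzMap.integral_fderiv_smul_eq_neg (∂_{b} f) a φ h1 h2) x]

theorem SchwartzMap.integral_lapHeat_smul (ht : 0 < t) (f : 𝓢(Eu d, ℂ)) (x : Eu d) :
    ∫ y, lapHeat t (x - y) • f y = ∫ y, heat t (x - y) • (Δ f) y := by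
  have h1 : ∀ i, Integrable fun y =>
      hheat t (EuclideanSpace.single i 1) (EuclideanSpace.single i 1) (x - y) • f y := fun i =>
    integrable_smul_of_abs_le_of_bounded (by positivity : 0 < 2 * t)
      f.continuous.aestronglyMeasurable (Eventually.of_forall (SchwartzMap.norm_le_seminorm ℝ f)) x
      (continuous_hheat t _ _) (abs_hheat_le ht _ _)
  have h2 : ∀ f : 𝓢(Eu d, ℂ), Integrable fun y => heat t (x - y) • f y := fun f =>
    integrable_smul_of_abs_le_of_bounded (c := 1) ht f.continuous.aestronglyMeasurable
      (Eventually.of_forall (SchwartzMap.norm_le_seminorm ℝ f)) x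
      (continuous_heat t) fun z => by rw [one_mul, abs_of_pos (heat_pos ht z)]
  rw [SchwartzMap.laplacian_eq_sum (EuclideanSpace.basisFun (Fin d) ℝ)]
  simp only [lapHeat, Finset.sum_smul, _root_.sum_apply, Finset.smul_sum,
    EuclideanSpace.basisFun_apply]
  rw [integral_finsetSum _ fun i _ => h1 i, integral_finsetSum _ fun i _ => h2 _]
  exact Finset.sum_congr rfl fun i _ => SchwartzMap.integral_hheat_smul ht f _ _ x

/-- With `ψ = (η - Δ)⁻¹ ∂_a ∂_b φ`, the integrand is `-d/ds (e^{-ηs} e^{sΔ} ψ)`, and the time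
integral telescopes. -/
theorem SchwartzMap.heatHessian_eq {η ε R : ℝ} (hη : 0 ≤ η) (hε : 0 < ε) (hR : ε ≤ R)
    {φ ψ : 𝓢(Eu d, ℂ)} {a b : Eu d} (h : (η : ℂ) • ψ - Δ ψ = ∂_{a} (∂_{b} φ)) (x : Eu d) :
    heatHessian η ε R φ a b x =
      Real.exp (-(η * ε)) • (∫ y, heat ε (x - y) • ψ y) -
        Real.exp (-(η * R)) • ∫ y, heat R (x - y) • ψ y := by
  have hψ := intervalIntegral_lapHeat_smul hη hε hR (ψ.continuous.aestronglyMeasurable)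
    (Eventually.of_forall (SchwartzMap.norm_le_seminorm ℝ ψ)) x
  rw [← neg_sub, ← hψ, ← intervalIntegral.integral_neg]
  refine intervalIntegral.integral_congr fun s hs => ?_
  rw [Set.uIcc_of_le hR] at hs
  have hs0 := hε.trans_le hs.1
  have h2 : ∀ f : 𝓢(Eu d, ℂ), Integrable fun y => heat s (x - y) • f y := fun f =>
    integrable_smul_of_abs_le_of_bounded (c := 1) hs0 f.continuous.aestronglyMeasurable
      (Eventually.of_forall (SchwartzMap.norm_le_seminorm ℝ f)) x
      (continuous_heat s) fun z => by rw [one_mul, abs_of_pos (heat_pos hs0 z)]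
  rw [← smul_neg, neg_sub, SchwartzMap.integral_hheat_smul hs0, ← h,
    SchwartzMap.integral_lapHeat_smul hs0, ← integral_smul η]
  have h3 : Integrable fun y => η • heat s (x - y) • ψ y := (h2 ψ).smul η
  rw [← integral_sub h3 (h2 (Δ ψ))]
  congr 2
  ext y
  simp only [_root_.sub_apply, _root_.smul_apply, smul_sub, Complex.real_smul,
    smul_eq_mul]
  ring

/-- The kernel is even, so it can be moved onto the test function, where the time integral
telescopes; the two remaining heat kernels are then moved back onto `g`. Only these boundary terms
have to be followed as `ε → 0` and `R → ∞`. -/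
theorem integral_mul_heatHessian {η ε R : ℝ} (hη : 0 ≤ η) (hε : 0 < ε) (hR : ε ≤ R)
    (hg : AEStronglyMeasurable g) (hG : ∀ᵐ y, ‖g y‖ ≤ G)
    {φ ψ : 𝓢(Eu d, ℂ)} {a b : Eu d} (h : (η : ℂ) • ψ - Δ ψ = ∂_{a} (∂_{b} φ)) :
    ∫ x, φ x * heatHessian η ε R g a b x =
      Real.exp (-(η * ε)) • (∫ x, ψ x * ∫ y, heat ε (x - y) • g y) -
        Real.exp (-(η * R)) • ∫ x, ψ x * ∫ y, heat R (x - y) • g y := by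
  have hR0 := hε.trans_le hR
  have hcomm : ∀ s, 0 < s → ∫ x, ψ x * ∫ y, heat s (x - y) • g y =
      ∫ y, g y * ∫ x, heat s (y - x) • ψ x := fun s hs =>
    integral_mul_convolution_comm (integrable_heat hs) (continuous_heat s).measurable
      (heat_neg s) hg hG ψ.integrable
  have hi : ∀ s, 0 < s → Integrable fun y => g y * ∫ x, heat s (y - x) • ψ x := fun s hs => by
    have := (integrable_mul_convolution (integrable_heat hs) (continuous_heat s).measurable hg hG
      ψ.integrable).integral_prod_right
    simpa only [integral_mul_kernel_comm (heat_neg s)] using this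
  simp only [heatHessian_eq_integral_hessKernel hη hε hR hg hG]
  rw [integral_mul_convolution_comm (integrable_hessKernel hη hε hR a b)
    (measurable_hessKernel hR a b) (hessKernel_neg η ε R a b) hg hG φ.integrable]
  simp only [← heatHessian_eq_integral_hessKernel hη hε hR φ.continuous.aestronglyMeasurable
    (Eventually.of_forall (SchwartzMap.norm_le_seminorm ℝ φ)), SchwartzMap.heatHessian_eq hη hε hR h]
  rw [hcomm ε hε, hcomm R hR0, ← integral_smul, ← integral_smul]
  have hi' : ∀ s, 0 < s → Integrable fun y =>
      Real.exp (-(η * s)) • (g y * ∫ x, heat s (y - x) • ψ x) := fun s hs => (hi s hs).smul (Real.exp (-(η * s)))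
  rw [← integral_sub (hi' ε hε) (hi' R hR0)]
  congr 1
  ext y
  simp only [Complex.real_smul]
  ring

/-- The resolvent, transposed to the Schwartz space. -/
theorem exists_schwartz_resolvent {η : ℝ} (hη : 0 < η) (φ : 𝓢(Eu d, ℂ)) :
    ∃ ψ : 𝓢(Eu d, ℂ), (η : ℂ) • ψ - Δ ψ = φ ∧ ∀ T : 𝓢'(Eu d, ℂ), helmholtzInv η T φ = T ψ := by
  open FourierTransform in
  refine ⟨𝓕 (SchwartzMap.smulLeftCLM ℂ (resolventSymbol d η) (𝓕⁻ φ)), ?_, fun T => rfl⟩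
  open FourierTransform in
  set ψ : 𝓢(Eu d, ℂ) := 𝓕 (SchwartzMap.smulLeftCLM ℂ (resolventSymbol d η) (𝓕⁻ φ)) with hψ
  have hs := resolventSymbol_hasTemperateGrowth d hη
  have hn : (fun x : Eu d => Complex.ofReal (‖x‖ ^ 2)).HasTemperateGrowth := by fun_prop
  have hcomm : ∀ T : 𝓢'(Eu d, ℂ), helmholtzInv η (Δ T) = Δ (helmholtzInv η T) := by
    intro T
    rw [TemperedDistribution.laplacian_eq_fourierMultiplierCLM,
      TemperedDistribution.laplacian_eq_fourierMultiplierCLM, helmholtzInv, helmholtzInv,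
      ← Complex.coe_smul, map_smul, ← Complex.coe_smul,
      TemperedDistribution.fourierMultiplierCLM_fourierMultiplierCLM_apply hn hs,
      TemperedDistribution.fourierMultiplierCLM_fourierMultiplierCLM_apply hs hn,
      mul_comm (resolventSymbol d η)]
  ext x
  -- The right-inverse identity for the Dirac mass at `x`, tested on `φ`; after commuting the
  -- resolvent with `Δ` it is the claimed equation at the point `x`.
  have h1 := congrArg (fun T : 𝓢'(Eu d, ℂ) => T φ)
    (sub_laplacian_helmholtzInv hη (TemperedDistribution.delta x))
  rw [← hcomm] at h1
  have h2 : (η : ℂ) • (TemperedDistribution.delta x) ψ -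
      (Δ (TemperedDistribution.delta x : 𝓢'(Eu d, ℂ))) ψ =
      (TemperedDistribution.delta x) φ := h1
  rw [TemperedDistribution.laplacian_apply_apply] at h2
  simpa using h2

end Hessian

/-! ### Recovering a symmetric bilinear form from its values along `d - 1` vectors -/

section LinearAlgebra

variable {d : ℕ}

/-- A crude form of Hadamard's inequality: `d!` counts the terms of the Leibniz formula. -/
theorem abs_det_of_columns_le (u : Fin d → Eu d) :
    |(Matrix.of fun i j => u j i : Matrix (Fin d) (Fin d) ℝ).det| ≤
      (d.factorial : ℝ) * ∏ j, ‖u j‖ := by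
  rw [Matrix.det_apply]
  refine (Finset.abs_sum_le_sum_abs _ _).trans ?_
  have h : ∀ σ ∈ (Finset.univ : Finset (Equiv.Perm (Fin d))),
      |Equiv.Perm.sign σ • ∏ i, (Matrix.of fun i j => u j i : Matrix (Fin d) (Fin d) ℝ) (σ i) i| ≤
      ∏ j, ‖u j‖ := by
    intro σ _
    rw [Units.smul_def, zsmul_eq_mul, abs_mul]
    have h1 : |((Equiv.Perm.sign σ : ℤ) : ℝ)| = 1 := by
      rcases Int.units_eq_one_or (Equiv.Perm.sign σ) with h | h <;> simp [h]
    rw [h1, one_mul, Finset.abs_prod]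
    refine Finset.prod_le_prod (fun _ _ => abs_nonneg _) fun i _ => ?_
    exact PiLp.norm_apply_le (u i) (σ i)
  refine (Finset.sum_le_sum h).trans_eq ?_
  simp [Fintype.card_perm]

/-- The columns of `colMatrix v y`. -/
noncomputable def colVec (v : Fin (d - 1) → Eu d) (y : Eu d) (j : Fin d) : Eu d :=
  if h : (j : ℕ) < d - 1 then v ⟨j, h⟩ else y

theorem colMatrix_eq (v : Fin (d - 1) → Eu d) (y : Eu d) :
    colMatrix v y = Matrix.of fun i j => colVec v y j i := by
  ext i j
  simp only [colMatrix, colVec, Matrix.of_apply]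
  split_ifs <;> rfl

/-- Made for the determinants of Cramer's rule: column `l` is replaced by a vector of norm at most
one, column `n` is the wedge product, and the other `d - 2` columns are bounded by `V`. -/
theorem prod_le_of_forall_le {f : Fin d → ℝ} {A V : ℝ} {l n : Fin d} (hln : l ≠ n)
    (hf0 : ∀ j, 0 ≤ f j) (hl : f l ≤ 1) (hn : f n ≤ A) (hA : 0 ≤ A)
    (hf : ∀ j, j ≠ l → j ≠ n → f j ≤ V) :
    ∏ j, f j ≤ V ^ (d - 2) * A := by
  rw [← Finset.mul_prod_erase _ _ (Finset.mem_univ n),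
    ← Finset.mul_prod_erase _ _ (Finset.mem_erase.2 ⟨hln, Finset.mem_univ l⟩)]
  have h1 : ∏ j ∈ (Finset.univ.erase n).erase l, f j ≤ V ^ (d - 2) := by
    refine (Finset.prod_le_prod (fun j _ => hf0 j) (g := fun _ => V) fun j hj => ?_).trans_eq ?_
    · simp only [Finset.mem_erase] at hj
      exact hf j hj.1 hj.2.1
    · rw [Finset.prod_const, Finset.card_erase_of_mem (Finset.mem_erase.2 ⟨hln, Finset.mem_univ l⟩),
        Finset.card_erase_of_mem (Finset.mem_univ n), Finset.card_univ, Fintype.card_fin]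
      rfl
  have h0 : 0 ≤ ∏ j ∈ (Finset.univ.erase n).erase l, f j := Finset.prod_nonneg fun j _ => hf0 j
  calc f n * (f l * ∏ j ∈ (Finset.univ.erase n).erase l, f j)
      ≤ A * (1 * V ^ (d - 2)) := by
        gcongr
        exact mul_nonneg (hf0 l) h0
    _ = _ := by ring

variable {V : ℝ}

theorem norm_wedge_sq (hd : 2 ≤ d) (v : Fin (d - 1) → Eu d) :
    ‖wedge v‖ ^ 2 = (colMatrix v (wedge v)).det := by
  rw [← inner_wedge (by omega), real_inner_self_eq_norm_sq]

/-- `|W|²` is the determinant of the columns `v` and `W`, hence at most `d! V^{d-1} |W|`; divide by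
`|W|`. -/
theorem norm_wedge_le (hd : 2 ≤ d) (v : Fin (d - 1) → Eu d)
    (hV : ∀ l, ‖v l‖ ≤ V) : ‖wedge v‖ ≤ (d.factorial : ℝ) * V ^ (d - 1) := by
  rcases (norm_nonneg (wedge v)).eq_or_lt with h0 | h0
  · rw [← h0]
    have : 0 ≤ V := (norm_nonneg _).trans (hV ⟨0, by omega⟩)
    positivity
  have h1 := (le_abs_self _).trans (abs_det_of_columns_le (colVec v (wedge v)))
  rw [← colMatrix_eq, ← norm_wedge_sq hd] at h1
  have h2 : ∏ j, ‖colVec v (wedge v) j‖ ≤ V ^ (d - 1) * ‖wedge v‖ := by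
    set n : Fin d := ⟨d - 1, by omega⟩ with hn
    rw [← Finset.prod_erase_mul _ _ (Finset.mem_univ n)]
    have e1 : colVec v (wedge v) n = wedge v := by simp [colVec, hn]
    rw [e1]
    gcongr
    refine (Finset.prod_le_prod (fun j _ => norm_nonneg _) (g := fun _ => V) fun j hj => ?_).trans_eq ?_
    · have hjn : (j : ℕ) < d - 1 := by
        have h3 := (Finset.mem_erase.1 hj).1
        have h4 : (j : ℕ) ≠ d - 1 := fun h => h3 (Fin.ext h)
        omega
      simp only [colVec, hjn, dif_pos]
      exact hV _
    · simp
  have h3 : ‖wedge v‖ * ‖wedge v‖ ≤ (d.factorial : ℝ) * V ^ (d - 1) * ‖wedge v‖ := by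
    calc _ = ‖wedge v‖ ^ 2 := by ring
      _ ≤ _ := h1
      _ ≤ (d.factorial : ℝ) * (V ^ (d - 1) * ‖wedge v‖) := by gcongr
      _ = _ := by ring
  exact le_of_mul_le_mul_right h3 h0

/-- Decomposition of a vector along `v_1, …, v_{d-1}` and their wedge product. -/
theorem exists_wedge_decomposition (hd : 2 ≤ d) (v : Fin (d - 1) → Eu d)
    (hV : ∀ l, ‖v l‖ ≤ V) (hW : wedge v ≠ 0) (e : Eu d)
    (he : ‖e‖ ≤ 1) :
    ∃ γ : Fin (d - 1) → ℝ, (∀ l, |γ l| ≤ (d.factorial : ℝ) * V ^ (d - 2) / ‖wedge v‖) ∧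
      e = ∑ l, γ l • v l + (inner ℝ (wedge v) e / ‖wedge v‖ ^ 2) • wedge v := by
  set W := wedge v with hWd
  have hW0 : 0 < ‖W‖ := norm_pos_iff.2 hW
  set M := colMatrix v W with hM
  have hdet : M.det = ‖W‖ ^ 2 := (norm_wedge_sq hd v).symm
  -- Cramer's rule for the basis `v_1, …, v_{d-1}, W`, whose determinant is `|W|²`. The last
  -- coefficient is `det (v, e) = W · e`.
  have key := Matrix.mulVec_cramer M (fun i => e i)
  set c := Matrix.cramer M (fun i => e i) with hc
  have hd1 : d - 1 + 1 = d := by omega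
  have hupd : ∀ l, c l = (Matrix.of fun i j =>
      (Function.update (colVec v W) l e) j i : Matrix (Fin d) (Fin d) ℝ).det := by
    intro l
    rw [hc, Matrix.cramer_apply, hM, colMatrix_eq]
    congr 1
    ext i j
    rw [Matrix.updateCol_apply]
    by_cases h : j = l
    · subst h; simp
    · simp [h]
  have hlast : c ⟨d - 1, by omega⟩ = inner ℝ W e := by
    rw [hupd, inner_wedge (by omega), colMatrix_eq]
    congr 1
    ext i j
    simp only [Matrix.of_apply, Function.update_apply, colVec]
    by_cases h : (j : ℕ) < d - 1
    · have : j ≠ ⟨d - 1, by omega⟩ := fun h' => by rw [h'] at h; simp at h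
      simp [h, this]
    · have : j = ⟨d - 1, by omega⟩ := Fin.ext (by simp only; omega)
      simp [this]
  refine ⟨fun l => c ⟨l, by omega⟩ / ‖W‖ ^ 2, fun l => ?_, ?_⟩
  · have h1 := abs_det_of_columns_le (Function.update (colVec v W) ⟨l, by omega⟩ e)
    rw [← hupd] at h1
    have h2 := prod_le_of_forall_le (V := V) (A := ‖W‖)
      (f := fun j => ‖Function.update (colVec v W) ⟨l, by omega⟩ e j‖)
      (l := ⟨l, by omega⟩) (n := ⟨d - 1, by omega⟩) ?_ (fun j => norm_nonneg _)
      (by simpa using he) ?_ hW0.le ?_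
    · rw [abs_div, abs_of_pos (by positivity : 0 < ‖W‖ ^ 2), div_le_div_iff₀ (by positivity) hW0]
      calc _ ≤ ((d.factorial : ℝ) * (V ^ (d - 2) * ‖W‖)) * ‖W‖ := by
            gcongr
            exact h1.trans (by gcongr)
        _ = _ := by ring
    · intro h
      have := congrArg Fin.val h
      simp only at this
      have := l.2
      omega
    · rw [Function.update_of_ne]
      · simp [colVec]
      · intro h
        have := congrArg Fin.val h
        simp only at this
        have := l.2
        omega
    · intro j hj hjn
      have h3 : (j : ℕ) < d - 1 := by
        have h4 : (j : ℕ) ≠ d - 1 := fun h => hjn (Fin.ext h)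
        omega
      simp only [Function.update_of_ne hj, colVec, h3, dif_pos]
      exact hV _
  · have h1 : ‖W‖ ^ 2 • e = ∑ j, c j • colVec v W j := by
      ext i
      have := congrFun key i
      rw [hdet] at this
      simp only [Pi.smul_apply, Matrix.mulVec, dotProduct, hM, colMatrix_eq, Matrix.of_apply,
        smul_eq_mul] at this
      simp only [PiLp.smul_apply, smul_eq_mul, WithLp.ofLp_sum, Finset.sum_apply, WithLp.ofLp_smul,
        Pi.smul_apply]
      rw [← this]
      exact Finset.sum_congr rfl fun j _ => mul_comm _ _
    have h2 : ∑ j, c j • colVec v W j =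
        ∑ l : Fin (d - 1), c ⟨l, by omega⟩ • v l + inner ℝ W e • W := by
      rw [← hlast, ← (finCongr hd1).sum_comp, Fin.sum_univ_castSucc]
      congr 1
      · refine Finset.sum_congr rfl fun l _ => ?_
        simp [colVec]
        rfl
      · simp [colVec]
        rfl
    rw [h2] at h1
    have h3 : e = (‖W‖ ^ 2)⁻¹ • (‖W‖ ^ 2 • e) := by
      rw [smul_smul, inv_mul_cancel₀ (by positivity), one_smul]
    refine h3.trans ?_
    rw [h1, smul_add, Finset.smul_sum]
    simp only [smul_smul, div_eq_inv_mul]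

/-- A symmetric bilinear form is determined by its trace and its values on pairs of vectors one of
which belongs to a family of `d - 1` independent vectors. -/
theorem exists_coeff_of_wedge_ne_zero (hd : 2 ≤ d) (v : Fin (d - 1) → Eu d)
    (hV : ∀ l, ‖v l‖ ≤ V) (hW : wedge v ≠ 0) :
    ∃ (A : Fin d → Fin d → ℝ) (c : Fin d → Fin d → Fin d → Fin (d - 1) → ℝ),
      (∀ i j, |A i j| ≤ 1) ∧
      (∀ i j k l, |c i j k l| ≤
        3 * (d.factorial : ℝ) ^ 4 * (V ^ (4 * d - 5) / ‖wedge v‖ ^ 4)) ∧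
      ∀ S : Eu d →ₗ[ℝ] Eu d →ₗ[ℝ] ℂ, (∀ a b, S a b = S b a) → ∀ i j,
        S (EuclideanSpace.single i 1) (EuclideanSpace.single j 1) =
          A i j • ∑ k, S (EuclideanSpace.single k 1) (EuclideanSpace.single k 1) +
          ∑ k, ∑ l, c i j k l • S (EuclideanSpace.single k 1) (v l) := by
  set W := wedge v with hWd
  have hW0 : 0 < ‖W‖ := norm_pos_iff.2 hW
  have hV0 : 0 ≤ V := (norm_nonneg _).trans (hV ⟨0, by omega⟩)
  choose γ hγ hdec using fun i : Fin d =>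
    exists_wedge_decomposition hd v hV hW (EuclideanSpace.single i 1) (by simp)
  have hWi : ∀ i, |W i| ≤ ‖W‖ := fun i => PiLp.norm_apply_le W i
  have hinner : ∀ i, inner ℝ W (EuclideanSpace.single i 1) = W i := fun i => by
    simp [EuclideanSpace.inner_single_right]
  set B := (d.factorial : ℝ) * V ^ (d - 2) / ‖W‖ with hB
  have hB0 : 0 ≤ B := by positivity
  -- The natural size of the coefficients is `V^{d-2}/|W|`. Multiplying and dividing by `|W|³`, with
  -- `|W| ≤ d! V^{d-1}` in the numerator, gives the exponent `(d - 2) + 3(d - 1) = 4d - 5` of the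
  -- theorem.
  have hBle : B ≤ (d.factorial : ℝ) ^ 4 * (V ^ (4 * d - 5) / ‖W‖ ^ 4) := by
    have h1 := norm_wedge_le hd v hV
    rw [← hWd] at h1
    have e1 : 4 * d - 5 = (d - 2) + 3 * (d - 1) := by omega
    calc B = (d.factorial : ℝ) * V ^ (d - 2) * ‖W‖ ^ 3 / ‖W‖ ^ 4 := by
          rw [hB]; field_simp
      _ ≤ (d.factorial : ℝ) * V ^ (d - 2) * ((d.factorial : ℝ) * V ^ (d - 1)) ^ 3 / ‖W‖ ^ 4 := by
          gcongr
      _ = _ := by rw [e1, pow_add, pow_mul']; ring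
  have hq : ∀ i j, |W i * W j / ‖W‖ ^ 2| ≤ 1 := by
    intro i j
    rw [abs_div, abs_mul, abs_of_pos (by positivity : 0 < ‖W‖ ^ 2), div_le_one (by positivity), sq]
    exact mul_le_mul (hWi i) (hWi j) (abs_nonneg _) hW0.le
  -- Expand `e_j` in `S(e_i, e_j)`, then `e_i` in `S(e_i, W)`, and replace `S(W, W)` by the trace
  -- minus known entries. Each of the three operations contributes one term of size at most `B` to
  -- `c`, hence the factor `3`.
  refine ⟨fun i j => W i * W j / ‖W‖ ^ 2, fun i j k l => (if k = i then γ j l else 0) +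
    W j * W k / ‖W‖ ^ 2 * γ i l - W i * W j / ‖W‖ ^ 2 * γ k l, hq, fun i j k l => ?_, ?_⟩
  · have h1 : |if k = i then γ j l else 0| ≤ B := by
      split_ifs
      · exact hγ j l
      · simpa using hB0
    have h2 : ∀ a b k, |W a * W b / ‖W‖ ^ 2 * γ k l| ≤ B := fun a b k => by
      rw [abs_mul]
      calc _ ≤ 1 * B := mul_le_mul (hq a b) (hγ k l) (abs_nonneg _) zero_le_one
        _ = B := one_mul B
    calc _ ≤ B + B + B :=
          (abs_sub _ _).trans (add_le_add ((abs_add_le _ _).trans (add_le_add h1 (h2 _ _ _)))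
            (h2 _ _ _))
      _ = 3 * B := by ring
      _ ≤ _ := by rw [mul_assoc]; gcongr
  · intro S hS i j
    set e : Fin d → Eu d := fun i => EuclideanSpace.single i 1 with he
    have hWe : W = ∑ k, W k • e k := by
      have := (EuclideanSpace.basisFun (Fin d) ℝ).sum_repr W
      simpa [he] using this.symm
    have hSe : ∀ x : Eu d, ∀ j, S x (e j) = ∑ l, γ j l • S x (v l) + (W j / ‖W‖ ^ 2) • S x W := by
      intro x j
      have h1 : e j = _ := hdec j
      rw [hinner] at h1
      conv_lhs => rw [h1]
      simp only [map_add, map_sum, map_smul, hWd]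
    have hSW : ∀ y : Eu d, S W y = ∑ k, W k • S (e k) y := by
      intro y
      conv_lhs => rw [hWe]
      simp only [map_sum, map_smul, LinearMap.sum_apply, LinearMap.smul_apply]
    have htr : ∑ k, S (e k) (e k) = ∑ k, ∑ l, γ k l • S (e k) (v l) +
        (‖W‖ ^ 2)⁻¹ • S W W := by
      simp only [hSe]
      rw [Finset.sum_add_distrib, hSW W, Finset.smul_sum]
      congr 1
      refine Finset.sum_congr rfl fun k _ => ?_
      rw [smul_smul, div_eq_inv_mul]
    have hiW : S (e i) W = ∑ l, γ i l • ∑ k, W k • S (e k) (v l) + (W i / ‖W‖ ^ 2) • S W W := by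
      rw [hS, hSe]
      simp only [hSW (v _)]
    change S (e i) (e j) = _
    rw [hSe, hiW]
    have hWW : S W W = ‖W‖ ^ 2 • (∑ k, S (e k) (e k) - ∑ k, ∑ l, γ k l • S (e k) (v l)) := by
      rw [htr, add_sub_cancel_left, smul_smul, mul_inv_cancel₀ (by positivity), one_smul]
    rw [hWW]
    have e1 : ∑ k, ∑ l, ((if k = i then γ j l else 0) + W j * W k / ‖W‖ ^ 2 * γ i l -
        W i * W j / ‖W‖ ^ 2 * γ k l) • S (e k) (v l) =
        ∑ l, γ j l • S (e i) (v l) + (W j / ‖W‖ ^ 2) • ∑ l, γ i l • ∑ k, W k • S (e k) (v l) -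
          (W i * W j / ‖W‖ ^ 2) • ∑ k, ∑ l, γ k l • S (e k) (v l) := by
      simp only [sub_smul, add_smul, Finset.sum_sub_distrib, Finset.sum_add_distrib]
      congr 1
      · congr 1
        · rw [Finset.sum_eq_single i]
          · simp
          · intro k _ hk; simp [hk]
          · simp
        · rw [Finset.sum_comm, Finset.smul_sum]
          refine Finset.sum_congr rfl fun l _ => ?_
          rw [Finset.smul_sum, Finset.smul_sum]
          refine Finset.sum_congr rfl fun k _ => ?_
          rw [smul_smul, smul_smul]
          congr 1
          ring
      · rw [Finset.smul_sum]
        refine Finset.sum_congr rfl fun k _ => ?_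
        rw [Finset.smul_sum]
        refine Finset.sum_congr rfl fun l _ => ?_
        rw [smul_smul]
    rw [e1]
    have e2 : W i / ‖W‖ ^ 2 * ‖W‖ ^ 2 = W i := by field_simp
    rw [smul_smul, e2]
    simp only [smul_add, smul_sub, smul_smul]
    have e3 : W j / ‖W‖ ^ 2 * W i = W i * W j / ‖W‖ ^ 2 := by ring
    rw [e3]
    abel

end LinearAlgebra

section Assembly

variable {d : ℕ}

/-! ### Time integrals over exhausting intervals -/

theorem norm_intervalIntegral_le_of_norm_le_Ioi {F : ℝ → ℂ} {b : ℝ → ℝ}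
    (hb : IntegrableOn b (Set.Ioi 0)) (hFb : ∀ t, 0 < t → ‖F t‖ ≤ b t) {ε R : ℝ} (hε : 0 < ε)
    (hR : ε ≤ R) : ‖∫ t in ε..R, F t‖ ≤ ∫ t in Set.Ioi 0, b t := by
  have hsub : Set.Ioc ε R ⊆ Set.Ioi 0 := fun t ht => hε.trans ht.1
  refine (intervalIntegral.norm_integral_le_of_norm_le hR (g := b)
    (Eventually.of_forall fun t ht => hFb t (hε.trans ht.1)) ?_).trans ?_
  · rw [intervalIntegrable_iff_integrableOn_Ioc_of_le hR]
    exact hb.mono_set hsub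
  · rw [intervalIntegral.integral_of_le hR]
    refine setIntegral_mono_set hb ?_ (Eventually.of_forall hsub)
    exact ae_restrict_of_forall_mem measurableSet_Ioi fun t ht =>
      (norm_nonneg _).trans (hFb t ht)

theorem tendsto_intervalIntegral_Ioi {F : ℝ → ℂ} (hF : IntegrableOn F (Set.Ioi 0)) :
    Tendsto (fun n : ℕ => ∫ t in (1 / ((n : ℝ) + 1))..((n : ℝ) + 1), F t) atTop
      (𝓝 (∫ t in Set.Ioi 0, F t)) := by
  have h1 : ∀ n : ℕ, ∫ t in (1 / ((n : ℝ) + 1))..((n : ℝ) + 1), F t =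
      ∫ t in Set.Ioi 0, (Set.Ioc (1 / ((n : ℝ) + 1)) ((n : ℝ) + 1)).indicator F t := by
    intro n
    have hn : (1 : ℝ) ≤ (n : ℝ) + 1 := by linarith [(Nat.cast_nonneg n : (0 : ℝ) ≤ n)]
    have h0 : 1 / ((n : ℝ) + 1) ≤ (n : ℝ) + 1 :=
      (div_le_one_of_le₀ hn (by linarith)).trans hn
    rw [intervalIntegral.integral_of_le h0, setIntegral_indicator measurableSet_Ioc,
      Set.inter_eq_right.2]
    intro t ht
    have : 0 < 1 / ((n : ℝ) + 1) := by positivity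
    exact this.trans ht.1
  simp only [h1]
  apply tendsto_integral_of_dominated_convergence (fun t => ‖F t‖)
  · exact fun n => hF.aestronglyMeasurable.indicator measurableSet_Ioc
  · exact hF.norm
  · exact fun n => Eventually.of_forall fun t => norm_indicator_le_norm_self _ _
  · refine ae_restrict_of_forall_mem measurableSet_Ioi fun t ht => ?_
    refine tendsto_const_nhds.congr' ?_
    have e1 : ∀ᶠ n : ℕ in atTop, 1 / ((n : ℝ) + 1) < t :=
      (tendsto_one_div_add_atTop_nhds_zero_nat (𝕜 := ℝ)).eventually_lt_const ht
    have e2 : ∀ᶠ n : ℕ in atTop, t ≤ n := tendsto_natCast_atTop_atTop.eventually_ge_atTop t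
    filter_upwards [e1, e2] with n h1 h2
    rw [Set.indicator_of_mem]
    exact ⟨h1, by linarith⟩

theorem integrableOn_exp_neg_mul {η : ℝ} (hη : 0 < η) :
    IntegrableOn (fun t => Real.exp (-(η * t))) (Set.Ioi 0) := by
  simpa [neg_mul] using integrableOn_exp_mul_Ioi (neg_lt_zero.2 hη) 0

theorem integral_exp_neg_mul {η : ℝ} (hη : 0 < η) :
    ∫ t in Set.Ioi 0, Real.exp (-(η * t)) = η⁻¹ := by
  have := integral_exp_mul_Ioi (neg_lt_zero.2 hη) 0
  simpa [neg_mul] using this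

/-- The time integral of `e^{-ηt} t^{-β}`. -/
noncomputable def timeConst (η β : ℝ) : ℝ :=
  ∫ t in Set.Ioi (0 : ℝ), Real.exp (-(η * t)) * t ^ (-β)

theorem integrableOn_exp_neg_mul_rpow {η β : ℝ} (hη : 0 < η) (hβ : β < 1) :
    IntegrableOn (fun t => Real.exp (-(η * t)) * t ^ (-β)) (Set.Ioi 0) := by
  have := integrableOn_rpow_mul_exp_neg_mul_rpow (s := -β) (p := 1) (by linarith) zero_lt_one hη
  refine this.congr (Eventually.of_forall fun t => ?_)
  simp only [Real.rpow_one]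
  rw [mul_comm, neg_mul]

variable {g : Eu d → ℂ} {G : ℝ}

theorem aestronglyMeasurable_time_kernel {K : ℝ → Eu d → ℝ}
    (hK : Measurable fun q : ℝ × Eu d => K q.1 q.2) (hg : AEStronglyMeasurable g) (η : ℝ)
    (x : Eu d) :
    AEStronglyMeasurable (fun t => Real.exp (-(η * t)) • ∫ y, K t (x - y) • g y)
      (volume.restrict (Set.Ioi 0)) := by
  have h1 := (aestronglyMeasurable_kernel_smul hK (X := fun _ => x) measurable_const hg
    (volume.restrict (Set.Ioi 0))).integral_prod_right'
  have h2 : Continuous fun t : ℝ => Real.exp (-(η * t)) := by fun_prop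
  exact h2.aestronglyMeasurable.smul h1

/-! ### Algebraic properties of the regularised Hessian -/

theorem hheat_comm (t : ℝ) (a b z : Eu d) : hheat t a b z = hheat t b a z := by
  simp only [hheat, real_inner_comm a b]
  ring

theorem heatHessian_comm (η ε R : ℝ) (g : Eu d → ℂ) (a b x : Eu d) :
    heatHessian η ε R g a b x = heatHessian η ε R g b a x := by
  simp only [heatHessian, hheat_comm _ a b]

theorem heatHessian_smul (η ε R : ℝ) (g : Eu d → ℂ) (c : ℝ) (a b x : Eu d) :
    heatHessian η ε R g (c • a) b x = c • heatHessian η ε R g a b x := by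
  have h : ∀ t z, hheat t (c • a) b z = c * hheat t a b z := fun t z => by
    simp only [hheat, inner_smul_left, inner_smul_right]
    simp
    ring
  simp only [heatHessian, h, mul_smul]
  rw [← intervalIntegral.integral_smul]
  congr 1
  ext t
  rw [integral_smul, smul_comm]

theorem continuousOn_exp_mul_hheat (η : ℝ) {ε R : ℝ} (hε : 0 < ε) (hR : ε ≤ R) (a b z : Eu d) :
    ContinuousOn (fun t => Real.exp (-(η * t)) * hheat t a b z) (Set.uIcc ε R) := by
  intro s hs
  rw [Set.uIcc_of_le hR] at hs
  have hs0 := hε.trans_le hs.1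
  have h1 : ContinuousAt (fun s => heat s z) s := (hasDerivAt_heat hs0 z).continuousAt
  apply ContinuousAt.continuousWithinAt
  simp only [hheat]
  have h2 : 4 * s ^ 2 ≠ 0 := by positivity
  have h3 : 2 * s ≠ 0 := by positivity
  fun_prop (disch := assumption)

theorem integrable_hessKernel_smul {η ε R : ℝ} (hη : 0 ≤ η) (hε : 0 < ε) (hR : ε ≤ R)
    (hg : AEStronglyMeasurable g) (hG : ∀ᵐ y, ‖g y‖ ≤ G) (a b x : Eu d) :
    Integrable fun y => hessKernel η ε R a b (x - y) • g y := by
  have h1 : Integrable fun y => hessKernel η ε R a b (x - y) :=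
    (integrable_hessKernel hη hε hR a b).comp_sub_left x
  refine (h1.norm.mul_const G).mono' (h1.aestronglyMeasurable.smul hg) ?_
  filter_upwards [hG] with y hy
  rw [norm_smul]
  gcongr

theorem heatHessian_add {η ε R : ℝ} (hη : 0 ≤ η) (hε : 0 < ε) (hR : ε ≤ R)
    (hg : AEStronglyMeasurable g) (hG : ∀ᵐ y, ‖g y‖ ≤ G) (a c b x : Eu d) :
    heatHessian η ε R g (a + c) b x =
      heatHessian η ε R g a b x + heatHessian η ε R g c b x := by
  have h : ∀ t z, hheat t (a + c) b z = hheat t a b z + hheat t c b z := fun t z => by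
    simp only [hheat, inner_add_left, inner_add_right]
    ring
  have hk : ∀ z, hessKernel η ε R (a + c) b z =
      hessKernel η ε R a b z + hessKernel η ε R c b z := fun z => by
    simp only [hessKernel, h, mul_add]
    exact intervalIntegral.integral_add
      (continuousOn_exp_mul_hheat η hε hR a b z).intervalIntegrable
      (continuousOn_exp_mul_hheat η hε hR c b z).intervalIntegrable
  simp only [heatHessian_eq_integral_hessKernel hη hε hR hg hG, hk, add_smul]
  exact integral_add (integrable_hessKernel_smul hη hε hR hg hG a b x)
    (integrable_hessKernel_smul hη hε hR hg hG c b x)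

/-- The regularised Hessian at a point, as a bilinear form. -/
noncomputable def heatHessianForm {η ε R : ℝ} (hη : 0 ≤ η) (hε : 0 < ε) (hR : ε ≤ R)
    (hg : AEStronglyMeasurable g) (hG : ∀ᵐ y, ‖g y‖ ≤ G) (x : Eu d) :
    Eu d →ₗ[ℝ] Eu d →ₗ[ℝ] ℂ :=
  LinearMap.mk₂ ℝ (fun a b => heatHessian η ε R g a b x)
    (fun a a' b => heatHessian_add hη hε hR hg hG a a' b x)
    (fun c a b => heatHessian_smul η ε R g c a b x)
    (fun a b b' => by
      simp only [heatHessian_comm _ _ _ _ a]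
      exact heatHessian_add hη hε hR hg hG b b' a x)
    (fun c a b => by
      simp only [heatHessian_comm _ _ _ _ a]
      exact heatHessian_smul η ε R g c b a x)

theorem norm_integral_heat_smul_le (hG : ∀ᵐ y, ‖g y‖ ≤ G) {t : ℝ}
    (ht : 0 < t) (x : Eu d) : ‖∫ y, heat t (x - y) • g y‖ ≤ G := by
  have := norm_integral_smul_le_of_bounded (c := 1) ht hG x (k := heat t) fun z => by
    rw [one_mul, abs_of_pos (heat_pos ht z)]
  rwa [one_mul] at this

theorem integrableOn_exp_mul_heat_smul {η : ℝ} (hη : 0 < η) (hg : AEStronglyMeasurable g)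
    (hG : ∀ᵐ y, ‖g y‖ ≤ G) (x : Eu d) :
    IntegrableOn (fun t => Real.exp (-(η * t)) • ∫ y, heat t (x - y) • g y) (Set.Ioi 0) := by
  refine ((integrableOn_exp_neg_mul hη).mul_const G).mono'
    (aestronglyMeasurable_time_kernel measurable_heat hg η x)
    (ae_restrict_of_forall_mem measurableSet_Ioi fun t ht => ?_)
  rw [norm_smul, Real.norm_of_nonneg (Real.exp_pos _).le]
  gcongr
  exact norm_integral_heat_smul_le hG ht x

/-- The trace of the regularised Hessian. -/
theorem sum_heatHessian {η ε R : ℝ} (hη : 0 < η) (hε : 0 < ε) (hR : ε ≤ R)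
    (hg : AEStronglyMeasurable g) (hG : ∀ᵐ y, ‖g y‖ ≤ G) (x : Eu d) :
    ∑ k, heatHessian η ε R g (EuclideanSpace.single k 1) (EuclideanSpace.single k 1) x =
      Real.exp (-(η * R)) • (∫ y, heat R (x - y) • g y) -
        Real.exp (-(η * ε)) • (∫ y, heat ε (x - y) • g y) +
          η • ∫ t in ε..R, Real.exp (-(η * t)) • ∫ y, heat t (x - y) • g y := by
  have hR0 := hε.trans_le hR
  have hsub : Set.Ioc ε R ⊆ Set.Ioi 0 := fun t ht => hε.trans ht.1
  have hint : ∀ a b : Eu d, IntervalIntegrable (fun t => Real.exp (-(η * t)) •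
      ∫ y, hheat t a b (x - y) • g y) volume ε R := fun a b => by
    rw [intervalIntegrable_iff_integrableOn_Ioc_of_le hR]
    refine (integrable_const (heatConst d * ‖a‖ * ‖b‖ * ε⁻¹ * G)).mono'
      ((aestronglyMeasurable_time_kernel (measurable_hheat a b) hg η x).mono_measure
        (Measure.restrict_mono hsub le_rfl)) ?_
    refine ae_restrict_of_forall_mem measurableSet_Ioc fun t ht => ?_
    rw [← integral_smul]
    simp only [smul_smul]
    exact norm_integral_smul_le_of_bounded (by have := hε.trans ht.1; positivity : 0 < 2 * t) hG x
      (k := fun z => Real.exp (-(η * t)) * hheat t a b z) (abs_exp_mul_hheat_le hη.le hε a b ht)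
  have h2 : IntervalIntegrable (fun t => η • (Real.exp (-(η * t)) •
      ∫ y, heat t (x - y) • g y)) volume ε R := by
    rw [intervalIntegrable_iff_integrableOn_Ioc_of_le hR]
    exact ((integrableOn_exp_mul_heat_smul hη hg hG x).mono_set hsub).smul η
  have h3 : ∫ t in ε..R, Real.exp (-(η * t)) •
      ((∫ y, lapHeat t (x - y) • g y) - η • ∫ y, heat t (x - y) • g y) =
      ∫ t in ε..R, (∑ k, Real.exp (-(η * t)) • (∫ y, hheat t (EuclideanSpace.single k 1)
        (EuclideanSpace.single k 1) (x - y) • g y)) -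
        η • (Real.exp (-(η * t)) • ∫ y, heat t (x - y) • g y) := by
    refine intervalIntegral.integral_congr fun t ht => ?_
    rw [Set.uIcc_of_le hR] at ht
    have ht0 := hε.trans_le ht.1
    have h4 : ∫ y, lapHeat t (x - y) • g y = ∑ k, ∫ y, hheat t (EuclideanSpace.single k 1)
        (EuclideanSpace.single k 1) (x - y) • g y := by
      rw [← integral_finsetSum _ fun i _ => integrable_smul_of_abs_le_of_bounded
        (by positivity : 0 < 2 * t) hg hG x (continuous_hheat t _ _) (abs_hheat_le ht0 _ _)]
      simp only [lapHeat, Finset.sum_smul]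
    simp only [h4]
    rw [smul_sub, Finset.smul_sum, smul_comm η]
  have h5 : IntervalIntegrable (fun t => ∑ k, Real.exp (-(η * t)) • (∫ y, hheat t
      (EuclideanSpace.single k 1) (EuclideanSpace.single k 1) (x - y) • g y)) volume ε R := by
    have := IntervalIntegrable.sum Finset.univ
      fun (k : Fin d) _ => hint (EuclideanSpace.single k 1) (EuclideanSpace.single k 1)
    simpa [Finset.sum_fn] using this
  -- Subtracting `η e^{tΔ} g` completes `Δ e^{tΔ} g` to an exact derivative after multiplication by
  -- `e^{-ηt}`.
  rw [← intervalIntegral_lapHeat_smul hη.le hε hR hg hG x, h3,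
    intervalIntegral.integral_sub h5 h2, intervalIntegral.integral_smul, sub_add_cancel]
  simp only [heatHessian]
  rw [intervalIntegral.integral_finsetSum fun k _ => hint _ _]

/-- Each boundary term is at most `G`, and so is the remaining term because `η ∫₀^∞ e^{-ηt} dt = 1`.
-/
theorem norm_sum_heatHessian_le {η ε R : ℝ} (hη : 0 < η) (hε : 0 < ε) (hR : ε ≤ R)
    (hg : AEStronglyMeasurable g) (hG : ∀ᵐ y, ‖g y‖ ≤ G) (x : Eu d) :
    ‖∑ k, heatHessian η ε R g (EuclideanSpace.single k 1) (EuclideanSpace.single k 1) x‖ ≤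
      3 * G := by
  have hR0 := hε.trans_le hR
  have h1 : ∀ t, 0 < t → ‖Real.exp (-(η * t)) • ∫ y, heat t (x - y) • g y‖ ≤
      Real.exp (-(η * t)) * G := fun t ht => by
    rw [norm_smul, Real.norm_of_nonneg (Real.exp_pos _).le]
    gcongr
    exact norm_integral_heat_smul_le hG ht x
  have hG0 : 0 ≤ G := (norm_nonneg _).trans (norm_integral_heat_smul_le hG one_pos x)
  have h2 : ∀ t, 0 < t → ‖Real.exp (-(η * t)) • ∫ y, heat t (x - y) • g y‖ ≤ G := fun t ht => by
    refine (h1 t ht).trans (mul_le_of_le_one_left hG0 (Real.exp_le_one_iff.2 ?_))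
    have := mul_pos hη ht
    linarith
  have h3 := norm_intervalIntegral_le_of_norm_le_Ioi ((integrableOn_exp_neg_mul hη).mul_const G)
    h1 hε hR
  rw [integral_mul_const, integral_exp_neg_mul hη] at h3
  rw [sum_heatHessian hη hε hR hg hG]
  refine (norm_add_le _ _).trans ?_
  rw [norm_smul, Real.norm_of_nonneg hη.le]
  have h4 : η * ‖∫ t in ε..R, Real.exp (-(η * t)) • ∫ y, heat t (x - y) • g y‖ ≤ G := by
    calc _ ≤ η * (η⁻¹ * G) := by gcongr
      _ = G := by field_simp
  linarith [norm_sub_le (Real.exp (-(η * R)) • ∫ y, heat R (x - y) • g y)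
    (Real.exp (-(η * ε)) • ∫ y, heat ε (x - y) • g y), h2 R hR0, h2 ε hε]

theorem one_div_add_one_le (n : ℕ) : 1 / ((n : ℝ) + 1) ≤ (n : ℝ) + 1 := by
  have hn : (1 : ℝ) ≤ (n : ℝ) + 1 := by linarith [(Nat.cast_nonneg n : (0 : ℝ) ≤ n)]
  exact (div_le_one_of_le₀ hn (by linarith)).trans hn

theorem tendsto_one_div_add_one_nhdsGT :
    Tendsto (fun n : ℕ => 1 / ((n : ℝ) + 1)) atTop (𝓝[>] 0) :=
  tendsto_nhdsWithin_iff.2 ⟨tendsto_one_div_add_atTop_nhds_zero_nat,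
    Eventually.of_forall fun n => by simp only [Set.mem_Ioi]; positivity⟩

theorem tendsto_exp_neg_mul_add_one {η : ℝ} (hη : 0 < η) :
    Tendsto (fun n : ℕ => Real.exp (-(η * ((n : ℝ) + 1)))) atTop (𝓝 0) := by
  refine Real.tendsto_exp_neg_atTop_nhds_zero.comp (Tendsto.const_mul_atTop hη ?_)
  exact tendsto_natCast_atTop_atTop.atTop_add tendsto_const_nhds

theorem tendsto_exp_neg_mul_one_div (η : ℝ) :
    Tendsto (fun n : ℕ => Real.exp (-(η * (1 / ((n : ℝ) + 1))))) atTop (𝓝 1) := by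
  have hc : Continuous fun t : ℝ => Real.exp (-(η * t)) := by fun_prop
  have := (hc.tendsto 0).comp (tendsto_one_div_add_atTop_nhds_zero_nat (𝕜 := ℝ))
  simpa [Function.comp_def] using this

/-- Only the boundary term at `ε → 0` needs the hypothesis on `x`; the one at infinity is killed by
the exponential. -/
theorem exists_tendsto_sum_heatHessian {η : ℝ} (hη : 0 < η) (hg : AEStronglyMeasurable g)
    (hG : ∀ᵐ y, ‖g y‖ ≤ G) {x : Eu d}
    (hx : Tendsto (fun t => ∫ y, heat t (x - y) • g y) (𝓝[>] 0) (𝓝 (g x))) :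
    ∃ L, Tendsto (fun n : ℕ => ∑ k, heatHessian η (1 / ((n : ℝ) + 1)) ((n : ℝ) + 1) g
      (EuclideanSpace.single k 1) (EuclideanSpace.single k 1) x) atTop (𝓝 L) := by
  simp only [fun n : ℕ => sum_heatHessian hη (by positivity : 0 < 1 / ((n : ℝ) + 1))
    (one_div_add_one_le n) hg hG x]
  have h1 : Tendsto (fun n : ℕ => Real.exp (-(η * ((n : ℝ) + 1))) •
      ∫ y, heat ((n : ℝ) + 1) (x - y) • g y) atTop (𝓝 0) := by
    refine squeeze_zero_norm (a := fun n : ℕ => Real.exp (-(η * ((n : ℝ) + 1))) * G) (fun n => ?_)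
      (by simpa using (tendsto_exp_neg_mul_add_one hη).mul_const G)
    rw [norm_smul, Real.norm_of_nonneg (Real.exp_pos _).le]
    gcongr
    exact norm_integral_heat_smul_le hG (by positivity) x
  exact ⟨_, (h1.sub ((tendsto_exp_neg_mul_one_div η).smul
    (hx.comp tendsto_one_div_add_one_nhdsGT))).add
    ((tendsto_intervalIntegral_Ioi (integrableOn_exp_mul_heat_smul hη hg hG x)).const_smul η)⟩

/-! ### The derivative of the regularised Hessian along a vector field -/

section Field

variable {p : ℝ≥0∞} {Y : Eu d → Eu d} {D : Eu d → (Eu d →L[ℝ] Eu d)} {K : ℝ} {w : Eu d → ℂ}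

/-- The bound of the regularised Hessian along a vector field. -/
noncomputable def fieldBound (d : ℕ) (p : ℝ≥0∞) (N G A : ℝ) : ℝ :=
  heatConst d * (morreyConst d p * N * G + A)

theorem norm_exp_smul_hheat_field_le {η : ℝ} (hY : Continuous Y) (hK : ∀ x, ‖Y x‖ ≤ K)
    (hp1 : 1 ≤ p) (hpt : p < ⊤) (hdp : (d : ℝ) < p.toReal)
    (hYD : HasWeakGradient Y D) (hD : MemLp D p) (hg : AEStronglyMeasurable g)
    (hG : ∀ᵐ y, ‖g y‖ ≤ G) (hw : HasWeakDiv g Y w) (hwp : MemLp w p) {a : Eu d}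
    (ha : ‖a‖ = 1) (x : Eu d) {t : ℝ} (ht : 0 < t) :
    ‖Real.exp (-(η * t)) • ∫ y, hheat t a (Y x) (x - y) • g y‖ ≤
      fieldBound d p (eLpNorm D p volume).toReal G (eLpNorm w p volume).toReal *
        (Real.exp (-(η * t)) * t ^ (-(1 / 2 + d / (2 * p.toReal)))) := by
  have h := norm_integral_hheat_field_le ht hY hK hp1 hpt hdp hYD hD hg hG hw hwp a x
  rw [ha, mul_one] at h
  rw [norm_smul, Real.norm_of_nonneg (Real.exp_pos _).le]
  refine (mul_le_mul_of_nonneg_left h (Real.exp_pos _).le).trans_eq ?_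
  rw [fieldBound]
  ring

/-- The condition `p > d`, in the form that makes the singularity at time zero integrable. -/
theorem half_add_lt_one (hdp : (d : ℝ) < p.toReal) : 1 / 2 + (d : ℝ) / (2 * p.toReal) < 1 := by
  have hp0 : 0 < p.toReal := lt_of_le_of_lt (Nat.cast_nonneg d) hdp
  have : (d : ℝ) / (2 * p.toReal) < 1 / 2 := by
    rw [div_lt_div_iff₀ (by positivity) (by norm_num)]
    linarith
  linarith

theorem norm_heatHessian_field_le {η ε R : ℝ} (hη : 0 < η) (hε : 0 < ε) (hR : ε ≤ R)
    (hY : Continuous Y) (hK : ∀ x, ‖Y x‖ ≤ K)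
    (hp1 : 1 ≤ p) (hpt : p < ⊤) (hdp : (d : ℝ) < p.toReal)
    (hYD : HasWeakGradient Y D) (hD : MemLp D p) (hg : AEStronglyMeasurable g)
    (hG : ∀ᵐ y, ‖g y‖ ≤ G) (hw : HasWeakDiv g Y w) (hwp : MemLp w p) {a : Eu d}
    (ha : ‖a‖ = 1) (x : Eu d) :
    ‖heatHessian η ε R g a (Y x) x‖ ≤
      fieldBound d p (eLpNorm D p volume).toReal G (eLpNorm w p volume).toReal *
        timeConst η (1 / 2 + d / (2 * p.toReal)) := by
  have h := norm_intervalIntegral_le_of_norm_le_Ioi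
    ((integrableOn_exp_neg_mul_rpow hη (half_add_lt_one hdp)).const_mul _)
    (fun t ht => norm_exp_smul_hheat_field_le (η := η) hY hK hp1 hpt hdp hYD hD hg hG hw hwp
      ha x ht) hε hR
  rwa [integral_const_mul] at h

theorem exists_tendsto_heatHessian_field {η : ℝ} (hη : 0 < η)
    (hY : Continuous Y) (hK : ∀ x, ‖Y x‖ ≤ K)
    (hp1 : 1 ≤ p) (hpt : p < ⊤) (hdp : (d : ℝ) < p.toReal)
    (hYD : HasWeakGradient Y D) (hD : MemLp D p) (hg : AEStronglyMeasurable g)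
    (hG : ∀ᵐ y, ‖g y‖ ≤ G) (hw : HasWeakDiv g Y w) (hwp : MemLp w p) {a : Eu d}
    (ha : ‖a‖ = 1) (x : Eu d) :
    ∃ L, Tendsto (fun n : ℕ => heatHessian η (1 / ((n : ℝ) + 1)) ((n : ℝ) + 1) g a (Y x) x)
      atTop (𝓝 L) := by
  refine ⟨_, tendsto_intervalIntegral_Ioi ?_⟩
  refine ((integrableOn_exp_neg_mul_rpow hη (half_add_lt_one hdp)).const_mul _).mono'
    (aestronglyMeasurable_time_kernel (measurable_hheat a (Y x)) hg η x)
    (ae_restrict_of_forall_mem measurableSet_Ioi fun t ht =>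
      norm_exp_smul_hheat_field_le (η := η) hY hK hp1 hpt hdp hYD hD hg hG hw hwp ha x ht)

end Field

end Assembly

/-! ### Uniform bounds for a non-degenerate family, and passage to the limit. -/

section Family

variable {d m : ℕ} {g : Eu d → ℂ} {G : ℝ} {p : ℝ≥0∞} {X : Fin m → Eu d → Eu d}
  {D : Fin m → Eu d → (Eu d →L[ℝ] Eu d)} {w : Fin m → Eu d → ℂ} {V N A I : ℝ}

theorem morreyConst_nonneg (hdp : (d : ℝ) < p.toReal) : 0 ≤ morreyConst d p := by
  have hC := heatConst_pos d
  have := half_add_lt_one hdp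
  have : 0 < 1 / 2 - (d : ℝ) / (2 * p.toReal) := by linarith
  unfold morreyConst
  positivity

theorem timeConst_nonneg (η β : ℝ) : 0 ≤ timeConst η β :=
  setIntegral_nonneg measurableSet_Ioi fun t ht => by
    have ht0 : (0 : ℝ) < t := ht
    positivity

/-- The constant multiplying the derivatives along the family in the estimate of the Hessian. -/
noncomputable def hessConst (d : ℕ) (p : ℝ≥0∞) (η : ℝ) : ℝ :=
  d * ((d - 1 : ℕ) : ℝ) * (3 * (d.factorial : ℝ) ^ 4) *
    timeConst η (1 / 2 + d / (2 * p.toReal))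

theorem hessConst_nonneg (d : ℕ) (p : ℝ≥0∞) (η : ℝ) : 0 ≤ hessConst d p η := by
  have := timeConst_nonneg η (1 / 2 + d / (2 * p.toReal))
  unfold hessConst
  positivity

/-- The hypotheses on a family of vector fields and on a function `g`, with explicit bounds. -/
structure FamilyBounds (p : ℝ≥0∞) (X : Fin m → Eu d → Eu d)
    (D : Fin m → Eu d → (Eu d →L[ℝ] Eu d)) (g : Eu d → ℂ) (w : Fin m → Eu d → ℂ)
    (V N G A I : ℝ) : Prop where
  one_le : 1 ≤ p
  lt_top : p < ⊤
  dim_lt : (d : ℝ) < p.toReal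
  continuous : ∀ l, Continuous (X l)
  norm_le : ∀ l x, ‖X l x‖ ≤ V
  hasWeakGradient : ∀ l, HasWeakGradient (X l) (D l)
  memLp : ∀ l, MemLp (D l) p
  eLpNorm_le : ∀ l, (eLpNorm (D l) p volume).toReal ≤ N
  aestronglyMeasurable : AEStronglyMeasurable g
  ae_norm_le : ∀ᵐ y, ‖g y‖ ≤ G
  hasWeakDiv : ∀ l, HasWeakDiv g (X l) (w l)
  memLp_div : ∀ l, MemLp (w l) p
  -- Here `A` bounds `div (g X_l)`, not `∂_{X_l} g`.
  eLpNorm_div_le : ∀ l, (eLpNorm (w l) p volume).toReal ≤ A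
  pos : 0 < I
  -- The tuple depends on `x` without any regularity, which is enough because the algebra is done
  -- pointwise.
  exists_wedge : ∀ x, ∃ Λ : Fin (d - 1) → Fin m, I ^ (d - 1) ≤ ‖wedge fun k => X (Λ k) x‖

namespace FamilyBounds

theorem G_nonneg (h : FamilyBounds p X D g w V N G A I) : 0 ≤ G := by
  obtain ⟨y, hy⟩ := h.ae_norm_le.exists
  exact (norm_nonneg _).trans hy

theorem norm_heatHessian_along_le (h : FamilyBounds p X D g w V N G A I)
    {η ε R : ℝ} (hη : 0 < η) (hε : 0 < ε) (hR : ε ≤ R)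
    (l : Fin m) {a : Eu d} (ha : ‖a‖ = 1) (x : Eu d) :
    ‖heatHessian η ε R g a (X l x) x‖ ≤
      fieldBound d p N G A * timeConst η (1 / 2 + d / (2 * p.toReal)) := by
  refine (norm_heatHessian_field_le hη hε hR (h.continuous l) (h.norm_le l) h.one_le h.lt_top
    h.dim_lt (h.hasWeakGradient l) (h.memLp l) h.aestronglyMeasurable h.ae_norm_le
    (h.hasWeakDiv l) (h.memLp_div l) ha x).trans ?_
  have h1 := morreyConst_nonneg h.dim_lt
  have h2 := h.eLpNorm_le l
  have h3 := h.eLpNorm_div_le l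
  have h4 := h.G_nonneg
  have h5 := heatConst_pos d
  have h6 := timeConst_nonneg η (1 / 2 + d / (2 * p.toReal))
  unfold fieldBound
  gcongr

theorem norm_heatHessian_le (h : FamilyBounds p X D g w V N G A I)
    (hd : 2 ≤ d) {η ε R : ℝ} (hη : 0 < η) (hε : 0 < ε) (hR : ε ≤ R)
    (i j : Fin d) (x : Eu d) :
    ‖heatHessian η ε R g (EuclideanSpace.single i 1) (EuclideanSpace.single j 1) x‖ ≤
      3 * G + hessConst d p η * (V ^ (4 * d - 5) / I ^ (4 * d - 4)) * fieldBound d p N G A := by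
  obtain ⟨Λ, hΛ⟩ := h.exists_wedge x
  have hI := h.pos
  have hW0 : 0 < ‖wedge fun k => X (Λ k) x‖ := lt_of_lt_of_le (by positivity) hΛ
  obtain ⟨a, c, ha, hc, hS⟩ := exists_coeff_of_wedge_ne_zero hd (fun k => X (Λ k) x)
    (fun k => h.norm_le (Λ k) x) (norm_pos_iff.1 hW0)
  have hS' : heatHessian η ε R g (EuclideanSpace.single i 1) (EuclideanSpace.single j 1) x = _ :=
    hS (heatHessianForm hη.le hε hR h.aestronglyMeasurable h.ae_norm_le x)
    (fun a b => heatHessian_comm _ _ _ _ _ _ _) i j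
  simp only [heatHessianForm, LinearMap.mk₂_apply] at hS'
  rw [hS']
  have hV0 : 0 ≤ V := (norm_nonneg _).trans (h.norm_le (Λ ⟨0, by omega⟩) x)
  set T := timeConst η (1 / 2 + d / (2 * p.toReal)) with hT
  have hF0 : 0 ≤ fieldBound d p N G A * T :=
    (norm_nonneg _).trans (h.norm_heatHessian_along_le hη hε hR (Λ ⟨0, by omega⟩)
      (a := EuclideanSpace.single i 1) (by simp) x)
  have hcI : ∀ i j k l, |c i j k l| ≤
      3 * (d.factorial : ℝ) ^ 4 * (V ^ (4 * d - 5) / I ^ (4 * d - 4)) := fun i j k l => by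
    refine (hc i j k l).trans ?_
    -- The fourth power of `|W| ≥ I^{d-1}` explains the exponent `4d - 4`.
    have e : I ^ (4 * d - 4) = (I ^ (d - 1)) ^ 4 := by
      rw [← pow_mul]; congr 1; omega
    rw [e]
    gcongr
  refine (norm_add_le _ _).trans (add_le_add ?_ ?_)
  · rw [norm_smul]
    calc _ ≤ 1 * (3 * G) := by
          gcongr
          · exact ha i j
          · exact norm_sum_heatHessian_le hη hε hR h.aestronglyMeasurable h.ae_norm_le x
      _ = _ := one_mul _
  · have hterm : ∀ k l, ‖c i j k l •
        heatHessian η ε R g (EuclideanSpace.single k 1) (X (Λ l) x) x‖ ≤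
        3 * (d.factorial : ℝ) ^ 4 * (V ^ (4 * d - 5) / I ^ (4 * d - 4)) *
          (fieldBound d p N G A * T) := fun k l => by
      rw [norm_smul]
      exact mul_le_mul (hcI i j k l) (h.norm_heatHessian_along_le hη hε hR (Λ l) (by simp) x)
        (norm_nonneg _) (by positivity)
    refine (norm_sum_le _ _).trans ((Finset.sum_le_sum fun k _ => (norm_sum_le _ _).trans
      (Finset.sum_le_sum fun l _ => hterm k l)).trans_eq ?_)
    simp only [Finset.sum_const, Finset.card_univ, Fintype.card_fin, nsmul_eq_mul, hessConst]
    ring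

/-- For fixed `x` the algebraic decomposition has coefficients independent of `n`. The entries along
the fields converge at every point, by the integrable bound in time; the trace converges where
`e^{tΔ} g(x)` tends to `g(x)`. -/
theorem exists_tendsto_heatHessian (h : FamilyBounds p X D g w V N G A I)
    (hd : 2 ≤ d) {η : ℝ} (hη : 0 < η) :
    ∀ᵐ x, ∀ i j, ∃ L, Tendsto (fun n : ℕ => heatHessian η (1 / ((n : ℝ) + 1)) ((n : ℝ) + 1) g
      (EuclideanSpace.single i 1) (EuclideanSpace.single j 1) x) atTop (𝓝 L) := by
  filter_upwards [ae_tendsto_integral_heat_smul h.aestronglyMeasurable h.ae_norm_le] with x hx i j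
  obtain ⟨Λ, hΛ⟩ := h.exists_wedge x
  have hI := h.pos
  have hW0 : 0 < ‖wedge fun k => X (Λ k) x‖ := lt_of_lt_of_le (by positivity) hΛ
  obtain ⟨a, c, ha, hc, hS⟩ := exists_coeff_of_wedge_ne_zero hd (fun k => X (Λ k) x)
    (fun k => h.norm_le (Λ k) x) (norm_pos_iff.1 hW0)
  have hS' : ∀ n : ℕ, heatHessian η (1 / ((n : ℝ) + 1)) ((n : ℝ) + 1) g
      (EuclideanSpace.single i 1) (EuclideanSpace.single j 1) x = _ := fun n =>
    hS (heatHessianForm hη.le (by positivity) (one_div_add_one_le n) h.aestronglyMeasurable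
      h.ae_norm_le x) (fun a b => heatHessian_comm _ _ _ _ _ _ _) i j
  simp only [heatHessianForm, LinearMap.mk₂_apply] at hS'
  simp only [hS']
  obtain ⟨L, hL⟩ := exists_tendsto_sum_heatHessian hη h.aestronglyMeasurable h.ae_norm_le hx
  choose L' hL' using fun (k : Fin d) (l : Fin (d - 1)) =>
    exists_tendsto_heatHessian_field hη (h.continuous (Λ l)) (h.norm_le (Λ l)) h.one_le h.lt_top
    h.dim_lt (h.hasWeakGradient (Λ l)) (h.memLp (Λ l)) h.aestronglyMeasurable h.ae_norm_le
    (h.hasWeakDiv (Λ l)) (h.memLp_div (Λ l)) (a := EuclideanSpace.single k 1) (by simp) x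
  exact ⟨_, (hL.const_smul _).add (tendsto_finsetSum _ fun k _ => tendsto_finsetSum _ fun l _ =>
    (hL' k l).const_smul _)⟩

end FamilyBounds

theorem aestronglyMeasurable_heatHessian {η ε R : ℝ} (hη : 0 ≤ η) (hε : 0 < ε) (hR : ε ≤ R)
    (hg : AEStronglyMeasurable g) (hG : ∀ᵐ y, ‖g y‖ ≤ G) (a b : Eu d) :
    AEStronglyMeasurable fun x => heatHessian η ε R g a b x := by
  simp only [heatHessian_eq_integral_hessKernel hη hε hR hg hG]
  have h1 : Measurable fun q : Eu d × Eu d => hessKernel η ε R a b (q.1 - q.2) :=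
    (measurable_hessKernel hR a b).comp (measurable_fst.sub measurable_snd)
  have h2 : AEStronglyMeasurable (fun q : Eu d × Eu d => hessKernel η ε R a b (q.1 - q.2) • g q.2)
      ((volume : Measure (Eu d)).prod volume) := h1.aestronglyMeasurable.smul hg.comp_snd
  exact h2.integral_prod_right'

/-- The limit of the boundary terms of `integral_mul_heatHessian`; `η > 0` removes the one at
infinity. -/
theorem tendsto_integral_mul_heat (hg : AEStronglyMeasurable g) (hG : ∀ᵐ y, ‖g y‖ ≤ G)
    (ψ : 𝓢(Eu d, ℂ)) {η : ℝ} (hη : 0 < η) :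
    Tendsto (fun n : ℕ =>
      Real.exp (-(η * (1 / ((n : ℝ) + 1)))) •
        (∫ x, ψ x * ∫ y, heat (1 / ((n : ℝ) + 1)) (x - y) • g y) -
      Real.exp (-(η * ((n : ℝ) + 1))) • ∫ x, ψ x * ∫ y, heat ((n : ℝ) + 1) (x - y) • g y)
      atTop (𝓝 (∫ x, ψ x * g x)) := by
  have hm : ∀ t, 0 < t → AEStronglyMeasurable fun x => ∫ y, heat t (x - y) • g y := fun t _ => by
    have h1 : Continuous fun q : Eu d × Eu d => heat t (q.1 - q.2) :=
      (continuous_heat t).comp (continuous_fst.sub continuous_snd)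
    have h2 : AEStronglyMeasurable (fun q : Eu d × Eu d => heat t (q.1 - q.2) • g q.2)
      ((volume : Measure (Eu d)).prod volume) := h1.aestronglyMeasurable.smul hg.comp_snd
    exact h2.integral_prod_right'
  have hb : ∀ t, 0 < t → ∀ x, ‖ψ x * ∫ y, heat t (x - y) • g y‖ ≤ ‖ψ x‖ * G := fun t ht x => by
    rw [norm_mul]
    gcongr
    exact norm_integral_heat_smul_le hG ht x
  have hi : Integrable fun x => ‖ψ x‖ * G := ψ.integrable.norm.mul_const G
  have h1 : Tendsto (fun n : ℕ => ∫ x, ψ x * ∫ y, heat (1 / ((n : ℝ) + 1)) (x - y) • g y) atTop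
      (𝓝 (∫ x, ψ x * g x)) := by
    apply tendsto_integral_of_dominated_convergence (fun x => ‖ψ x‖ * G)
    · exact fun n => ψ.continuous.aestronglyMeasurable.mul (hm _ (by positivity))
    · exact hi
    · exact fun n => Eventually.of_forall (hb _ (by positivity))
    · filter_upwards [ae_tendsto_integral_heat_smul hg hG] with x hx
      exact (hx.comp tendsto_one_div_add_one_nhdsGT).const_mul _
  have h2 : Tendsto (fun n : ℕ => Real.exp (-(η * ((n : ℝ) + 1))) •
      ∫ x, ψ x * ∫ y, heat ((n : ℝ) + 1) (x - y) • g y) atTop (𝓝 0) := by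
    refine squeeze_zero_norm
      (a := fun n : ℕ => Real.exp (-(η * ((n : ℝ) + 1))) * ∫ x, ‖ψ x‖ * G) (fun n => ?_)
      (by simpa using (tendsto_exp_neg_mul_add_one hη).mul_const (∫ x, ‖ψ x‖ * G))
    rw [norm_smul, Real.norm_of_nonneg (Real.exp_pos _).le]
    gcongr
    exact norm_integral_le_of_norm_le hi (Eventually.of_forall (hb _ (by positivity)))
  simpa using ((tendsto_exp_neg_mul_one_div η).smul h1).sub h2

/-- Existence of a bounded Hessian, from a uniform bound and almost everywhere convergence of its
regularisations. -/
theorem exists_boundedHessian {η : ℝ} (hη : 0 < η) (hg : MemLp g ⊤ volume)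
    (hG : ∀ᵐ y, ‖g y‖ ≤ G) {M : ℝ}
    (hM : ∀ (n : ℕ) i j x, ‖heatHessian η (1 / ((n : ℝ) + 1)) ((n : ℝ) + 1) g
      (EuclideanSpace.single i 1) (EuclideanSpace.single j 1) x‖ ≤ M)
    (hlim : ∀ᵐ x, ∀ i j, ∃ L, Tendsto (fun n : ℕ => heatHessian η (1 / ((n : ℝ) + 1))
      ((n : ℝ) + 1) g (EuclideanSpace.single i 1) (EuclideanSpace.single j 1) x) atTop (𝓝 L)) :
    ∃ H : Eu d → EuclideanSpace ℂ (Fin d × Fin d),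
      IsBoundedHessian (helmholtzInv η (Lp.toTemperedDistribution (hg.toLp g))) H ∧
      eLpNorm H ⊤ volume ≤ ENNReal.ofReal (d * M) := by
  have hpos : ∀ n : ℕ, 0 < 1 / ((n : ℝ) + 1) := fun n => by positivity
  set S : ℕ → Fin d → Fin d → Eu d → ℂ := fun n i j x =>
    heatHessian η (1 / ((n : ℝ) + 1)) ((n : ℝ) + 1) g
      (EuclideanSpace.single i 1) (EuclideanSpace.single j 1) x with hS
  have hSm : ∀ n i j, AEStronglyMeasurable (S n i j) := fun n i j =>
    aestronglyMeasurable_heatHessian hη.le (hpos n) (one_div_add_one_le n) hg.1 hG _ _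
  set L : Fin d → Fin d → Eu d → ℂ := fun i j x => limUnder atTop fun n => S n i j x with hL
  have hSL : ∀ᵐ x, ∀ i j, Tendsto (fun n => S n i j x) atTop (𝓝 (L i j x)) := by
    filter_upwards [hlim] with x hx i j
    exact tendsto_nhds_limUnder (hx i j)
  have hLm : ∀ i j, AEStronglyMeasurable (L i j) := fun i j =>
    aestronglyMeasurable_of_tendsto_ae atTop (fun n => hSm n i j)
      (hSL.mono fun x hx => hx i j)
  set H : Eu d → EuclideanSpace ℂ (Fin d × Fin d) := fun x =>
    WithLp.toLp 2 fun q => L q.1 q.2 x with hH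
  have hHm : AEStronglyMeasurable H := by
    have h1 : AEMeasurable fun x => fun q : Fin d × Fin d => L q.1 q.2 x :=
      aemeasurable_pi_lambda _ fun q => (hLm q.1 q.2).aemeasurable
    exact ((MeasurableEquiv.toLp 2 (Fin d × Fin d → ℂ)).measurable.comp_aemeasurable
      h1).aestronglyMeasurable
  have hHb : ∀ᵐ x, ‖H x‖ ≤ d * M := by
    filter_upwards [hSL] with x hx
    have hM0 : ∀ _ : Fin d, 0 ≤ M := fun i => (norm_nonneg _).trans (hM 0 i i x)
    have h1 : ∀ q : Fin d × Fin d, ‖H x q‖ ≤ M := fun q =>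
      le_of_tendsto (hx q.1 q.2).norm (Eventually.of_forall fun n => hM n q.1 q.2 x)
    -- In dimension `0` there is no entry from which to deduce `0 ≤ M`, but then `H` vanishes.
    -- Otherwise `d²` entries bounded by `M` give a Hilbert-Schmidt norm at most `d M`.
    rcases Nat.eq_zero_or_pos d with hd | hd
    · subst hd
      have : H x = 0 := Subsingleton.elim _ _
      simp [this]
    · have hM1 := hM0 ⟨0, hd⟩
      rw [EuclideanSpace.norm_eq]
      apply Real.sqrt_le_iff.2 ⟨by positivity, ?_⟩
      calc ∑ q, ‖H x q‖ ^ 2 ≤ ∑ q : Fin d × Fin d, M ^ 2 := by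
            gcongr with q
            exact h1 q
        _ = _ := by simp; ring
  have hHn : eLpNorm H ⊤ volume ≤ ENNReal.ofReal (d * M) := by
    rw [eLpNorm_exponent_top]
    exact eLpNormEssSup_le_of_ae_bound hHb
  refine ⟨H, ⟨⟨hHm, hHn.trans_lt ENNReal.ofReal_lt_top⟩, fun i j φ => ?_⟩, hHn⟩
  -- Transposition reverses the order of the two derivatives and produces two signs, which cancel;
  -- the symmetry of `heatHessian` restores the order at the end.
  obtain ⟨ψ, hψ, hT⟩ := exists_schwartz_resolvent hη
    (∂_{(EuclideanSpace.single j 1 : Eu d)} (∂_{(EuclideanSpace.single i 1 : Eu d)} φ))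
  simp only [TemperedDistribution.lineDerivOp_apply_apply, LineDeriv.lineDerivOp_neg, neg_neg]
  rw [hT, Lp.toTemperedDistribution_apply]
  have h1 : ∫ x, ψ x • (hg.toLp g : Eu d → ℂ) x = ∫ x, ψ x * g x := by
    refine integral_congr_ae ?_
    filter_upwards [hg.coeFn_toLp] with x hx
    rw [hx, smul_eq_mul]
  rw [h1]
  have l1 := tendsto_integral_mul_heat hg.1 hG ψ hη
  have l2 : Tendsto (fun n => ∫ x, φ x * S n i j x) atTop (𝓝 (∫ x, φ x * H x (i, j))) := by
    apply tendsto_integral_of_dominated_convergence (fun x => ‖φ x‖ * M)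
    · exact fun n => φ.continuous.aestronglyMeasurable.mul (hSm n i j)
    · exact φ.integrable.norm.mul_const M
    · refine fun n => Eventually.of_forall fun x => ?_
      rw [norm_mul]
      gcongr
      exact hM n i j x
    · filter_upwards [hSL] with x hx
      exact (hx i j).const_mul _
  -- For each `n` both sequences are the same pairing, seen once through its boundary terms and once
  -- through the Hessian itself.
  refine tendsto_nhds_unique l1 (l2.congr fun n => ?_)
  rw [← integral_mul_heatHessian hη.le (hpos n) (one_div_add_one_le n) hg.1 hG hψ]
  simp only [hS, heatHessian_comm _ _ _ _ (EuclideanSpace.single i 1)]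

end Family

/-! ### Uniqueness of weak derivatives, and the quantities in the statement. -/

section Uniqueness

variable {d : ℕ} {p : ℝ≥0∞}

theorem HasWeakGradient.ae_eq {Y : Eu d → Eu d} {D D' : Eu d → (Eu d →L[ℝ] Eu d)}
    (h : HasWeakGradient Y D) (h' : HasWeakGradient Y D') : D =ᵐ[volume] D' := by
  have hloc : ∀ {D : Eu d → (Eu d →L[ℝ] Eu d)}, LocallyIntegrable D volume → ∀ v,
      LocallyIntegrable (fun x => D x v) volume := fun hD v x => by
    obtain ⟨s, hs, hi⟩ := hD x
    exact ⟨s, hs, (ContinuousLinearMap.apply ℝ (Eu d) v).integrable_comp hi⟩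
  have h1 : ∀ i : Fin d, ∀ᵐ x, D x (EuclideanSpace.single i 1) = D' x (EuclideanSpace.single i 1) :=
    fun i => ae_eq_of_integral_contDiff_smul_eq (hloc h.2.1 _) (hloc h'.2.1 _)
      fun φ hφ hs => neg_injective ((h.2.2 φ hφ hs _).symm.trans (h'.2.2 φ hφ hs _))
  filter_upwards [ae_all_iff.2 h1] with x hx
  apply ContinuousLinearMap.coe_injective
  refine (EuclideanSpace.basisFun (Fin d) ℝ).toBasis.ext fun i => ?_
  simpa using hx i

/-- `weakGradient` is an arbitrary choice, whereas the hypothesis speaks of some gradient in `L^p`;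
uniqueness almost everywhere reconciles them. -/
theorem MemLInfP.weakGradient_spec {Y : Eu d → Eu d} (h : MemLInfP p Y) :
    HasWeakGradient Y (weakGradient Y) ∧ MemLp (weakGradient Y) p volume := by
  obtain ⟨D, hD, hp⟩ := h.2.2
  have hex : ∃ D, HasWeakGradient Y D := ⟨D, hD⟩
  have h1 : HasWeakGradient Y (weakGradient Y) := by
    rw [weakGradient, dif_pos hex]
    exact hex.choose_spec
  exact ⟨h1, hp.ae_eq (hD.ae_eq h1)⟩

theorem HasWeakDiv.ae_eq {g : Eu d → ℂ} {Y : Eu d → Eu d} {w w' : Eu d → ℂ}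
    (h : HasWeakDiv g Y w) (h' : HasWeakDiv g Y w') : w =ᵐ[volume] w' :=
  ae_eq_of_integral_contDiff_smul_eq h.2.1 h'.2.1
    fun φ hφ hs => neg_injective ((h.2.2 φ hφ hs).symm.trans (h'.2.2 φ hφ hs))

theorem MemLAlong.weakDiv_spec {g : Eu d → ℂ} {Y : Eu d → Eu d} (h : MemLAlong p Y g) :
    HasWeakDiv g Y (weakDiv g Y) ∧ MemLp (weakDiv g Y) p volume := by
  obtain ⟨w, hw, hp⟩ := h.2
  have hex : ∃ w, HasWeakDiv g Y w := ⟨w, hw⟩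
  have h1 : HasWeakDiv g Y (weakDiv g Y) := by
    rw [weakDiv, dif_pos hex]
    exact hex.choose_spec
  exact ⟨h1, hp.ae_eq (hw.ae_eq h1)⟩

theorem abs_trace_le (T : Eu d →L[ℝ] Eu d) :
    |LinearMap.trace ℝ (Eu d) (T : Eu d →ₗ[ℝ] Eu d)| ≤ d * ‖T‖ := by
  rw [LinearMap.trace_eq_sum_inner _ (EuclideanSpace.basisFun (Fin d) ℝ)]
  refine (Finset.abs_sum_le_sum_abs _ _).trans ((Finset.sum_le_sum fun i _ => ?_).trans_eq
    (by simp : ∑ _i : Fin d, ‖T‖ = d * ‖T‖))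
  refine (abs_real_inner_le_norm _ _).trans ?_
  have h := T.le_opNorm ((EuclideanSpace.basisFun (Fin d) ℝ) i)
  simpa using h

/-- The divergence `div (g Y)` is controlled by `∂_Y g`, `g` and the gradient of `Y`. -/
theorem eLpNorm_weakDiv_le (hp1 : 1 ≤ p) {g : Eu d → ℂ} {Y : Eu d → Eu d} {G : ℝ} (hG0 : 0 ≤ G)
    (hG : ∀ᵐ y, ‖g y‖ ≤ G) (hg : AEStronglyMeasurable g) (hY : MemLInfP p Y)
    (hgY : MemLAlong p Y g) :
    MemLp (derivAlong Y g) p volume ∧ (eLpNorm (weakDiv g Y) p volume).toReal ≤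
      (eLpNorm (derivAlong Y g) p volume).toReal +
        d * G * (eLpNorm (weakGradient Y) p volume).toReal := by
  have hD := hY.weakGradient_spec.2
  have hw := hgY.weakDiv_spec.2
  set q : Eu d → ℂ := fun x =>
    g x * ((LinearMap.trace ℝ (Eu d) (weakGradient Y x : Eu d →ₗ[ℝ] Eu d) : ℝ) : ℂ) with hq
  have hqm : AEStronglyMeasurable q := by
    have hc : Continuous fun T : Eu d →L[ℝ] Eu d =>
        ((LinearMap.trace ℝ (Eu d) (T : Eu d →ₗ[ℝ] Eu d) : ℝ) : ℂ) :=
      Complex.continuous_ofReal.comp (LinearMap.continuous_of_finiteDimensional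
        ((LinearMap.trace ℝ (Eu d)).comp (ContinuousLinearMap.coeLM ℝ)))
    exact hg.mul (hc.comp_aestronglyMeasurable hD.1)
  have hqb : ∀ᵐ x, ‖q x‖ ≤ (d * G) * ‖weakGradient Y x‖ := by
    filter_upwards [hG] with x hx
    rw [hq, norm_mul, Complex.norm_real]
    calc _ ≤ G * (d * ‖weakGradient Y x‖) :=
          mul_le_mul hx (abs_trace_le _) (abs_nonneg _) hG0
      _ = _ := by ring
  have hqn : eLpNorm q p volume ≤ ENNReal.ofReal (d * G) * eLpNorm (weakGradient Y) p volume :=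
    eLpNorm_le_mul_eLpNorm_of_ae_le_mul hqb p
  have hqp : MemLp q p volume :=
    ⟨hqm, hqn.trans_lt (ENNReal.mul_lt_top ENNReal.ofReal_lt_top hD.2)⟩
  have hdp : MemLp (derivAlong Y g) p volume := hw.sub hqp
  refine ⟨hdp, ?_⟩
  have hsum : weakDiv g Y = derivAlong Y g + q := by
    ext x
    simp [derivAlong, hq]
  have h1 : eLpNorm (weakDiv g Y) p volume ≤ eLpNorm (derivAlong Y g) p volume +
      ENNReal.ofReal (d * G) * eLpNorm (weakGradient Y) p volume := by
    conv_lhs => rw [hsum]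
    exact (eLpNorm_add_le hdp.1 hqm hp1).trans (by gcongr)
  have h2 := ENNReal.mul_lt_top (ENNReal.ofReal_lt_top (r := d * G)) hD.2
  refine (ENNReal.toReal_mono (ENNReal.add_lt_top.2 ⟨hdp.2, h2⟩).ne h1).trans_eq ?_
  rw [ENNReal.toReal_add hdp.2.ne h2.ne, ENNReal.toReal_mul,
    ENNReal.toReal_ofReal (by positivity)]

/-- The fields are frozen at every point, so an almost everywhere bound is not enough. The set where
it holds is dense, having full measure, and closed by continuity. -/
theorem enorm_le_eLpNorm_top_of_continuous {Y : Eu d → Eu d} (hY : Continuous Y) (x : Eu d) :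
    ‖Y x‖ₑ ≤ eLpNorm Y ⊤ volume := by
  have h1 : ∀ᵐ y, ‖Y y‖ₑ ≤ eLpNorm Y ⊤ volume := by
    rw [eLpNorm_exponent_top]
    exact ae_le_eLpNormEssSup
  have h2 : Dense {y | ‖Y y‖ₑ ≤ eLpNorm Y ⊤ volume} := Measure.dense_of_ae h1
  have h3 : IsClosed {y | ‖Y y‖ₑ ≤ eLpNorm Y ⊤ volume} :=
    isClosed_le hY.enorm continuous_const
  have h4 := h2.closure_eq
  rw [h3.closure_eq] at h4
  have : x ∈ {y | ‖Y y‖ₑ ≤ eLpNorm Y ⊤ volume} := h4 ▸ Set.mem_univ x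
  exact this

/-- The supremum runs over finitely many tuples and is attained; the power `d - 1` undoes the root
in `nonDegeneracy`. -/
theorem exists_wedge_of_nonDegeneracy {m : ℕ} (hd : 2 ≤ d) (hm : d - 1 ≤ m)
    {X : Fin m → Eu d → Eu d} (hX : 0 < nonDegeneracy X) (x : Eu d) :
    ∃ Λ : Fin (d - 1) → Fin m,
      nonDegeneracy X ^ (d - 1) ≤ ‖wedge fun k => X (Λ k) x‖ := by
  have : Nonempty (Fin (d - 1) ↪o Fin m) := ⟨Fin.castLEOrderEmb hm⟩
  have hbdd : BddBelow (Set.range fun x : Eu d => ⨆ Λ : Fin (d - 1) ↪o Fin m,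
      ‖wedge (fun k => X (Λ k) x)‖ ^ (1 / ((d : ℝ) - 1))) :=
    ⟨0, by
      rintro _ ⟨y, rfl⟩
      exact Real.iSup_nonneg fun Λ => by positivity⟩
  have h1 : nonDegeneracy X ≤ ⨆ Λ : Fin (d - 1) ↪o Fin m,
      ‖wedge (fun k => X (Λ k) x)‖ ^ (1 / ((d : ℝ) - 1)) := ciInf_le hbdd x
  obtain ⟨Λ, hΛ⟩ := exists_eq_ciSup_of_finite (f := fun Λ : Fin (d - 1) ↪o Fin m =>
    ‖wedge (fun k => X (Λ k) x)‖ ^ (1 / ((d : ℝ) - 1)))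
  refine ⟨Λ, ?_⟩
  rw [← hΛ] at h1
  have hd1 : ((d - 1 : ℕ) : ℝ) = (d : ℝ) - 1 := by
    rw [Nat.cast_sub (by omega), Nat.cast_one]
  have hd0 : (d : ℝ) - 1 ≠ 0 := by
    rw [← hd1]
    exact Nat.cast_ne_zero.2 (by omega)
  calc nonDegeneracy X ^ (d - 1)
      ≤ (‖wedge (fun k => X (Λ k) x)‖ ^ (1 / ((d : ℝ) - 1))) ^ (d - 1) := by gcongr
    _ = _ := by
      rw [← Real.rpow_natCast, ← Real.rpow_mul (norm_nonneg _), hd1, one_div_mul_cancel hd0,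
        Real.rpow_one]

theorem iSup_ne_top_of_finite {ι : Type*} [Finite ι] [Nonempty ι] {f : ι → ℝ≥0∞}
    (hf : ∀ i, f i ≠ ⊤) : ⨆ i, f i ≠ ⊤ := by
  obtain ⟨i, hi⟩ := exists_eq_ciSup_of_finite (f := f)
  rw [← hi]
  exact hf i

end Uniqueness

/-! ### The main estimate. -/

theorem propositionp (d : ℕ) (hd : 2 ≤ d) (p : ℝ≥0∞) (hp : (d : ℝ≥0∞) < p) (hp' : p < ⊤)
    (η : ℝ) (hη : 0 < η) :
    ∃ C : ℝ≥0, 0 < C ∧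
      ∀ (m : ℕ), d - 1 ≤ m →
      ∀ X : Fin m → Eu d → Eu d, (∀ l, MemLInfP p (X l)) → 0 < nonDegeneracy X →
      ∀ (g : Eu d → ℂ) (hg : MemLp g ⊤ volume), (∀ l, MemLAlong p (X l) g) →
        ∃ H : Eu d → EuclideanSpace ℂ (Fin d × Fin d),
          IsBoundedHessian
            (helmholtzInv η (Lp.toTemperedDistribution (hg.toLp g))) H ∧
          eLpNorm H ⊤ volume ≤
            C * ((1 + (⨆ l, eLpNorm (X l) ⊤ volume) ^ (4 * d - 5) *
                    (⨆ l, eLpNorm (weakGradient (X l)) p volume) /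
                    ENNReal.ofReal (nonDegeneracy X) ^ (4 * d - 4)) *
                  eLpNorm g ⊤ volume +
                (⨆ l, eLpNorm (X l) ⊤ volume) ^ (4 * d - 5) /
                    ENNReal.ofReal (nonDegeneracy X) ^ (4 * d - 4) *
                  (⨆ l, eLpNorm (derivAlong (X l) g) p volume)) := by
  have hp1 : 1 ≤ p := by
    refine le_trans ?_ hp.le
    exact_mod_cast (by omega : 1 ≤ d)
  have hdp : (d : ℝ) < p.toReal := by
    have := (ENNReal.toReal_lt_toReal (ENNReal.natCast_ne_top d) hp'.ne).2 hp
    simpa using this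
  have hM0 := morreyConst_nonneg hdp
  have hC0 := (heatConst_pos d).le
  have hE0 := hessConst_nonneg d p η
  -- The `3` comes from the trace. In the last factor, `morreyConst d p` comes from the commutator,
  -- `d` from `|div X_l| ≤ d ‖∇X_l‖`, and `1` from `∂_{X_l} g`. The final constant `d * c` has a
  -- further `d` for the Hilbert-Schmidt norm.
  set c : ℝ := 3 + hessConst d p η * heatConst d * (morreyConst d p + d + 1) with hc
  have hcpos : 0 < c := by positivity
  have hd0 : (0 : ℝ) < d := Nat.cast_pos.2 (by omega)
  refine ⟨(d * c).toNNReal, Real.toNNReal_pos.2 (by positivity), ?_⟩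
  intro m hm X hX hI g hg hgX
  have : Nonempty (Fin m) := ⟨⟨0, by omega⟩⟩
  set I := nonDegeneracy X with hId
  have hVt : (⨆ l, eLpNorm (X l) ⊤ volume) ≠ ⊤ := iSup_ne_top_of_finite fun l => by
    obtain ⟨K, hK⟩ := (hX l).2.1
    exact (memLp_top_of_bound (hX l).1.aestronglyMeasurable K (Eventually.of_forall hK)).2.ne
  have hNt : (⨆ l, eLpNorm (weakGradient (X l)) p volume) ≠ ⊤ :=
    iSup_ne_top_of_finite fun l => (hX l).weakGradient_spec.2.2.ne
  have hGt : eLpNorm g ⊤ volume ≠ ⊤ := hg.2.ne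
  have hG : ∀ᵐ y, ‖g y‖ ≤ (eLpNorm g ⊤ volume).toReal := by
    have h1 : ∀ᵐ y, ‖g y‖ₑ ≤ eLpNorm g ⊤ volume := by
      rw [eLpNorm_exponent_top]
      exact ae_le_eLpNormEssSup
    filter_upwards [h1] with y hy
    have := ENNReal.toReal_mono hGt hy
    rwa [toReal_enorm] at this
  have hdiv := fun l => eLpNorm_weakDiv_le hp1 ENNReal.toReal_nonneg hG hg.1 (hX l) (hgX l)
  have hAt : (⨆ l, eLpNorm (derivAlong (X l) g) p volume) ≠ ⊤ :=
    iSup_ne_top_of_finite fun l => (hdiv l).1.2.ne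
  set V := (⨆ l, eLpNorm (X l) ⊤ volume).toReal with hV
  set N := (⨆ l, eLpNorm (weakGradient (X l)) p volume).toReal with hN
  set G := (eLpNorm g ⊤ volume).toReal with hGd
  set A := (⨆ l, eLpNorm (derivAlong (X l) g) p volume).toReal with hA
  have hV0 : 0 ≤ V := ENNReal.toReal_nonneg
  have hN0 : 0 ≤ N := ENNReal.toReal_nonneg
  have hG0 : 0 ≤ G := ENNReal.toReal_nonneg
  have hA0 : 0 ≤ A := ENNReal.toReal_nonneg
  have hNl : ∀ l, (eLpNorm (weakGradient (X l)) p volume).toReal ≤ N := fun l =>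
    ENNReal.toReal_mono hNt (le_iSup (fun l => eLpNorm (weakGradient (X l)) p volume) l)
  -- Since `div (g X_l) = ∂_{X_l} g + g div X_l`, the divergences are bounded by `A + d G N`.
  have hfam : FamilyBounds p X (fun l => weakGradient (X l)) g (fun l => weakDiv g (X l))
      V N G (A + d * G * N) I :=
    { one_le := hp1
      lt_top := hp'
      dim_lt := hdp
      continuous := fun l => (hX l).1
      norm_le := fun l x => by
        have := ENNReal.toReal_mono hVt ((enorm_le_eLpNorm_top_of_continuous (hX l).1 x).trans
          (le_iSup (fun l => eLpNorm (X l) ⊤ volume) l))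
        rwa [toReal_enorm] at this
      hasWeakGradient := fun l => (hX l).weakGradient_spec.1
      memLp := fun l => (hX l).weakGradient_spec.2
      eLpNorm_le := hNl
      aestronglyMeasurable := hg.1
      ae_norm_le := hG
      hasWeakDiv := fun l => (hgX l).weakDiv_spec.1
      memLp_div := fun l => (hgX l).weakDiv_spec.2
      eLpNorm_div_le := fun l => by
        refine (hdiv l).2.trans ?_
        gcongr
        · exact ENNReal.toReal_mono hAt
            (le_iSup (fun l => eLpNorm (derivAlong (X l) g) p volume) l)
        · exact hNl l
      pos := hI
      exists_wedge := exists_wedge_of_nonDegeneracy hd hm hI }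
  obtain ⟨H, hH, hHn⟩ := exists_boundedHessian hη hg hG
    (fun n i j x => hfam.norm_heatHessian_le hd hη (by positivity) (one_div_add_one_le n) i j x)
    (hfam.exists_tendsto_heatHessian hd hη)
  refine ⟨H, hH, hHn.trans ?_⟩
  set Q := V ^ (4 * d - 5) / I ^ (4 * d - 4) with hQ
  have hQ0 : 0 ≤ Q := by positivity
  have hreal : d * (3 * G + hessConst d p η * Q * fieldBound d p N G (A + d * G * N)) ≤
      d * c * ((1 + V ^ (4 * d - 5) * N / I ^ (4 * d - 4)) * G + Q * A) := by
    have e1 : V ^ (4 * d - 5) * N / I ^ (4 * d - 4) = Q * N := by rw [hQ]; ring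
    rw [e1, mul_assoc (d : ℝ) c]
    refine mul_le_mul_of_nonneg_left ?_ hd0.le
    unfold fieldBound
    set k := hessConst d p η * heatConst d with hk
    have hk0 : 0 ≤ k := by positivity
    have e2 : 3 * G + hessConst d p η * Q *
        (heatConst d * (morreyConst d p * N * G + (A + d * G * N))) =
        3 * G + k * (morreyConst d p + d) * (Q * N * G) + k * (Q * A) := by
      rw [hk]; ring
    rw [e2, hc]
    have h1 : 0 ≤ Q * N * G := by positivity
    have h2 : 0 ≤ Q * A := by positivity
    have h3 : 0 ≤ k * (morreyConst d p + d + 1) * G := by positivity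
    have h4 : 0 ≤ k * (Q * N * G) := by positivity
    have h5 : 0 ≤ k * (morreyConst d p + d) * (Q * A) := by positivity
    nlinarith
  refine (ENNReal.ofReal_le_ofReal hreal).trans_eq ?_
  have hW0 : 0 ≤ V ^ (4 * d - 5) * N / I ^ (4 * d - 4) := by positivity
  have hIpos : 0 < I ^ (4 * d - 4) := pow_pos hI _
  have e3 : ENNReal.ofReal (d * c * ((1 + V ^ (4 * d - 5) * N / I ^ (4 * d - 4)) * G + Q * A)) =
      ENNReal.ofReal (d * c) * ((1 + ENNReal.ofReal V ^ (4 * d - 5) * ENNReal.ofReal N /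
        ENNReal.ofReal I ^ (4 * d - 4)) * ENNReal.ofReal G +
          ENNReal.ofReal V ^ (4 * d - 5) / ENNReal.ofReal I ^ (4 * d - 4) *
            ENNReal.ofReal A) := by
    rw [ENNReal.ofReal_mul (by positivity : 0 ≤ (d : ℝ) * c),
      ENNReal.ofReal_add (by positivity) (by positivity),
      ENNReal.ofReal_mul (add_nonneg zero_le_one hW0), ENNReal.ofReal_mul hQ0,
      ENNReal.ofReal_add zero_le_one hW0, hQ, ENNReal.ofReal_div_of_pos hIpos,
      ENNReal.ofReal_div_of_pos hIpos, ENNReal.ofReal_mul (by positivity : 0 ≤ V ^ (4 * d - 5)),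
      ENNReal.ofReal_pow hV0, ENNReal.ofReal_pow hI.le, ENNReal.ofReal_one]
  rw [e3, hV, hN, hGd, hA, ENNReal.ofReal_toReal hVt, ENNReal.ofReal_toReal hNt,
    ENNReal.ofReal_toReal hGt, ENNReal.ofReal_toReal hAt]
  rfl
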